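/- **Conventions.** Work in one of the following settings: real Lie groups and manifolds, smooth or analytic; complex Lie groups and complex manifolds; affine algebraic groups and affine varieties (schemes) over a field of characteristic zero. Let $G$ be a group in this setting, with Lie algebra $\mathfrak g$, and let $\bullet$ be an $\mathrm{Ad}$-invariant symmetric bilinear form on $\mathfrak g$, possibly degenerate. Let $\omega$ and $\bar\omega$ be the left and right invariant Maurer–Cartan forms of $G$, $\omega_q(v)=q^{-1}v$, $\bar\omega_q(v)=vq^{-1}$, and let $\lambda^{\bullet}=\tfrac1{12}[\omega,\omega]\bullet\omega$, where $([\omega,\omega]\bullet\omega)(v_1,v_2,v_3)=\sum_{\pi\in S_3}\mathrm{sign}(\pi)\,[\omega(v_{\pi 1}),\omega(v_{\pi 2})]\bullet\omega(v_{\pi 3})$. Let $M$ be a $G$-manifold, and for $X\in\mathfrak g$ write $X_M(m)=\tfrac{d}{dt}\big|_{0}\exp(-tX)m$. Let $G$ act on itself by conjugation, let $\Phi\colon M\to G$ be a $G$-equivariant map, and let $\sigma$ be a $G$-invariant $2$-form on $M$. * $\Phi$ is a *$G$-momentum mapping for $\sigma$ relative to $\bullet$* if $\sigma(X_M,v)=\tfrac12\,X\bullet\big(\Phi^{-1}d\Phi(v)+d\Phi(v)\Phi^{-1}\big)$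 for all $X\in\mathfrak g$ and all tangent vectors $v$. * $\sigma$ is *$\Phi$-quasi closed relative to $\bullet$* if $d\sigma=\Phi^*\lambda^{\bullet}$. * $\sigma$ is *$\Phi$-non-degenerate* if the morphism $(\sigma^\flat,d\Phi)\colon TM\to T^*M\oplus T_\Phi G$ of vector bundles on $M$ is a monomorphism, i.e. injective on every fibre. Here $T_\Phi G$ is the pullback of $TG$ along $\Phi$. In the algebraic setting this is required at all points with values in commutative algebras over the ground field. **Proposition.** Let $\widetilde G$ be a second copy of $G$, and let $\widetilde{\bullet}$ be the form $\bullet$ on its Lie algebra. Let $G\times\widetilde G$ act on $G\times G$ by $$(x,y)\cdot(q_1,q_2)=(xq_1y^{-1},\,yq_2x^{-1}),$$ and let $$\Phi=(\mathrm{mult},\widetilde{\mathrm{mult}})\colon G\times G\to G\times\widetilde G,\qquad (q_1,q_2)\mapsto(q_1q_2,\;q_1^{-1}q_2^{-1}).$$ Let $\sigma^\times=-\tfrac12(\omega_1\bullet\bar\omega_2+\bar\omega_1\bullet\omega_2)$ on $G\times G$, where the index $j$ means pullback along the projection to the $j$-th factor and $(\alpha\bullet\beta)(u,v)=\alpha(u)\bullet\beta(v)-\alpha(v)\bullet\beta(u)$.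 Then: 1. $\sigma^\times$ is $(G\times\widetilde G)$-invariant, $\Phi$ is $(G\times\widetilde G)$-equivariant, and $\Phi$ is a $(G\times\widetilde G)$-momentum mapping for $\sigma^\times$ relative to the form $\bullet+\widetilde{\bullet}$ on $\mathfrak g\oplus\widetilde{\mathfrak g}$. 2. $\sigma^\times$ is $\Phi$-quasi closed relative to $\bullet+\widetilde{\bullet}$, i.e. $d\sigma^\times=\Phi^*\lambda^{\bullet+\widetilde{\bullet}}$. 3. If $\bullet$ is non-degenerate, then $\sigma^\times$ is $\Phi$-non-degenerate. -/

import Mathlib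

open scoped Manifold ContDiff TensorProduct

noncomputable section

namespace QuasiHam

namespace Lie

open Set

section Forms
variable {𝕜 : Type*} [RCLike 𝕜] {E : Type*} [NormedAddCommGroup E] [NormedSpace 𝕜 E]
  {H : Type*} [TopologicalSpace H] (I : ModelWithCorners 𝕜 E H)
  {M : Type*} [TopologicalSpace M] [ChartedSpace H M]

/-- A (not necessarily continuous) field of alternating `k`-forms on the tangent spaces of `M`. -/
abbrev FormField (M : Type*) [TopologicalSpace M] [ChartedSpace H M] (k : ℕ) : Type _ :=
  (x : M) → TangentSpace I x [⋀^Fin k]→L[𝕜] 𝕜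

variable {I}

/-- The local expression of a form field in the preferred chart at `x₀`: its pullback along the
inverse chart to (an open subset of the range of `I` in) the model vector space. -/
def FormField.inChart {k : ℕ} (σ : FormField I M k) (x₀ : M) (y : E) : E [⋀^Fin k]→L[𝕜] 𝕜 :=
  (σ ((extChartAt I x₀).symm y)).compContinuousLinearMap
    (mfderivWithin 𝓘(𝕜, E) I (extChartAt I x₀).symm (range I) y)

/-- A form field is of class `C^n` when all its local expressions are. -/
def FormField.IsOfClass {k : ℕ} (n : ℕ∞ω) (σ : FormField I M k) : Prop :=
  ∀ x₀ : M, ContDiffOn 𝕜 n (σ.inChart x₀) (extChartAt I x₀).target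

/-- The exterior derivative (computed at `x` in the preferred chart at `x`). -/
def FormField.extDeriv {k : ℕ} (σ : FormField I M k) : FormField I M (k + 1) := fun x =>
  (extDerivWithin (σ.inChart x) (range I) (extChartAt I x x)).compContinuousLinearMap
    (mfderiv I 𝓘(𝕜, E) (extChartAt I x) x)

end Forms

section Groups
variable {𝕜 : Type*} [RCLike 𝕜] {E : Type*} [NormedAddCommGroup E] [NormedSpace 𝕜 E]
  {H : Type*} [TopologicalSpace H] {I : ModelWithCorners 𝕜 E H}
  {G : Type*} [TopologicalSpace G] [ChartedSpace H G] [Group G]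

/-- The left invariant Maurer-Cartan form `ω`, `ω_q(v) = q⁻¹ v`. -/
def maurerCartanL (q : G) : TangentSpace I q →L[𝕜] GroupLieAlgebra I G :=
  (mfderiv I I (fun h : G => q⁻¹ * h) q :)

/-- The right invariant Maurer-Cartan form `ω̄`, `ω̄_q(v) = v q⁻¹`. -/
def maurerCartanR (q : G) : TangentSpace I q →L[𝕜] GroupLieAlgebra I G :=
  (mfderiv I I (fun h : G => h * q⁻¹) q :)

/-- The adjoint action of `g`, the derivative at the identity of `h ↦ g h g⁻¹`. -/
def Ad (g : G) : GroupLieAlgebra I G →L[𝕜] GroupLieAlgebra I G :=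
  (mfderiv I I (fun h : G => g * h * g⁻¹) 1 :)


/-- `Ad`-invariance of a bilinear form on the Lie algebra. -/
def IsAdInvariant (B : LinearMap.BilinForm 𝕜 (GroupLieAlgebra I G)) : Prop :=
  ∀ (g : G) (X Y : GroupLieAlgebra I G), B (Ad g X) (Ad g Y) = B X Y

/-- The Cartan `3`-form `λ = (1/12) [ω, ω] • ω`: the `3`-form `[ω, ω] • ω` is the wedge product
of three copies of `ω` with respect to the trilinear map `(X, Y, Z) ↦ [X, Y] • Z`, that is, the
sum over all permutations `π` of `sign π • ([ω(v_π0), ω(v_π1)] • ω(v_π2))`. -/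
def cartanForm (B : LinearMap.BilinForm 𝕜 (GroupLieAlgebra I G)) (q : G)
    (v : Fin 3 → TangentSpace I q) : 𝕜 :=
  (1 / 12) * ∑ π : Equiv.Perm (Fin 3), ((Equiv.Perm.sign π : ℤ) : 𝕜) *
    B ⁅maurerCartanL q (v (π 0)), maurerCartanL q (v (π 1))⁆ (maurerCartanL q (v (π 2)))

end Groups

section Actions
variable {𝕜 : Type*} [RCLike 𝕜] {E : Type*} [NormedAddCommGroup E] [NormedSpace 𝕜 E]
  {H : Type*} [TopologicalSpace H] (I : ModelWithCorners 𝕜 E H)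
  {G : Type*} [TopologicalSpace G] [ChartedSpace H G] [Group G]
  {E' : Type*} [NormedAddCommGroup E'] [NormedSpace 𝕜 E']
  {H' : Type*} [TopologicalSpace H'] (J : ModelWithCorners 𝕜 E' H')
  {M : Type*} [TopologicalSpace M] [ChartedSpace H' M]

/-- `a : G → M → M` is a left action of class `C^n` of the Lie group `G` on the manifold `M`. -/
structure IsAction (n : ℕ∞ω) (a : G → M → M) : Prop where
  one_act : ∀ m, a 1 m = m
  mul_act : ∀ x y m, a (x * y) m = a x (a y m)
  contMDiff : ContMDiff (I.prod J) J n fun p : G × M => a p.1 p.2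

variable {I J}

/-- The fundamental vector field `X_M` of `X`, with `X_M(m) = d/dt|₀ (exp (-t X) m)`, that is, the
value at `-X` of the derivative at the identity of the orbit map `g ↦ g m`. -/
def fund (a : G → M → M) (X : GroupLieAlgebra I G) (m : M) : TangentSpace J m :=
  (mfderiv I J (fun g : G => a g m) 1 (-X) :)

/-- Invariance of a form field under an action. -/
def IsInvariant {k : ℕ} (a : G → M → M) (σ : FormField J M k) : Prop :=
  ∀ (g : G) (m : M) (v : Fin k → TangentSpace J m),
    σ (a g m) (fun i => mfderiv J J (a g) m (v i)) = σ m v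

/-- `Φ` is equivariant, `G` acting on itself by conjugation. -/
def IsEquivariant (a : G → M → M) (Φ : M → G) : Prop :=
  ∀ (g : G) (m : M), Φ (a g m) = g * Φ m * g⁻¹

variable (I J) in
/-- The `G`-equivariant map `Φ : M → G` of class `C^n` is a `G`-momentum mapping, relative to the
form `B` on the Lie algebra, for the `G`-invariant `2`-form `σ` of class `C^n`: for every `X` in
the Lie algebra, `σ(X_M, v) = 1/2 X • (Φ⁻¹ dΦ(v) + dΦ(v) Φ⁻¹)`. -/
structure IsMomentumMap (n : ℕ∞ω) (a : G → M → M)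
    (B : LinearMap.BilinForm 𝕜 (GroupLieAlgebra I G))
    (σ : FormField J M 2) (Φ : M → G) : Prop where
  form_class : σ.IsOfClass n
  form_invariant : IsInvariant a σ
  map_class : ContMDiff J I n Φ
  map_equivariant : IsEquivariant (G := G) a Φ
  momentum : ∀ (X : GroupLieAlgebra I G) (m : M) (v : TangentSpace J m),
    σ m ![fund a X m, v] = (1 / 2) * B X
      (maurerCartanL (Φ m) (mfderiv J I Φ m v) + maurerCartanR (Φ m) (mfderiv J I Φ m v))

variable (I J) in
/-- `σ` is `Φ`-quasi closed relative to `B`: `dσ = Φ^* λ`. -/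
def IsQuasiClosed (B : LinearMap.BilinForm 𝕜 (GroupLieAlgebra I G))
    (σ : FormField J M 2) (Φ : M → G) : Prop :=
  ∀ (m : M) (v : Fin 3 → TangentSpace J m),
    σ.extDeriv m v = cartanForm B (Φ m) (fun i => mfderiv J I Φ m (v i))

variable (I J) in
/-- `σ` is `Φ`-non-degenerate: the morphism `(σ^♭, dΦ) : TM → T^*M ⊕ T_Φ G` of vector bundles is
injective on every fibre. -/
def IsNondegenerateRel (σ : FormField J M 2) (Φ : M → G) : Prop :=
  ∀ (m : M) (u : TangentSpace J m),
    (∀ v : TangentSpace J m, σ m ![u, v] = 0) → mfderiv J I Φ m u = 0 → u = 0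

end Actions

section Double
variable {𝕜 : Type*} [RCLike 𝕜] {E : Type*} [NormedAddCommGroup E] [NormedSpace 𝕜 E]
  {H : Type*} [TopologicalSpace H] {I : ModelWithCorners 𝕜 E H}
  {G : Type*} [TopologicalSpace G] [ChartedSpace H G] [Group G]

/-- The form `• + •̃` on the Lie algebra `𝔤 ⊕ 𝔤̃` of `G × G`. -/
def sumForm (B : LinearMap.BilinForm 𝕜 (GroupLieAlgebra I G)) :
    LinearMap.BilinForm 𝕜 (GroupLieAlgebra (I.prod I) (G × G)) :=
  B.compl₁₂ (mfderiv (I.prod I) I (Prod.fst : G × G → G) 1 : _ →L[𝕜] _).toLinearMap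
      (mfderiv (I.prod I) I (Prod.fst : G × G → G) 1 : _ →L[𝕜] _).toLinearMap +
    B.compl₁₂ (mfderiv (I.prod I) I (Prod.snd : G × G → G) 1 : _ →L[𝕜] _).toLinearMap
      (mfderiv (I.prod I) I (Prod.snd : G × G → G) 1 : _ →L[𝕜] _).toLinearMap

/-- The action `(x, y) · (q₁, q₂) = (x q₁ y⁻¹, y q₂ x⁻¹)` of `G × G` on `G × G`. -/
def doubleAct (g q : G × G) : G × G := (g.1 * q.1 * g.2⁻¹, g.2 * q.2 * g.1⁻¹)

/-- The map `(mult, mult~)`, `(q₁, q₂) ↦ (q₁ q₂, q₁⁻¹ q₂⁻¹)`. -/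
def doubleMap (q : G × G) : G × G := (q.1 * q.2, q.1⁻¹ * q.2⁻¹)

/-- The `2`-form `α • β` obtained from two `1`-forms `α`, `β` with values in a finite-dimensional
space with a bilinear form: `(α • β)(u, v) = α(u) • β(v) - α(v) • β(u)`. -/
def wedge [FiniteDimensional 𝕜 E] {V : Type*} [AddCommGroup V] [Module 𝕜 V] [TopologicalSpace V]
    (B : LinearMap.BilinForm 𝕜 (GroupLieAlgebra I G)) (α β : V →L[𝕜] GroupLieAlgebra I G) :
    V [⋀^Fin 2]→L[𝕜] 𝕜 where
  toFun v := B (α (v 0)) (β (v 1)) - B (α (v 1)) (β (v 0))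
  map_update_add' v i x y := by
    classical
    fin_cases i <;> simp [Function.update] <;> ring
  map_update_smul' v i c x := by
    classical
    fin_cases i <;> simp [Function.update] <;> ring
  map_eq_zero_of_eq' v i j h hij := by
    fin_cases i <;> fin_cases j <;> simp_all
  cont := by
    let B' : E →ₗ[𝕜] E →ₗ[𝕜] 𝕜 := B
    have hB : Continuous fun p : E × E => B'.toContinuousBilinearMap p.1 p.2 :=
      ContinuousLinearMap.continuous₂ _
    exact (hB.comp ((α.continuous.comp (continuous_apply 0)).prodMk
      (β.continuous.comp (continuous_apply 1)))).sub
      (hB.comp ((α.continuous.comp (continuous_apply 1)).prodMk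
      (β.continuous.comp (continuous_apply 0))))

/-- The `2`-form `σ^× = -1/2 (ω₁ • ω̄₂ + ω̄₁ • ω₂)` on `G × G`, where the index `j` means pullback
along the projection to the `j`-th factor. -/
def doubleForm [FiniteDimensional 𝕜 E] (B : LinearMap.BilinForm 𝕜 (GroupLieAlgebra I G)) :
    FormField (I.prod I) (G × G) 2 := fun q =>
  let ω₁ := (maurerCartanL q.1).comp (mfderiv (I.prod I) I (Prod.fst : G × G → G) q)
  let ω₂ := (maurerCartanL q.2).comp (mfderiv (I.prod I) I (Prod.snd : G × G → G) q)
  let ω₁' := (maurerCartanR q.1).comp (mfderiv (I.prod I) I (Prod.fst : G × G → G) q)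
  let ω₂' := (maurerCartanR q.2).comp (mfderiv (I.prod I) I (Prod.snd : G × G → G) q)
  (-(1 / 2) : 𝕜) • (wedge B ω₁ ω₂' + wedge B ω₁' ω₂)

end Double
end Lie

namespace Alg

open Set WithConv

universe u v w

section Tangent
variable {K : Type u} [Field K] {C : Type v} [CommRing C] [Algebra K C]
  {R : Type w} [CommRing R] [Algebra K R]

/-- The tangent space `T_m M(R)` at an `R`-valued point `m : C → R` of the affine `K`-scheme `M`
with coordinate algebra `C`: the `K`-derivations `C → R` along `m`. -/
def tangent (m : C →ₐ[K] R) : Submodule R (C →ₗ[K] R) where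
  carrier := {v | ∀ a b, v (a * b) = m a * v b + m b * v a}
  add_mem' {v w} hv hw a b := by
    simp only [mem_ofPred_eq] at hv hw
    simp only [LinearMap.add_apply, hv, hw]; ring
  zero_mem' a b := by simp
  smul_mem' r v hv a b := by
    simp only [mem_ofPred_eq] at hv
    simp only [LinearMap.smul_apply, hv, smul_eq_mul]; ring

/-- The derivative `T_m M(R) → T_{Φ(m)} N(R)` of the morphism `Φ : M → N` of affine schemes with
comorphism `φ`. -/
def tangentMap {D : Type*} [CommRing D] [Algebra K D] (φ : D →ₐ[K] C) (m : C →ₐ[K] R) :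
    tangent m →ₗ[R] tangent (m.comp φ) where
  toFun v := ⟨v.1 ∘ₗ φ.toLinearMap, fun a b => by simpa using v.2 (φ a) (φ b)⟩
  map_add' _ _ := rfl
  map_smul' _ _ := rfl

/-- Change of the ring of values of a tangent vector. -/
def tangentBaseChange {S : Type*} [CommRing S] [Algebra K S] (h : R →ₐ[K] S) {m : C →ₐ[K] R}
    (v : tangent m) : tangent (h.comp m) :=
  ⟨h.toLinearMap ∘ₗ v.1, fun a b => by
    have := v.2 a b
    simp [this]⟩

/-- A vector field on `M`, i.e. a derivation of its coordinate algebra, as a tangent vector at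
the universal point of `M`. -/
def ofDerivation (X : Derivation K C C) : tangent (AlgHom.id K C) :=
  ⟨X.toLinearMap, fun a b => by simp⟩

variable (K C) in
/-- A field of alternating `k`-forms on the tangent spaces of `M` at all points with values in
commutative `K`-algebras. -/
def FormField (k : ℕ) : Type _ :=
  ∀ (R : Type v) [CommRing R] [Algebra K R] (m : C →ₐ[K] R), tangent m [⋀^Fin k]→ₗ[R] R

/-- A form field is an (algebraic) differential form on `M` when it is natural in the ring of
values. -/
def FormField.IsRegular {k : ℕ} (σ : FormField K C k) : Prop :=
  ∀ (R S : Type v) [CommRing R] [CommRing S] [Algebra K R] [Algebra K S] (h : R →ₐ[K] S)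
    (m : C →ₐ[K] R) (v : Fin k → tangent m),
    σ S (h.comp m) (fun i => tangentBaseChange h (v i)) = h (σ R m v)

/-- The value of a `2`-form on two vector fields. -/
def FormField.onFields (σ : FormField K C 2) (X Y : Derivation K C C) : C :=
  σ C (AlgHom.id K C) ![ofDerivation X, ofDerivation Y]

/-- The exterior derivative of a `2`-form, evaluated on three vector fields. -/
def FormField.extDeriv (σ : FormField K C 2) (X Y Z : Derivation K C C) : C :=
  X (σ.onFields Y Z) - Y (σ.onFields X Z) + Z (σ.onFields X Y)
    - σ.onFields ⁅X, Y⁆ Z + σ.onFields ⁅X, Z⁆ Y - σ.onFields ⁅Y, Z⁆ X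

end Tangent

section Pair
variable {K : Type u} [Field K] {C : Type*} [CommRing C] [Algebra K C] {D : Type*} [CommRing D]
  [Algebra K D] {R : Type*} [CommRing R] [Algebra K R]

/-- The `R`-valued point `(p, q)` of a product of affine schemes. -/
def pair (p : C →ₐ[K] R) (q : D →ₐ[K] R) : C ⊗[K] D →ₐ[K] R :=
  Algebra.TensorProduct.lift p q fun _ _ => .all ..

@[simp] theorem pair_tmul (p : C →ₐ[K] R) (q : D →ₐ[K] R) (c : C) (d : D) :
    pair p q (c ⊗ₜ d) = p c * q d := Algebra.TensorProduct.lift_tmul ..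

theorem pair_comp_left (p : C →ₐ[K] R) (q : D →ₐ[K] R) :
    (pair p q).comp Algebra.TensorProduct.includeLeft = p := by
  ext; simp

theorem pair_comp_right (p : C →ₐ[K] R) (q : D →ₐ[K] R) :
    (pair p q).comp Algebra.TensorProduct.includeRight = q := by
  ext; simp

end Pair

section Groups
variable {K : Type u} [Field K] {A : Type v} [CommRing A] [HopfAlgebra K A]
  {R : Type w} [CommRing R] [Algebra K R]

variable (K A R) in
/-- The group `G(R)` of `R`-valued points of the affine group scheme with coordinate algebra `A`;
its multiplication is the convolution product. -/
abbrev Points : Type _ := WithConv (A →ₐ[K] R)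

variable (K A R) in
/-- The Lie algebra `𝔤(R)`, the tangent space of `G` at the identity element of `G(R)`.
The Lie algebra of `G` is `𝔤 = 𝔤(K)`. -/
abbrev LieAlg : Type _ := tangent (1 : Points K A R).ofConv

/-- The convolution product `(f * g)(a) = ∑ f(a₁) g(a₂)` of linear maps. -/
def conv (f g : A →ₗ[K] R) : A →ₗ[K] R := (toConv f * toConv g).ofConv

theorem mul'_map_mul {C D : Type*} [CommRing C] [Algebra K C] [CommRing D] [Algebra K D]
    (p : C →ₐ[K] R) (q : D →ₐ[K] R)
    (X : C →ₗ[K] R) (hX : X ∈ tangent p) (Y : D →ₗ[K] R) (hY : Y ∈ tangent q) (s t : C ⊗[K] D) :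
    LinearMap.mul' K R (TensorProduct.map X Y (s * t)) = 
      pair p q s * LinearMap.mul' K R (TensorProduct.map X Y t) +
      pair p q t * LinearMap.mul' K R (TensorProduct.map X Y s)
      + LinearMap.mul' K R (TensorProduct.map X q.toLinearMap s) * LinearMap.mul' K R (TensorProduct.map p.toLinearMap Y t)
      + LinearMap.mul' K R (TensorProduct.map X q.toLinearMap t) * LinearMap.mul' K R (TensorProduct.map p.toLinearMap Y s) := by
  induction s with
  | zero => simp
  | add s₁ s₂ h₁ h₂ => simp only [add_mul, map_add, h₁, h₂]; ring
  | tmul a b =>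
    induction t with
    | zero => simp
    | add s₁ s₂ h₁ h₂ => simp only [mul_add, map_add, h₁, h₂]; ring
    | tmul c d =>
      have h1 := hX a c
      have h2 := hY b d
      simp only [Algebra.TensorProduct.tmul_mul_tmul, TensorProduct.map_tmul,
        LinearMap.mul'_apply, h1, h2, pair_tmul, AlgHom.toLinearMap_apply]
      ring

theorem mul'_map_point_left {C D : Type*} [CommRing C] [Algebra K C] [CommRing D] [Algebra K D]
    (p : C →ₐ[K] R) (q : D →ₐ[K] R)
    (Y : D →ₗ[K] R) (hY : Y ∈ tangent q) (s t : C ⊗[K] D) :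
    LinearMap.mul' K R (TensorProduct.map p.toLinearMap Y (s * t)) = 
      pair p q s * LinearMap.mul' K R (TensorProduct.map p.toLinearMap Y t) +
      pair p q t * LinearMap.mul' K R (TensorProduct.map p.toLinearMap Y s) := by
  induction s with
  | zero => simp
  | add s₁ s₂ h₁ h₂ => simp only [add_mul, map_add, h₁, h₂]; ring
  | tmul a b =>
    induction t with
    | zero => simp
    | add s₁ s₂ h₁ h₂ => simp only [mul_add, map_add, h₁, h₂]; ring
    | tmul c d =>
      have h2 := hY b d
      simp only [Algebra.TensorProduct.tmul_mul_tmul, TensorProduct.map_tmul, map_mul,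
        LinearMap.mul'_apply, h2, pair_tmul, AlgHom.toLinearMap_apply]
      ring

theorem mul'_map_point_right {C D : Type*} [CommRing C] [Algebra K C] [CommRing D] [Algebra K D]
    (p : C →ₐ[K] R) (q : D →ₐ[K] R)
    (X : C →ₗ[K] R) (hX : X ∈ tangent p) (s t : C ⊗[K] D) :
    LinearMap.mul' K R (TensorProduct.map X q.toLinearMap (s * t)) = 
      pair p q s * LinearMap.mul' K R (TensorProduct.map X q.toLinearMap t) +
      pair p q t * LinearMap.mul' K R (TensorProduct.map X q.toLinearMap s) := by
  induction s with
  | zero => simp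
  | add s₁ s₂ h₁ h₂ => simp only [add_mul, map_add, h₁, h₂]; ring
  | tmul a b =>
    induction t with
    | zero => simp
    | add s₁ s₂ h₁ h₂ => simp only [mul_add, map_add, h₁, h₂]; ring
    | tmul c d =>
      have h2 := hX a c
      simp only [Algebra.TensorProduct.tmul_mul_tmul, TensorProduct.map_tmul, map_mul,
        LinearMap.mul'_apply, h2, pair_tmul, AlgHom.toLinearMap_apply]
      ring

theorem conv_mem_left (p q : Points K A R) (v : A →ₗ[K] R) (hv : v ∈ tangent q.ofConv) :
    conv p.ofConv.toLinearMap v ∈ tangent (p * q).ofConv := fun a b => by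
  have ha : ∀ a, (p * q).ofConv a = _ := AlgHom.convMul_apply p q
  have := mul'_map_point_left p.ofConv q.ofConv v hv (CoalgebraStruct.comul a) (CoalgebraStruct.comul b)
  rw [ha, ha]
  rw [← Bialgebra.comul_mul] at this
  exact this

theorem conv_mem_right (p q : Points K A R) (v : A →ₗ[K] R) (hv : v ∈ tangent p.ofConv) :
    conv v q.ofConv.toLinearMap ∈ tangent (p * q).ofConv := fun a b => by
  have ha : ∀ a, (p * q).ofConv a = _ := AlgHom.convMul_apply p q
  have := mul'_map_point_right p.ofConv q.ofConv v hv (CoalgebraStruct.comul a) (CoalgebraStruct.comul b)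
  rw [ha, ha]
  rw [← Bialgebra.comul_mul] at this
  exact this

/-- The inverse of a point of `G(R)`. -/
def inv (q : Points K A R) : Points K A R :=
  toConv (q.ofConv.comp (HopfAlgebra.antipodeAlgHom K A))

theorem inv_mul (q : Points K A R) : inv q * q = 1 := by
  apply WithConv.ofConv_injective
  have h := AlgHom.comp_convMul_distrib q.ofConv (toConv (HopfAlgebra.antipodeAlgHom K A))
    (toConv (AlgHom.id K A))
  have e : toConv (HopfAlgebra.antipodeAlgHom K A) * toConv (AlgHom.id K A) = 1 := by
    apply WithConv.ofConv_injective
    apply AlgHom.toLinearMap_injective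
    apply WithConv.toConv_injective
    rw [AlgHom.toLinearMap_convMul, AlgHom.toLinearMap_convOne]
    exact LinearMap.antipode_mul_id
  rw [e] at h
  have h2 : (inv q * q).ofConv = _ := h.symm
  rw [h2]
  ext a
  simp

theorem mul_inv (q : Points K A R) : q * inv q = 1 := by
  apply WithConv.ofConv_injective
  have h := AlgHom.comp_convMul_distrib q.ofConv (toConv (AlgHom.id K A))
    (toConv (HopfAlgebra.antipodeAlgHom K A))
  have e : toConv (AlgHom.id K A) * toConv (HopfAlgebra.antipodeAlgHom K A) = 1 := by
    apply WithConv.ofConv_injective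
    apply AlgHom.toLinearMap_injective
    apply WithConv.toConv_injective
    rw [AlgHom.toLinearMap_convMul, AlgHom.toLinearMap_convOne]
    exact LinearMap.id_mul_antipode
  rw [e] at h
  have h2 : (q * inv q).ofConv = _ := h.symm
  rw [h2]
  ext a
  simp

/-- The left invariant Maurer-Cartan form, `v ↦ q⁻¹ v`, at the point `q` of `G(R)`. -/
def maurerCartanL (q : Points K A R) : tangent q.ofConv →ₗ[R] LieAlg K A R where
  toFun v := ⟨conv (inv q).ofConv.toLinearMap v.1, by
    have := conv_mem_left (inv q) q v.1 v.2
    rwa [inv_mul] at this⟩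
  map_add' v w := Subtype.ext (by simp [conv, mul_add])
  map_smul' r v := Subtype.ext (by
    simp only [conv, Submodule.coe_smul, RingHom.id_apply, toConv_smul, mul_smul_comm, ofConv_smul])

/-- The right invariant Maurer-Cartan form, `v ↦ v q⁻¹`, at the point `q` of `G(R)`. -/
def maurerCartanR (q : Points K A R) : tangent q.ofConv →ₗ[R] LieAlg K A R where
  toFun v := ⟨conv v.1 (inv q).ofConv.toLinearMap, by
    have := conv_mem_right q (inv q) v.1 v.2
    rwa [mul_inv] at this⟩
  map_add' v w := Subtype.ext (by simp [conv, add_mul])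
  map_smul' r v := Subtype.ext (by
    simp only [conv, Submodule.coe_smul, RingHom.id_apply, toConv_smul, smul_mul_assoc, ofConv_smul])

/-- The adjoint action of `g ∈ G(R)` on `𝔤(R)`, `ξ ↦ g ξ g⁻¹`. -/
def Ad (g : Points K A R) (ξ : LieAlg K A R) : LieAlg K A R :=
  ⟨conv (conv g.ofConv.toLinearMap ξ.1) (inv g).ofConv.toLinearMap, by
    have := conv_mem_right _ (inv g) _ (conv_mem_left g 1 ξ.1 ξ.2)
    rwa [mul_one, mul_inv] at this⟩

theorem conv_one_left (v : A →ₗ[K] R) : conv (1 : Points K A R).ofConv.toLinearMap v = v := by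
  have : toConv (1 : Points K A R).ofConv.toLinearMap = 1 := AlgHom.toLinearMap_convOne
  simp [conv, this]

theorem conv_one_right (v : A →ₗ[K] R) : conv v (1 : Points K A R).ofConv.toLinearMap = v := by
  have : toConv (1 : Points K A R).ofConv.toLinearMap = 1 := AlgHom.toLinearMap_convOne
  simp [conv, this]

/-- The Lie bracket of `𝔤(R)`, the commutator with respect to the convolution product (this is the
commutator of the left invariant derivations `(id ⊗ ξ) ∘ Δ`). -/
def bracket (ξ η : LieAlg K A R) : LieAlg K A R :=
  ⟨conv ξ.1 η.1 - conv η.1 ξ.1, fun a b => by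
    have h1 := mul'_map_mul _ _ ξ.1 ξ.2 η.1 η.2 (CoalgebraStruct.comul a) (CoalgebraStruct.comul b)
    have h2 := mul'_map_mul _ _ η.1 η.2 ξ.1 ξ.2 (CoalgebraStruct.comul a) (CoalgebraStruct.comul b)
    have e : ∀ a, pair (1 : Points K A R).ofConv (1 : Points K A R).ofConv (CoalgebraStruct.comul (R := K) a) = (1 : Points K A R).ofConv a := by
      intro a
      exact (AlgHom.convMul_apply _ _ a).symm.trans (by rw [mul_one])
    have l : ∀ (v : A →ₗ[K] R) a, LinearMap.mul' K R (TensorProduct.map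
        (1 : Points K A R).ofConv.toLinearMap v (CoalgebraStruct.comul a)) = v a :=
      fun v a => congrArg (fun f : A →ₗ[K] R => f a) (conv_one_left v)
    have r : ∀ (v : A →ₗ[K] R) a, LinearMap.mul' K R (TensorProduct.map
        v (1 : Points K A R).ofConv.toLinearMap (CoalgebraStruct.comul a)) = v a :=
      fun v a => congrArg (fun f : A →ₗ[K] R => f a) (conv_one_right v)
    rw [← Bialgebra.comul_mul, e, e, l, l, r, r] at h1 h2
    have h1' : conv ξ.1 η.1 (a * b) = _ := h1
    have h2' : conv η.1 ξ.1 (a * b) = _ := h2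
    have c : ∀ (f g : A →ₗ[K] R) a, LinearMap.mul' K R (TensorProduct.map
        f g (CoalgebraStruct.comul a)) = conv f g a := fun f g a => rfl
    rw [c, c] at h1' h2'
    rw [LinearMap.sub_apply, LinearMap.sub_apply, LinearMap.sub_apply, h1', h2']
    ring⟩


/-- The extension `𝔤 → 𝔤(R)` of scalars. -/
def ofLie : LieAlg K A K →ₗ[K] LieAlg K A R where
  toFun X := ⟨Algebra.linearMap K R ∘ₗ X.1, fun a b => by
    have := X.2 a b
    simp [this]⟩
  map_add' X Y := Subtype.ext (by ext; simp)
  map_smul' c X := Subtype.ext (by ext; simp [Algebra.smul_def])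

open Classical in
theorem extendScalars_injective :
    Function.Injective (LinearMap.liftBaseChange R (ofLie (K := K) (A := A) (R := R))) := by
  refine (injective_iff_map_eq_zero _).2 fun z hz => ?_
  let b := Module.Basis.ofVectorSpace K R
  apply (TensorProduct.equivFinsuppOfBasisLeft b).injective
  rw [map_zero]
  ext i a
  have key : ∀ z : R ⊗[K] LieAlg K A K,
      b.repr ((LinearMap.liftBaseChange R (ofLie (K := K) (A := A) (R := R)) z).1 a) i =
        ((TensorProduct.equivFinsuppOfBasisLeft b z) i).1 a := by
    intro z
    induction z with
    | zero => simp
    | add x y hx hy => simp [hx, hy]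
    | tmul r X =>
      have : (LinearMap.liftBaseChange R (ofLie (K := K) (A := A) (R := R)) (r ⊗ₜ X)).1 a
          = X.1 a • r := by
        simp [ofLie, Algebra.smul_def, mul_comm]
      rw [this, TensorProduct.equivFinsuppOfBasisLeft_apply_tmul_apply]
      simp [mul_comm]
  rw [← key, hz]
  simp

theorem extendScalars_surjective [Algebra.FiniteType K A] :
    Function.Surjective (LinearMap.liftBaseChange R (ofLie (K := K) (A := A) (R := R))) := by
  intro δ
  obtain ⟨s, hs⟩ := Algebra.FiniteType.out (R := K) (A := A)
  have hone : ∀ (x : A) (r : R), (1 : Points K A R).ofConv x * r =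
      CoalgebraStruct.counit (R := K) x • r := by
    intro x r; rw [Algebra.smul_def]; rfl
  have key : ∀ a, δ.1 a ∈ Submodule.span K (δ.1 '' (s : Set A)) := by
    intro a
    have ha : a ∈ Algebra.adjoin K (s : Set A) := by rw [hs]; trivial
    induction ha using Algebra.adjoin_induction with
    | mem x hx => exact Submodule.subset_span ⟨x, hx, rfl⟩
    | algebraMap r =>
      have h1 := δ.2 1 1
      simp only [mul_one, map_one, one_mul] at h1
      have h0 : δ.1 1 = 0 := by simpa using h1
      rw [Algebra.algebraMap_eq_smul_one, map_smul, h0, smul_zero]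
      exact zero_mem _
    | add x y _ _ hx hy => rw [map_add]; exact add_mem hx hy
    | mul x y _ _ hx hy =>
      rw [δ.2 x y, hone, hone]
      exact add_mem (Submodule.smul_mem _ _ hy) (Submodule.smul_mem _ _ hx)
  have : FiniteDimensional K (Submodule.span K (δ.1 '' (s : Set A))) :=
    FiniteDimensional.span_of_finite K (s.finite_toSet.image _)
  let b := Module.finBasis K (Submodule.span K (δ.1 '' (s : Set A)))
  let δ' : A →ₗ[K] Submodule.span K (δ.1 '' (s : Set A)) := δ.1.codRestrict _ key
  let X : ∀ i, LieAlg K A K := fun i => ⟨b.coord i ∘ₗ δ', fun x y => by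
    have h : δ' (x * y) = CoalgebraStruct.counit (R := K) x • δ' y +
        CoalgebraStruct.counit (R := K) y • δ' x := by
      apply Subtype.ext
      have := δ.2 x y
      rw [hone, hone] at this
      simpa [δ'] using this
    simp [h]⟩
  refine ⟨∑ i, (b i : R) ⊗ₜ X i, ?_⟩
  apply Subtype.ext
  ext a
  have h := congrArg Subtype.val (b.sum_repr (δ' a))
  simp only [AddSubmonoidClass.coe_finsetSum, Submodule.coe_smul] at h
  simp only [map_sum, LinearMap.liftBaseChange_tmul, AddSubmonoidClass.coe_finsetSum,
    LinearMap.sum_apply, Submodule.coe_smul, LinearMap.smul_apply]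
  refine Eq.trans (Finset.sum_congr rfl fun i _ => ?_) h
  simp [X, ofLie, Algebra.smul_def, mul_comm]

variable (K A R) in
/-- The canonical isomorphism `R ⊗ 𝔤 ≅ 𝔤(R)`. -/
def extendScalars [Algebra.FiniteType K A] : R ⊗[K] LieAlg K A K ≃ₗ[R] LieAlg K A R :=
  LinearEquiv.ofBijective (LinearMap.liftBaseChange R ofLie)
    ⟨extendScalars_injective, extendScalars_surjective⟩

variable (R) in
/-- The `R`-bilinear extension of a bilinear form on `𝔤` to `𝔤(R) = R ⊗ 𝔤`. -/
def extForm [Algebra.FiniteType K A] (B : LinearMap.BilinForm K (LieAlg K A K)) :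
    LinearMap.BilinForm R (LieAlg K A R) :=
  (LinearMap.BilinForm.baseChange R B).compl₁₂ (extendScalars K A R).symm.toLinearMap
    (extendScalars K A R).symm.toLinearMap

/-- `Ad`-invariance of a bilinear form on the Lie algebra: invariance under all points of the
group with values in commutative `K`-algebras. -/
def IsAdInvariant [Algebra.FiniteType K A] (B : LinearMap.BilinForm K (LieAlg K A K)) : Prop :=
  ∀ (R : Type v) [CommRing R] [Algebra K R] (g : Points K A R) (ξ η : LieAlg K A R),
    extForm R B (Ad g ξ) (Ad g η) = extForm R B ξ η

/-- The Cartan `3`-form `λ = (1/12) [ω, ω] • ω`: the `3`-form `[ω, ω] • ω` is the wedge product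
of three copies of `ω` with respect to the trilinear map `(ξ, η, ζ) ↦ [ξ, η] • ζ`, that is, the
sum over all permutations `π` of `sign π • ([ω(v_π0), ω(v_π1)] • ω(v_π2))`. -/
def cartanForm [Algebra.FiniteType K A] (B : LinearMap.BilinForm K (LieAlg K A K))
    (q : Points K A R) (v : Fin 3 → tangent q.ofConv) : R :=
  algebraMap K R (1 / 12) * ∑ π : Equiv.Perm (Fin 3), ((Equiv.Perm.sign π : ℤ) : R) *
    extForm R B (bracket (maurerCartanL q (v (π 0))) (maurerCartanL q (v (π 1))))
      (maurerCartanL q (v (π 2)))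

end Groups

section Actions
variable {K : Type u} [Field K] {A : Type v} [CommRing A] [HopfAlgebra K A]
  {C : Type v} [CommRing C] [Algebra K C] {R : Type v} [CommRing R] [Algebra K R]

/-- The point `g m` of `M(R)`, for `g ∈ G(R)`, `m ∈ M(R)` and a morphism `G × M → M` with
comorphism `ρ`. -/
def act (ρ : C →ₐ[K] A ⊗[K] C) (g : Points K A R) (m : C →ₐ[K] R) : C →ₐ[K] R :=
  (pair g.ofConv m).comp ρ

/-- The morphism `G × M → M` with comorphism `ρ` is a left action: it induces an action of the group
`G(R)` on the set `M(R)` for every commutative `K`-algebra `R`. -/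
def IsAction (ρ : C →ₐ[K] A ⊗[K] C) : Prop :=
  ∀ (R : Type v) [CommRing R] [Algebra K R],
    (∀ m : C →ₐ[K] R, act ρ (1 : Points K A R) m = m) ∧
      ∀ (x y : Points K A R) (m : C →ₐ[K] R), act ρ (x * y) m = act ρ x (act ρ y m)

variable (K A C) in
/-- A left action of the affine group scheme `G` on the affine scheme `M`, given by the comorphism
of the morphism `G × M → M`. -/
def Action : Type _ := {ρ : C →ₐ[K] A ⊗[K] C // IsAction ρ}

/-- The comorphism of the morphism `G × M → M`. -/
def Action.coact (a : Action K A C) : C →ₐ[K] A ⊗[K] C := a.1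

theorem Action.isAction (a : Action K A C) : IsAction a.coact := a.2

/-- The derivative `T_m M(R) → T_{g m} M(R)`, `v ↦ g v`, of the action of `g ∈ G(R)`. -/
def Action.onTangent (a : Action K A C) (g : Points K A R) {m : C →ₐ[K] R} (v : tangent m) :
    tangent (act a.coact g m) :=
  ⟨LinearMap.mul' K R ∘ₗ TensorProduct.map g.ofConv.toLinearMap v.1 ∘ₗ a.coact.toLinearMap,
    fun x y => by
      have := mul'_map_point_left g.ofConv m v.1 v.2 (a.coact x) (a.coact y)
      rw [← map_mul] at this
      simpa only [LinearMap.comp_apply, AlgHom.toLinearMap_apply, act, AlgHom.comp_apply]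
        using this⟩

/-- The fundamental vector field `X_M` of `X`, `X_M(m) = d/dt|₀ (exp (-t X) m)`, that is, the
value at `-X` of the derivative at the identity of the orbit map `g ↦ g m`. -/
def Action.fund (a : Action K A C) (X : LieAlg K A R) (m : C →ₐ[K] R) : tangent m :=
  ⟨-(LinearMap.mul' K R ∘ₗ TensorProduct.map X.1 m.toLinearMap ∘ₗ a.coact.toLinearMap), by
    apply neg_mem
    intro x y
    have h : ∀ x, pair (1 : Points K A R).ofConv m (a.coact x) = m x :=
      fun x => DFunLike.congr_fun ((a.isAction R).1 m) x
    have := mul'_map_point_right (1 : Points K A R).ofConv m X.1 X.2 (a.coact x) (a.coact y)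
    rw [← map_mul, h, h] at this
    simpa only [LinearMap.comp_apply, AlgHom.toLinearMap_apply] using this⟩

/-- Invariance of a form field under an action. -/
def IsInvariant {k : ℕ} (a : Action K A C) (σ : FormField K C k) : Prop :=
  ∀ (R : Type v) [CommRing R] [Algebra K R] (g : Points K A R) (m : C →ₐ[K] R)
    (v : Fin k → tangent m), σ R (act a.coact g m) (fun i => a.onTangent g (v i)) = σ R m v

/-- The morphism `Φ : M → G` with comorphism `φ` is equivariant, `G` acting on itself by
conjugation. -/
def IsEquivariant (a : Action K A C) (φ : A →ₐ[K] C) : Prop :=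
  ∀ (R : Type v) [CommRing R] [Algebra K R] (g : Points K A R) (m : C →ₐ[K] R),
    toConv ((act a.coact g m).comp φ) = g * toConv (m.comp φ) * inv g

/-- The `G`-equivariant morphism `Φ : M → G` with comorphism `φ` is a `G`-momentum mapping,
relative to the form `B` on the Lie algebra, for the `G`-invariant algebraic `2`-form `σ`:
for every `X` in the Lie algebra, `σ(X_M, v) = 1/2 X • (Φ⁻¹ dΦ(v) + dΦ(v) Φ⁻¹)`. -/
structure IsMomentumMap [Algebra.FiniteType K A] (a : Action K A C)
    (B : LinearMap.BilinForm K (LieAlg K A K)) (σ : FormField K C 2) (φ : A →ₐ[K] C) : Prop where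
  form_regular : σ.IsRegular
  form_invariant : IsInvariant a σ
  map_equivariant : IsEquivariant a φ
  momentum : ∀ (R : Type v) [CommRing R] [Algebra K R] (X : LieAlg K A R) (m : C →ₐ[K] R)
    (v : tangent m), σ R m ![a.fund X m, v] = algebraMap K R (1 / 2) * extForm R B X
      (maurerCartanL (toConv (m.comp φ)) (tangentMap φ m v) +
        maurerCartanR (toConv (m.comp φ)) (tangentMap φ m v))

/-- `σ` is `Φ`-quasi closed relative to `B`: `dσ = Φ^* λ`. -/
def IsQuasiClosed [Algebra.FiniteType K A] (B : LinearMap.BilinForm K (LieAlg K A K))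
    (σ : FormField K C 2) (φ : A →ₐ[K] C) : Prop :=
  ∀ X Y Z : Derivation K C C, σ.extDeriv X Y Z =
    cartanForm B (toConv ((AlgHom.id K C).comp φ))
      (fun i => tangentMap φ (AlgHom.id K C) (![ofDerivation X, ofDerivation Y, ofDerivation Z] i))

/-- `σ` is `Φ`-non-degenerate: the morphism `(σ^♭, dΦ) : TM → T^*M ⊕ T_Φ G` of vector bundles is
injective on the fibres at all points with values in commutative `K`-algebras. -/
def IsNondegenerateRel (σ : FormField K C 2) (φ : A →ₐ[K] C) : Prop :=
  ∀ (R : Type v) [CommRing R] [Algebra K R] (m : C →ₐ[K] R) (u : tangent m),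
    (∀ v : tangent m, σ R m ![u, v] = 0) → tangentMap φ m u = 0 → u = 0

end Actions

section Double
variable {K : Type u} [Field K] {A : Type v} [CommRing A] [HopfAlgebra K A]
  {R : Type w} [CommRing R] [Algebra K R]

/-- The first projection `G × G → G`, as an algebra homomorphism. -/
abbrev inl : A →ₐ[K] A ⊗[K] A := Algebra.TensorProduct.includeLeft

/-- The second projection `G × G → G`, as an algebra homomorphism. -/
abbrev inr : A →ₐ[K] A ⊗[K] A := Algebra.TensorProduct.includeRight

theorem one_comp_inl : (1 : Points K (A ⊗[K] A) R).ofConv.comp inl = (1 : Points K A R).ofConv := by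
  ext a
  simp

theorem one_comp_inr : (1 : Points K (A ⊗[K] A) R).ofConv.comp inr = (1 : Points K A R).ofConv := by
  ext a
  simp

theorem mul_comp_inl (x y : Points K (A ⊗[K] A) R) :
    toConv ((x * y).ofConv.comp inl) = toConv (x.ofConv.comp inl) * toConv (y.ofConv.comp inl) := by
  apply WithConv.ofConv_injective
  ext a
  have h1 := AlgHom.convMul_apply x y (a ⊗ₜ[K] 1)
  have h2 := AlgHom.convMul_apply (toConv (x.ofConv.comp (inl (K := K) (A := A))))
    (toConv (y.ofConv.comp inl)) a
  refine h1.trans (Eq.trans ?_ h2.symm)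
  rw [TensorProduct.comul_tmul, Bialgebra.comul_one]
  generalize CoalgebraStruct.comul (R := K) a = z
  induction z with
  | zero => simp
  | add x y hx hy => simp [TensorProduct.add_tmul, hx, hy]
  | tmul b c => simp [Algebra.TensorProduct.one_def]

theorem mul_comp_inr (x y : Points K (A ⊗[K] A) R) :
    toConv ((x * y).ofConv.comp inr) = toConv (x.ofConv.comp inr) * toConv (y.ofConv.comp inr) := by
  apply WithConv.ofConv_injective
  ext a
  have h1 := AlgHom.convMul_apply x y (1 ⊗ₜ[K] a)
  have h2 := AlgHom.convMul_apply (toConv (x.ofConv.comp (inr (K := K) (A := A))))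
    (toConv (y.ofConv.comp inr)) a
  refine h1.trans (Eq.trans ?_ h2.symm)
  rw [TensorProduct.comul_tmul, Bialgebra.comul_one]
  generalize CoalgebraStruct.comul (R := K) a = z
  induction z with
  | zero => simp
  | add x y hx hy => simp [TensorProduct.tmul_add, hx, hy]
  | tmul b c => simp [Algebra.TensorProduct.one_def]

variable (K A R) in
/-- The first component of an element of the Lie algebra of `G × G`. -/
def lieFst : LieAlg K (A ⊗[K] A) R →ₗ[R] LieAlg K A R where
  toFun X := ⟨X.1 ∘ₗ (inl (K := K) (A := A)).toLinearMap, by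
    have h : tangent ((1 : Points K (A ⊗[K] A) R).ofConv.comp inl) =
        tangent (1 : Points K A R).ofConv := by rw [one_comp_inl]
    exact h.le (tangentMap inl _ X).2⟩
  map_add' _ _ := rfl
  map_smul' _ _ := rfl

variable (K A R) in
/-- The second component of an element of the Lie algebra of `G × G`. -/
def lieSnd : LieAlg K (A ⊗[K] A) R →ₗ[R] LieAlg K A R where
  toFun X := ⟨X.1 ∘ₗ (inr (K := K) (A := A)).toLinearMap, by
    have h : tangent ((1 : Points K (A ⊗[K] A) R).ofConv.comp inr) =
        tangent (1 : Points K A R).ofConv := by rw [one_comp_inr]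
    exact h.le (tangentMap inr _ X).2⟩
  map_add' _ _ := rfl
  map_smul' _ _ := rfl

/-- The form `• + •̃` on the Lie algebra `𝔤 ⊕ 𝔤̃` of `G × G`. -/
def sumForm (B : LinearMap.BilinForm K (LieAlg K A K)) :
    LinearMap.BilinForm K (LieAlg K (A ⊗[K] A) K) :=
  B.compl₁₂ (lieFst K A K) (lieFst K A K) + B.compl₁₂ (lieSnd K A K) (lieSnd K A K)

variable (K A) in
/-- The comorphism of `(x, y, q₁, q₂) ↦ (x q₁ y⁻¹, y q₂ x⁻¹)`, where `x`, `y`, `q₁`, `q₂` are the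
four coordinate projections `G × G × G × G → G`, seen as points of `G`. -/
def doubleCoact : A ⊗[K] A →ₐ[K] (A ⊗[K] A) ⊗[K] (A ⊗[K] A) :=
  let x : Points K A ((A ⊗[K] A) ⊗[K] (A ⊗[K] A)) :=
    toConv (Algebra.TensorProduct.includeLeft.comp inl)
  let y : Points K A ((A ⊗[K] A) ⊗[K] (A ⊗[K] A)) :=
    toConv (Algebra.TensorProduct.includeLeft.comp inr)
  let q₁ : Points K A ((A ⊗[K] A) ⊗[K] (A ⊗[K] A)) :=
    toConv (Algebra.TensorProduct.includeRight.comp inl)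
  let q₂ : Points K A ((A ⊗[K] A) ⊗[K] (A ⊗[K] A)) :=
    toConv (Algebra.TensorProduct.includeRight.comp inr)
  pair (x * q₁ * inv y).ofConv (y * q₂ * inv x).ofConv

theorem comp_mul {S : Type*} [CommRing S] [Algebra K S] (h : R →ₐ[K] S) (x y : Points K A R) :
    toConv (h.comp (x * y).ofConv) = toConv (h.comp x.ofConv) * toConv (h.comp y.ofConv) := by
  rw [AlgHom.comp_convMul_distrib]

theorem inv_mul_rev (x y : Points K A R) : inv (x * y) = inv y * inv x := by
  apply left_inv_eq_right_inv (inv_mul (x * y))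
  rw [mul_assoc, ← mul_assoc y, mul_inv, one_mul, mul_inv]

theorem inv_one : inv (1 : Points K A R) = 1 := by
  have := inv_mul (1 : Points K A R)
  rwa [mul_one] at this

theorem act_doubleCoact_inl {R : Type v} [CommRing R] [Algebra K R]
    (g : Points K (A ⊗[K] A) R) (m : A ⊗[K] A →ₐ[K] R) :
    toConv ((act (doubleCoact K A) g m).comp inl) = toConv (g.ofConv.comp inl) *
      toConv (m.comp inl) * inv (toConv (g.ofConv.comp inr)) := by
  have h : (act (doubleCoact K A) g m).comp inl =
    (pair g.ofConv m).comp ((doubleCoact K A).comp inl) := rfl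
  have e : ∀ p : A →ₐ[K] A ⊗[K] A, (pair g.ofConv m).comp
      (Algebra.TensorProduct.includeLeft.comp p) = g.ofConv.comp p := by
    intro p; rw [← AlgHom.comp_assoc, pair_comp_left]
  have e' : ∀ p : A →ₐ[K] A ⊗[K] A, (pair g.ofConv m).comp
      (Algebra.TensorProduct.includeRight.comp p) = m.comp p := by
    intro p; rw [← AlgHom.comp_assoc, pair_comp_right]
  have d : ∀ p : A →ₐ[K] A ⊗[K] A, (pair g.ofConv m).comp
      (inv (toConv (Algebra.TensorProduct.includeLeft.comp p))).ofConv =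
      (inv (toConv (g.ofConv.comp p))).ofConv := by
    intro p; rw [← e p]; rfl
  rw [h, doubleCoact, pair_comp_left, comp_mul, comp_mul, d, e, e']

theorem act_doubleCoact_inr {R : Type v} [CommRing R] [Algebra K R]
    (g : Points K (A ⊗[K] A) R) (m : A ⊗[K] A →ₐ[K] R) :
    toConv ((act (doubleCoact K A) g m).comp inr) = toConv (g.ofConv.comp inr) *
      toConv (m.comp inr) * inv (toConv (g.ofConv.comp inl)) := by
  have h : (act (doubleCoact K A) g m).comp inr =
    (pair g.ofConv m).comp ((doubleCoact K A).comp inr) := rfl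
  have e : ∀ p : A →ₐ[K] A ⊗[K] A, (pair g.ofConv m).comp
      (Algebra.TensorProduct.includeLeft.comp p) = g.ofConv.comp p := by
    intro p; rw [← AlgHom.comp_assoc, pair_comp_left]
  have e' : ∀ p : A →ₐ[K] A ⊗[K] A, (pair g.ofConv m).comp
      (Algebra.TensorProduct.includeRight.comp p) = m.comp p := by
    intro p; rw [← AlgHom.comp_assoc, pair_comp_right]
  have d : ∀ p : A →ₐ[K] A ⊗[K] A, (pair g.ofConv m).comp
      (inv (toConv (Algebra.TensorProduct.includeLeft.comp p))).ofConv =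
      (inv (toConv (g.ofConv.comp p))).ofConv := by
    intro p; rw [← e p]; rfl
  rw [h, doubleCoact, pair_comp_right, comp_mul, comp_mul, d, e, e']

theorem point_ext {p q : A ⊗[K] A →ₐ[K] R}
    (h₁ : toConv (p.comp (inl (K := K) (A := A))) = toConv (q.comp inl))
    (h₂ : toConv (p.comp (inr (K := K) (A := A))) = toConv (q.comp inr)) : p = q :=
  Algebra.TensorProduct.ext (WithConv.toConv_injective h₁) (WithConv.toConv_injective h₂)

theorem doubleCoact_isAction : IsAction (doubleCoact K A) := by
  intro R _ _
  refine ⟨fun m => ?_, fun x y m => ?_⟩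
  · apply point_ext
    · rw [act_doubleCoact_inl, one_comp_inl, one_comp_inr, toConv_ofConv, inv_one]; simp
    · rw [act_doubleCoact_inr, one_comp_inl, one_comp_inr, toConv_ofConv, inv_one]; simp
  · apply point_ext
    · simp only [act_doubleCoact_inl, mul_comp_inl, mul_comp_inr, inv_mul_rev, mul_assoc]
    · simp only [act_doubleCoact_inr, mul_comp_inl, mul_comp_inr, inv_mul_rev, mul_assoc]

variable (K A) in
/-- The action `(x, y) · (q₁, q₂) = (x q₁ y⁻¹, y q₂ x⁻¹)` of `G × G` on `G × G`. -/
def doubleAction : Action K (A ⊗[K] A) (A ⊗[K] A) :=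
  ⟨doubleCoact K A, doubleCoact_isAction⟩

variable (K A) in
/-- The comorphism of the map `(mult, mult~)`, `(q₁, q₂) ↦ (q₁ q₂, q₁⁻¹ q₂⁻¹)`. -/
def doubleMap : A ⊗[K] A →ₐ[K] A ⊗[K] A :=
  let q₁ : Points K A (A ⊗[K] A) := toConv inl
  let q₂ : Points K A (A ⊗[K] A) := toConv inr
  pair (q₁ * q₂).ofConv (inv q₁ * inv q₂).ofConv

/-- The `2`-form `α • β` obtained from two `1`-forms `α`, `β` with values in the Lie algebra:
`(α • β)(u, v) = α(u) • β(v) - α(v) • β(u)`. -/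
def wedge {C : Type*} [CommRing C] [Algebra K C] {q : C →ₐ[K] R}
    (B : LinearMap.BilinForm R (LieAlg K A R)) (α β : tangent q →ₗ[R] LieAlg K A R) :
    tangent q [⋀^Fin 2]→ₗ[R] R where
  toFun v := B (α (v 0)) (β (v 1)) - B (α (v 1)) (β (v 0))
  map_update_add' v i x y := by
    fin_cases i <;> simp [Function.update] <;> ring
  map_update_smul' v i x y := by
    fin_cases i <;> simp [Function.update] <;> ring
  map_eq_zero_of_eq' v i j h hij := by
    fin_cases i <;> fin_cases j <;> simp_all

instance [Algebra.FiniteType K A] : Algebra.FiniteType K (A ⊗[K] A) :=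
  Algebra.FiniteType.trans (S := A) inferInstance inferInstance

/-- The `1`-form `ω₁` on `G × G`, the index `j` meaning pullback along the projection to the
`j`-th factor. -/
def omega₁ (q : A ⊗[K] A →ₐ[K] R) : tangent q →ₗ[R] LieAlg K A R :=
  (maurerCartanL (toConv (q.comp inl))).comp (tangentMap inl q)

/-- The `1`-form `ω₂` on `G × G`. -/
def omega₂ (q : A ⊗[K] A →ₐ[K] R) : tangent q →ₗ[R] LieAlg K A R :=
  (maurerCartanL (toConv (q.comp inr))).comp (tangentMap inr q)

/-- The `1`-form `ω̄₁` on `G × G`. -/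
def omegaBar₁ (q : A ⊗[K] A →ₐ[K] R) : tangent q →ₗ[R] LieAlg K A R :=
  (maurerCartanR (toConv (q.comp inl))).comp (tangentMap inl q)

/-- The `1`-form `ω̄₂` on `G × G`. -/
def omegaBar₂ (q : A ⊗[K] A →ₐ[K] R) : tangent q →ₗ[R] LieAlg K A R :=
  (maurerCartanR (toConv (q.comp inr))).comp (tangentMap inr q)

/-- The `2`-form `σ^× = -1/2 (ω₁ • ω̄₂ + ω̄₁ • ω₂)` on `G × G`. -/
def doubleForm [Algebra.FiniteType K A] (B : LinearMap.BilinForm K (LieAlg K A K)) :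
    FormField K (A ⊗[K] A) 2 := fun R _ _ q =>
  algebraMap K R (-(1 / 2)) •
    (wedge (extForm R B) (omega₁ q) (omegaBar₂ q) + wedge (extForm R B) (omegaBar₁ q) (omega₂ q))

end Double
end Alg

end QuasiHam

end

noncomputable section

namespace QuasiHam

/-! Everything is expressed through the four Lie algebra valued forms ω₁, ω̄₁, ω₂, ω̄₂ on G × G.
They satisfy ω̄ⱼ = Ad(qⱼ) ωⱼ and the structure equations dω(X, Y) = -[ωX, ωY], dω̄(X, Y) = [ω̄X,
ω̄Y]. The form • enters only through symmetry, Ad-invariance and the infinitesimal version [x, y] •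
z = x • [y, z].

Invariance and momentum. Under (x, y) the forms ω₁ and ω̄₂ are transformed by Ad(y), while ω̄₁ and
ω₂ are transformed by Ad(x). Since σ^× pairs forms of equal type, it is invariant. By the product
rule both Maurer-Cartan forms of q₁q₂ pull back to conjugates of ω₁ + ω̄₂, and those of q₁⁻¹q₂⁻¹ to
conjugates of -(ω̄₁ + ω₂). Moreover ω₁(X_M) = X₂ - Ad(q₁⁻¹)X₁ and ω₂(X_M) = X₁ - Ad(q₂⁻¹)X₂. The
momentum equation follows by substitution and Ad-invariance.

Quasi-closedness. Put τ(x) = [x₀, x₁] • x₂, an alternating expression, so that λ is 6/12 = 1/2 times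
τ(ω) (`sum_perm_bracket`). Conjugations drop out and τ has odd degree, hence Φ^*λ = ½(τ(ω₁ + ω̄₂) -
τ(ω̄₁ + ω₂)). The pure cubic terms cancel because τ(ω₁) = τ(ω̄₁) and τ(ω₂) = τ(ω̄₂); the mixed terms
are what the structure equations give for dσ^×. This is `wedge_extDeriv` followed by
`cartan_identity`.

Non-degeneracy. If dΦ(u) = 0, then ω̄₂(u) = -ω₁(u) and ω₂(u) = -ω̄₁(u). For v with ω₁(v) = Y and
ω₂(v) = 0 the two surviving terms of σ^×(u, v) are equal and add up to -Y • ω₁(u). Hence ω₁(u) = 0,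
then ω₂(u) = 0, and u = 0.

The two settings share the multilinear algebra and differ in how the calculus is obtained. For
algebraic groups, points and tangent vectors both lie in the convolution algebra of linear maps A →
R, where q⁻¹v, vq⁻¹, Ad and the bracket are products and commutators, and vector fields act by the
Leibniz rule (`postComp_tangent_mul`); infinitesimal invariance comes from dual numbers
(`extForm_bracket_add`). For Lie groups, the forms are logarithmic derivatives f⁻¹df and df f⁻¹,
with product rules `logL_mul` and `logR_mul`; the bracket is the skew part of the mixed second
derivative of the multiplication in the chart at the unit (`bracket_eq_lieBilin`), and the structure
equations come from differentiating along a diagonal (`maurerCartan_of_div`). -/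

/-- A sum over the permutations of three letters. -/
theorem sum_perm_three {R : Type*} [CommRing R] (f : Fin 3 → Fin 3 → Fin 3 → R) :
    ∑ π : Equiv.Perm (Fin 3), ((Equiv.Perm.sign π : ℤ) : R) * f (π 0) (π 1) (π 2) =
      f 0 1 2 - f 1 0 2 - f 2 1 0 - f 0 2 1 + f 1 2 0 + f 2 0 1 := by
  have h : (Finset.univ : Finset (Equiv.Perm (Fin 3))) =
      {1, Equiv.swap 0 1, Equiv.swap 0 2, Equiv.swap 1 2,
        Equiv.swap 0 1 * Equiv.swap 1 2, Equiv.swap 1 2 * Equiv.swap 0 1} := by decide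
  rw [h, Finset.sum_insert (by decide), Finset.sum_insert (by decide),
    Finset.sum_insert (by decide), Finset.sum_insert (by decide),
    Finset.sum_insert (by decide), Finset.sum_singleton]
  have e1 : Equiv.swap (0 : Fin 3) 1 2 = 2 := by decide
  have e2 : Equiv.swap (0 : Fin 3) 2 1 = 1 := by decide
  have e3 : Equiv.swap (1 : Fin 3) 2 0 = 0 := by decide
  simp [e1, e2, e3]
  ring

/-! ### Trilinear algebra of an invariant form, common to both settings. -/

section InvariantForm
variable {R L : Type*} [CommRing R] [AddCommGroup L] [Module R L]
  {E : L →ₗ[R] L →ₗ[R] R} {br : L →ₗ[R] L →ₗ[R] L}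

/-- The `3`-form attached to an invariant bilinear form on a Lie algebra. -/
theorem sum_perm_bracket (symm : ∀ x y, E x y = E y x) (skew : ∀ x y, br x y = -br y x)
    (inv : ∀ x y z, E (br x y) z = E x (br y z)) (x : Fin 3 → L) :
    ∑ π : Equiv.Perm (Fin 3), ((Equiv.Perm.sign π : ℤ) : R) * E (br (x (π 0)) (x (π 1))) (x (π 2)) =
      6 * E (br (x 0) (x 1)) (x 2) := by
  -- Skewness `s` and cyclic symmetry `c` make the summand alternating, so all six signed terms
  -- coincide.
  have s : ∀ x y z, E (br x y) z = -E (br y x) z := fun x y z => by rw [skew]; simp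
  have c : ∀ x y z, E (br x y) z = E (br y z) x := fun x y z => by rw [inv, symm]
  rw [sum_perm_three fun i j k => E (br (x i) (x j)) (x k), c (x 2) (x 0), s (x 1) (x 0),
    s (x 2) (x 1), c (x 1) (x 2), c (x 2) (x 0), s (x 0) (x 2), c (x 2) (x 0)]
  ring

/-- Of the eight terms of the multilinear expansion six are mixed. Cyclic symmetry sorts them into
three with two entries from `a` and three with two entries from `b`. -/
theorem bracket_add_three (symm : ∀ x y, E x y = E y x)
    (inv : ∀ x y z, E (br x y) z = E x (br y z)) (a b : Fin 3 → L) :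
    E (br (a 0 + b 0) (a 1 + b 1)) (a 2 + b 2) =
      E (br (a 0) (a 1)) (a 2) + E (br (b 0) (b 1)) (b 2) +
      (E (br (a 0) (a 1)) (b 2) + E (br (a 1) (a 2)) (b 0) + E (br (a 2) (a 0)) (b 1)) +
      (E (a 0) (br (b 1) (b 2)) + E (a 1) (br (b 2) (b 0)) + E (a 2) (br (b 0) (b 1))) := by
  have c : ∀ x y z, E (br x y) z = E (br y z) x := fun x y z => by rw [inv, symm]
  have c' : ∀ x y z, E x (br y z) = E (br x y) z := fun x y z => (inv x y z).symm
  simp only [map_add, LinearMap.add_apply, c']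
  linear_combination c (b 0) (a 1) (a 2) - c (a 2) (a 0) (b 1) + c (b 0) (a 1) (b 2) -
    c (a 2) (b 0) (b 1)

/-- The exterior derivative of the `2`-form `α • β` in terms of those of `α` and `β`. Here
`Dα i j` stands for the derivative of `α j` in the direction `i` and `kα i j` for the value of `α`
on the bracket of the vector fields `i` and `j`. -/
theorem wedge_extDeriv {α β : Fin 3 → L} {Dα Dβ kα kβ dα dβ : Fin 3 → Fin 3 → L}
    (hα : ∀ i j, Dα i j = Dα j i + kα i j + dα i j)
    (hβ : ∀ i j, Dβ i j = Dβ j i + kβ i j + dβ i j) :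
    (E (Dα 0 1) (β 2) + E (α 1) (Dβ 0 2) - (E (Dα 0 2) (β 1) + E (α 2) (Dβ 0 1))) -
    (E (Dα 1 0) (β 2) + E (α 0) (Dβ 1 2) - (E (Dα 1 2) (β 0) + E (α 2) (Dβ 1 0))) +
    (E (Dα 2 0) (β 1) + E (α 0) (Dβ 2 1) - (E (Dα 2 1) (β 0) + E (α 1) (Dβ 2 0))) -
    (E (kα 0 1) (β 2) - E (α 2) (kβ 0 1)) + (E (kα 0 2) (β 1) - E (α 1) (kβ 0 2)) -
    (E (kα 1 2) (β 0) - E (α 0) (kβ 1 2)) =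
    E (dα 0 1) (β 2) - E (dα 0 2) (β 1) + E (dα 1 2) (β 0) -
      (E (α 2) (dβ 0 1) - E (α 1) (dβ 0 2) + E (α 0) (dβ 1 2)) := by
  -- Only the pairs i < j are rewritten: the opposite derivatives then cancel in pairs, and the
  -- terms `kα`, `kβ` cancel against the bracket terms of the invariant formula.
  rw [hα 0 1, hα 0 2, hα 1 2, hβ 0 1, hβ 0 2, hβ 1 2]
  simp only [map_add, LinearMap.add_apply]
  ring

/-- The identity behind `dσ^× = Φ^* λ`, with `a = ω₁`, `a' = ω̄₁`, `b = ω₂`, `b' = ω̄₂`. -/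
theorem cartan_identity (symm : ∀ x y, E x y = E y x) (skew : ∀ x y, br x y = -br y x)
    (inv : ∀ x y z, E (br x y) z = E x (br y z)) {a a' b b' : Fin 3 → L}
    (ha : E (br (a 0) (a 1)) (a 2) = E (br (a' 0) (a' 1)) (a' 2))
    (hb : E (br (b 0) (b 1)) (b 2) = E (br (b' 0) (b' 1)) (b' 2)) :
    (E (-br (a 0) (a 1)) (b' 2) - E (-br (a 0) (a 2)) (b' 1) + E (-br (a 1) (a 2)) (b' 0) -
      (E (a 2) (br (b' 0) (b' 1)) - E (a 1) (br (b' 0) (b' 2)) + E (a 0) (br (b' 1) (b' 2)))) +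
    (E (br (a' 0) (a' 1)) (b 2) - E (br (a' 0) (a' 2)) (b 1) + E (br (a' 1) (a' 2)) (b 0) -
      (E (a' 2) (-br (b 0) (b 1)) - E (a' 1) (-br (b 0) (b 2)) + E (a' 0) (-br (b 1) (b 2)))) =
    -(E (br (a 0 + b' 0) (a 1 + b' 1)) (a 2 + b' 2) -
      E (br (a' 0 + b 0) (a' 1 + b 1)) (a' 2 + b 2)) := by
  -- By `ha` and `hb` the pure cubic terms of the two expansions cancel; only mixed terms are left
  -- to compare.
  rw [bracket_add_three symm inv, bracket_add_three symm inv, ha, hb, skew (a 2), skew (b' 2),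
    skew (a' 2), skew (b 2)]
  simp only [map_neg, LinearMap.neg_apply]
  ring

end InvariantForm

namespace Alg

open Set WithConv

universe u v w

/-! ### Algebraic setting: points and tangent vectors in the convolution algebra. -/

section ConvolutionAlgebra
variable {K : Type u} [Field K] {A : Type*} [CommRing A] [HopfAlgebra K A]
  {R S C : Type*} [CommRing R] [Algebra K R] [CommRing S] [Algebra K S] [CommRing C] [Algebra K C]

/-- A point, as an element of the convolution algebra. -/
def ofPoint (q : Points K A R) : WithConv (A →ₗ[K] R) := toConv q.ofConv.toLinearMap

/-- A tangent vector, as an element of the convolution algebra. -/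
def ofTangent {p : A →ₐ[K] R} (v : tangent p) : WithConv (A →ₗ[K] R) := toConv v.1

theorem ofTangent_injective {p : A →ₐ[K] R} :
    Function.Injective (ofTangent : tangent p → WithConv (A →ₗ[K] R)) :=
  fun _ _ h => Subtype.ext (toConv_injective h)

@[simp] theorem ofTangent_add {p : A →ₐ[K] R} (v w : tangent p) :
    ofTangent (v + w) = ofTangent v + ofTangent w := rfl

@[simp] theorem ofTangent_sub {p : A →ₐ[K] R} (v w : tangent p) :
    ofTangent (v - w) = ofTangent v - ofTangent w := rfl

@[simp] theorem ofTangent_neg {p : A →ₐ[K] R} (v : tangent p) :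
    ofTangent (-v) = -ofTangent v := rfl

@[simp] theorem ofTangent_zero {p : A →ₐ[K] R} :
    ofTangent (0 : tangent p) = 0 := rfl

@[simp] theorem ofTangent_smul {p : A →ₐ[K] R} (r : R) (v : tangent p) :
    ofTangent (r • v) = r • ofTangent v := rfl

@[simp] theorem ofPoint_mul (p q : Points K A R) : ofPoint (p * q) = ofPoint p * ofPoint q :=
  toConv_injective.eq_iff.2 rfl |>.trans (AlgHom.toLinearMap_convMul _ _)

@[simp] theorem ofPoint_one : ofPoint (1 : Points K A R) = 1 :=
  AlgHom.toLinearMap_convOne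

@[simp] theorem ofPoint_mul_inv (p : Points K A R) : ofPoint p * ofPoint (inv p) = 1 := by
  rw [← ofPoint_mul, mul_inv, ofPoint_one]

@[simp] theorem ofPoint_inv_mul (p : Points K A R) : ofPoint (inv p) * ofPoint p = 1 := by
  rw [← ofPoint_mul, inv_mul, ofPoint_one]

@[simp] theorem ofPoint_mul_inv_cancel_left (p : Points K A R) (x) :
    ofPoint p * (ofPoint (inv p) * x) = x := by
  rw [← mul_assoc, ofPoint_mul_inv, one_mul]

@[simp] theorem ofPoint_inv_mul_cancel_left (p : Points K A R) (x) :
    ofPoint (inv p) * (ofPoint p * x) = x := by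
  rw [← mul_assoc, ofPoint_inv_mul, one_mul]

@[simp] theorem inv_inv (p : Points K A R) : inv (inv p) = p :=
  left_inv_eq_right_inv (inv_mul _) (inv_mul p)

/-- Composition of an element of the convolution algebra with a linear map between the algebras of
values. -/
def postComp (L : C →ₗ[K] R) (f : WithConv (A →ₗ[K] C)) : WithConv (A →ₗ[K] R) :=
  toConv (L ∘ₗ f.ofConv)

@[simp] theorem postComp_add (L : C →ₗ[K] R) (f g : WithConv (A →ₗ[K] C)) :
    postComp L (f + g) = postComp L f + postComp L g :=
  WithConv.ext (LinearMap.comp_add ..)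

@[simp] theorem postComp_sub (L : C →ₗ[K] R) (f g : WithConv (A →ₗ[K] C)) :
    postComp L (f - g) = postComp L f - postComp L g :=
  WithConv.ext (LinearMap.comp_sub ..)

theorem postComp_algHom_mul (h : C →ₐ[K] R) (f g : WithConv (A →ₗ[K] C)) :
    postComp h.toLinearMap (f * g) = postComp h.toLinearMap f * postComp h.toLinearMap g :=
  WithConv.ext (LinearMap.algHom_comp_convMul_distrib h f g)

theorem postComp_ofPoint (h : C →ₐ[K] R) (q : Points K A C) :
    postComp h.toLinearMap (ofPoint q) = ofPoint (toConv (h.comp q.ofConv)) := rfl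

/-- Tangent vectors act on the convolution algebra by derivations. -/
theorem postComp_tangent_mul {p : C →ₐ[K] R} (v : tangent p) (f g : WithConv (A →ₗ[K] C)) :
    postComp v.1 (f * g) =
      postComp v.1 f * postComp p.toLinearMap g + postComp p.toLinearMap f * postComp v.1 g := by
  apply WithConv.ext
  ext a
  simp only [postComp, LinearMap.convMul_def, ofConv_add, LinearMap.add_apply,
    LinearMap.comp_apply]
  generalize CoalgebraStruct.comul (R := K) a = z
  induction z with
  | zero => simp
  | add x y hx hy => simp only [map_add, hx, hy]; ring
  | tmul b c =>
    have := v.2 (f.ofConv b) (g.ofConv c)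
    simp only [TensorProduct.map_tmul, LinearMap.mul'_apply, LinearMap.comp_apply, this,
      AlgHom.toLinearMap_apply]
    ring

@[simp] theorem postComp_tangent_one {p : C →ₐ[K] R} (v : tangent p) :
    postComp v.1 (1 : WithConv (A →ₗ[K] C)) = 0 := by
  have h := v.2 1 1
  simp only [mul_one, map_one, one_mul, left_eq_add] at h
  apply WithConv.ext
  ext a
  simp [postComp, LinearMap.convOne_def, Algebra.algebraMap_eq_smul_one, h]

theorem comp_inv (h : C →ₐ[K] R) (q : Points K A C) :
    toConv (h.comp (inv q).ofConv) = inv (toConv (h.comp q.ofConv)) := rfl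

/-- The identity q q⁻¹ = 1 is differentiated along `v` and solved for the derivative of q⁻¹. -/
theorem postComp_tangent_inv {p : C →ₐ[K] R} (v : tangent p) (q : Points K A C) :
    postComp v.1 (ofPoint (inv q)) = -(ofPoint (inv (toConv (p.comp q.ofConv))) *
      postComp v.1 (ofPoint q) * ofPoint (inv (toConv (p.comp q.ofConv)))) := by
  have h := postComp_tangent_mul v (ofPoint q) (ofPoint (inv q))
  rw [ofPoint_mul_inv, postComp_tangent_one, postComp_ofPoint, postComp_ofPoint, comp_inv] at h
  have h' := congrArg (fun x => ofPoint (inv (toConv (p.comp q.ofConv))) * x) h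
  simp only [mul_zero, mul_add, ofPoint_inv_mul_cancel_left] at h'
  rw [mul_assoc]
  exact (neg_eq_of_add_eq_zero_right h'.symm).symm

-- With these definitional equalities and the injectivity of `ofTangent`, statements about
-- Maurer-Cartan forms, adjoint action and bracket become identities in an associative algebra.
@[simp] theorem ofTangent_maurerCartanL (q : Points K A R) (v : tangent q.ofConv) :
    ofTangent (maurerCartanL q v) = ofPoint (inv q) * ofTangent v := rfl

@[simp] theorem ofTangent_maurerCartanR (q : Points K A R) (v : tangent q.ofConv) :
    ofTangent (maurerCartanR q v) = ofTangent v * ofPoint (inv q) := rfl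

@[simp] theorem ofTangent_bracket (ξ η : LieAlg K A R) :
    ofTangent (bracket ξ η) = ofTangent ξ * ofTangent η - ofTangent η * ofTangent ξ := rfl

@[simp] theorem ofTangent_Ad (g : Points K A R) (ξ : LieAlg K A R) :
    ofTangent (Ad g ξ) = ofPoint g * ofTangent ξ * ofPoint (inv g) := rfl

/-- The adjoint action as a linear map. -/
def adLinear (g : Points K A R) : LieAlg K A R →ₗ[R] LieAlg K A R where
  toFun := Ad g
  map_add' ξ η := ofTangent_injective (by simp [mul_add, add_mul])
  map_smul' r ξ := ofTangent_injective (by simp)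

theorem Ad_add (g : Points K A R) (ξ η : LieAlg K A R) : Ad g (ξ + η) = Ad g ξ + Ad g η :=
  map_add (adLinear g) ξ η

theorem Ad_Ad_inv (g : Points K A R) (ξ : LieAlg K A R) : Ad g (Ad (inv g) ξ) = ξ :=
  ofTangent_injective (by simp [mul_assoc])

theorem Ad_inv_Ad (g : Points K A R) (ξ : LieAlg K A R) : Ad (inv g) (Ad g ξ) = ξ :=
  ofTangent_injective (by simp [mul_assoc])

theorem Ad_bracket (g : Points K A R) (ξ η : LieAlg K A R) :
    Ad g (bracket ξ η) = bracket (Ad g ξ) (Ad g η) :=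
  ofTangent_injective (by simp [mul_assoc, mul_sub, sub_mul])

/-- The bracket as a bilinear map. -/
def bracketBilin : LieAlg K A R →ₗ[R] LieAlg K A R →ₗ[R] LieAlg K A R :=
  LinearMap.mk₂ R bracket
    (fun _ _ _ => ofTangent_injective (by simp [mul_add, add_mul]; abel))
    (fun _ _ _ => ofTangent_injective (by simp [smul_sub]))
    (fun _ _ _ => ofTangent_injective (by simp [mul_add, add_mul]; abel))
    (fun _ _ _ => ofTangent_injective (by simp [smul_sub]))

theorem bracketBilin_apply (ξ η : LieAlg K A R) : bracketBilin ξ η = bracket ξ η := rfl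

theorem bracket_swap (ξ η : LieAlg K A R) : bracket ξ η = -bracket η ξ :=
  ofTangent_injective (by simp)

theorem tangent_ofConv_one_congr (h : R →ₐ[K] S) :
    h.comp (1 : Points K A R).ofConv = (1 : Points K A S).ofConv := by
  ext; simp

/-- Extension of scalars of an element of the Lie algebra. -/
def lieBaseChange (h : R →ₐ[K] S) (ξ : LieAlg K A R) : LieAlg K A S :=
  ⟨h.toLinearMap ∘ₗ ξ.1, by
    rw [← tangent_ofConv_one_congr h]; exact (tangentBaseChange h ξ).2⟩

theorem ofTangent_lieBaseChange (h : R →ₐ[K] S) (ξ : LieAlg K A R) :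
    ofTangent (lieBaseChange h ξ) = postComp h.toLinearMap (ofTangent ξ) := rfl

/-- The derivation of the Lie algebra `𝔤(R)` induced by a derivation of `R`. -/
def lieDeriv (D : Derivation K R R) (ξ : LieAlg K A R) : LieAlg K A R :=
  ⟨D.toLinearMap ∘ₗ ξ.1, fun a b => by
    -- The identity point takes its values in K, which `D` kills, so no extra term arises from
    -- differentiating the coefficients.
    have := ξ.2 a b
    simp [this]⟩

theorem ofTangent_lieDeriv (D : Derivation K R R) (ξ : LieAlg K A R) :
    ofTangent (lieDeriv D ξ) = postComp (ofDerivation D).1 (ofTangent ξ) := rfl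

end ConvolutionAlgebra

/-! ### The R-bilinear extension of the form. -/

section ExtendedForm
variable {K : Type u} [Field K] {A : Type*} [CommRing A] [HopfAlgebra K A]
  {R S C : Type*} [CommRing R] [Algebra K R] [CommRing S] [Algebra K S] [CommRing C] [Algebra K C]
theorem lieBaseChange_add (h : R →ₐ[K] S) (ξ η : LieAlg K A R) :
    lieBaseChange h (ξ + η) = lieBaseChange h ξ + lieBaseChange h η :=
  ofTangent_injective (by simp [ofTangent_lieBaseChange])

theorem lieBaseChange_zero (h : R →ₐ[K] S) : lieBaseChange h (0 : LieAlg K A R) = 0 :=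
  Subtype.ext (by ext; simp [lieBaseChange])

theorem lieBaseChange_smul_ofLie (h : R →ₐ[K] S) (r : R) (X : LieAlg K A K) :
    lieBaseChange h (r • ofLie X) = h r • ofLie X :=
  Subtype.ext (by ext; simp [lieBaseChange, ofLie])

theorem lieDeriv_add (D : Derivation K R R) (ξ η : LieAlg K A R) :
    lieDeriv D (ξ + η) = lieDeriv D ξ + lieDeriv D η :=
  ofTangent_injective (by simp [ofTangent_lieDeriv])

theorem lieDeriv_zero (D : Derivation K R R) : lieDeriv D (0 : LieAlg K A R) = 0 :=
  Subtype.ext (by ext; simp [lieDeriv])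

/-- An element of 𝔤 has values in K, so only the coefficient `r` is differentiated. -/
theorem lieDeriv_smul_ofLie (D : Derivation K R R) (r : R) (X : LieAlg K A K) :
    lieDeriv D (r • ofLie X) = D r • ofLie X :=
  Subtype.ext (by ext; simp [lieDeriv, ofLie, mul_comm])

variable [Algebra.FiniteType K A]
  (B : LinearMap.BilinForm K (LieAlg K A K))

theorem extendScalars_symm_smul_ofLie (r : R) (X : LieAlg K A K) :
    (extendScalars K A R).symm (r • ofLie X) = r ⊗ₜ X := by
  rw [LinearEquiv.symm_apply_eq]
  exact (LinearMap.liftBaseChange_tmul R (ofLie (K := K) (A := A) (R := R)) r X).symm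

/-- Together with `lieAlg_induction` this determines the extended form; identities about it are
checked on multiples of elements of 𝔤. -/
theorem extForm_smul_ofLie (r s : R) (X Y : LieAlg K A K) :
    extForm R B (r • ofLie X) (s • ofLie Y) = algebraMap K R (B X Y) * (r * s) := by
  rw [← Algebra.smul_def, ← LinearMap.BilinForm.baseChange_tmul,
    ← extendScalars_symm_smul_ofLie, ← extendScalars_symm_smul_ofLie]
  rfl

/-- Elements of `𝔤(R)` are sums of multiples of elements of `𝔤`. -/
theorem lieAlg_induction {P : LieAlg K A R → Prop} (zero : P 0)
    (smul : ∀ (r : R) (X : LieAlg K A K), P (r • ofLie X))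
    (add : ∀ ξ η, P ξ → P η → P (ξ + η)) (ξ : LieAlg K A R) : P ξ := by
  obtain ⟨z, rfl⟩ := (extendScalars K A R).surjective ξ
  induction z with
  | zero => simpa using zero
  | add x y hx hy => simpa using add _ _ hx hy
  | tmul r X =>
    rw [← extendScalars_symm_smul_ofLie, LinearEquiv.apply_symm_apply]
    exact smul r X

variable {B}

theorem extForm_symm (hB : B.IsSymm) (ξ η : LieAlg K A R) :
    extForm R B ξ η = extForm R B η ξ := by
  induction ξ using lieAlg_induction with
  | zero => simp
  | add x y hx hy => rw [map_add, map_add, LinearMap.add_apply, hx, hy]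
  | smul r X =>
    induction η using lieAlg_induction with
    | zero => simp
    | add x y hx hy => rw [map_add, map_add, LinearMap.add_apply, hx, hy]
    | smul s Y => rw [extForm_smul_ofLie, extForm_smul_ofLie, hB.eq, mul_comm r]

variable (B) in
theorem extForm_neg_left (ξ η : LieAlg K A R) : extForm R B (-ξ) η = -extForm R B ξ η :=
  LinearMap.map_neg₂ (extForm R B) ξ η

variable (B) in
theorem extForm_neg_right (ξ η : LieAlg K A R) : extForm R B ξ (-η) = -extForm R B ξ η :=
  LinearMap.map_neg (extForm R B ξ) η

/-- Non-degeneracy survives extension of scalars to any R: in a K-basis of R the coordinates of `ξ`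
are elements of 𝔤, and the i-th coordinate of ξ • Y is the pairing of the i-th coordinate of `ξ`
with Y. Testing against 𝔤 alone therefore suffices. -/
theorem extForm_zero_right_of_ofLie (ξ : LieAlg K A R)
    (h : ∀ Y : LieAlg K A K, extForm R B ξ (ofLie Y) = 0) (hB : B.Nondegenerate) : ξ = 0 := by
  classical
  obtain ⟨z, rfl⟩ := (extendScalars K A R).surjective ξ
  suffices z = 0 by rw [this, map_zero]
  let b := Module.Basis.ofVectorSpace K R
  apply (TensorProduct.equivFinsuppOfBasisLeft b).injective
  rw [map_zero]
  ext1 i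
  refine hB.1 _ fun Y => ?_
  have key : ∀ z : R ⊗[K] LieAlg K A K,
      b.repr (extForm R B (extendScalars K A R z) (ofLie Y)) i =
        B ((TensorProduct.equivFinsuppOfBasisLeft b z) i) Y := by
    intro z
    induction z with
    | zero => simp
    | add x y hx hy => simp [hx, hy]
    | tmul r X =>
      have := extForm_smul_ofLie B r 1 X Y
      rw [one_smul, mul_one, ← Algebra.smul_def] at this
      rw [← extendScalars_symm_smul_ofLie, LinearEquiv.apply_symm_apply, this,
        extendScalars_symm_smul_ofLie, TensorProduct.equivFinsuppOfBasisLeft_apply_tmul_apply]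
      simp [mul_comm]
  rw [← key, h, map_zero]; rfl

variable (B) in
theorem extForm_lieBaseChange (h : R →ₐ[K] S) (ξ η : LieAlg K A R) :
    extForm S B (lieBaseChange h ξ) (lieBaseChange h η) = h (extForm R B ξ η) := by
  induction ξ using lieAlg_induction with
  | zero => simp [lieBaseChange_zero]
  | add x y hx hy => simp [lieBaseChange_add, hx, hy]
  | smul r X =>
    induction η using lieAlg_induction with
    | zero => simp [lieBaseChange_zero]
    | add x y hx hy => rw [lieBaseChange_add, map_add, map_add, hx, hy, map_add]
    | smul s Y =>
      rw [lieBaseChange_smul_ofLie, lieBaseChange_smul_ofLie, extForm_smul_ofLie,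
        extForm_smul_ofLie]
      simp

-- The values of `B` on 𝔤 lie in K and are killed by `D`, so the Leibniz rule for the product of the
-- two coefficients is all that is needed.
variable (B) in
theorem derivation_extForm (D : Derivation K R R) (ξ η : LieAlg K A R) :
    D (extForm R B ξ η) = extForm R B (lieDeriv D ξ) η + extForm R B ξ (lieDeriv D η) := by
  induction ξ using lieAlg_induction with
  | zero => simp [lieDeriv_zero]
  | add x y hx hy => simp [lieDeriv_add, hx, hy]; ring
  | smul r X =>
    induction η using lieAlg_induction with
    | zero => simp [lieDeriv_zero]
    | add x y hx hy => rw [lieDeriv_add, map_add, map_add, map_add, map_add, hx, hy]; ring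
    | smul s Y =>
      rw [lieDeriv_smul_ofLie, lieDeriv_smul_ofLie, extForm_smul_ofLie,
        extForm_smul_ofLie, extForm_smul_ofLie]
      simp
      ring

end ExtendedForm

/-! ### Infinitesimal invariance by means of dual numbers. -/

section AdInvariance
variable {K : Type u} [Field K] {A : Type v} [CommRing A] [HopfAlgebra K A]
  {R : Type v} [CommRing R] [Algebra K R]

/-- The point `1 + ε ζ` of `G(R[ε])`. -/
def infinitesimalPoint (ζ : LieAlg K A R) : Points K A (DualNumber R) :=
  toConv (AlgHom.ofLinearMap
    ((TrivSqZeroExt.inlAlgHom K R R).toLinearMap ∘ₗ (1 : Points K A R).ofConv.toLinearMap +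
      (TrivSqZeroExt.inrHom R R).restrictScalars K ∘ₗ ζ.1)
    (by
      have h := ζ.2 1 1
      simp only [mul_one, map_one, one_mul, left_eq_add] at h
      simp [h])
    (fun a b => by
      have h := ζ.2 a b
      simp only [LinearMap.add_apply, LinearMap.comp_apply, h]
      ext <;> simp [mul_comm, TrivSqZeroExt.algebraMap_eq_inl']))

theorem ofPoint_infinitesimalPoint (ζ : LieAlg K A R) :
    ofPoint (infinitesimalPoint ζ) = 1 + (DualNumber.eps : DualNumber R) •
      ofTangent (lieBaseChange (TrivSqZeroExt.inlAlgHom K R R) ζ) := by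
  apply WithConv.ext
  ext a <;>
  simp [infinitesimalPoint, ofPoint, ofTangent, lieBaseChange, TrivSqZeroExt.algebraMap_eq_inl']

/-- Since ε² = 0, the element 1 - εζ is inverse to 1 + εζ. -/
theorem ofPoint_inv_infinitesimalPoint (ζ : LieAlg K A R) :
    ofPoint (inv (infinitesimalPoint ζ)) = 1 - (DualNumber.eps : DualNumber R) •
      ofTangent (lieBaseChange (TrivSqZeroExt.inlAlgHom K R R) ζ) := by
  refine left_inv_eq_right_inv (ofPoint_inv_mul _) ?_
  rw [ofPoint_infinitesimalPoint]
  simp [mul_sub, add_mul, smul_smul]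

/-- The product (1 + εζ) ξ (1 - εζ) has ε-coefficient ζξ - ξζ: the derivative of the adjoint action
is the bracket. -/
theorem Ad_infinitesimalPoint (ζ ξ : LieAlg K A R) :
    Ad (infinitesimalPoint ζ) (lieBaseChange (TrivSqZeroExt.inlAlgHom K R R) ξ) =
      lieBaseChange (TrivSqZeroExt.inlAlgHom K R R) ξ + (DualNumber.eps : DualNumber R) •
        lieBaseChange (TrivSqZeroExt.inlAlgHom K R R) (bracket ζ ξ) := by
  apply ofTangent_injective
  simp only [ofTangent_Ad, ofPoint_infinitesimalPoint, ofPoint_inv_infinitesimalPoint,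
    ofTangent_add, ofTangent_smul, ofTangent_lieBaseChange, ofTangent_bracket, postComp_sub,
    postComp_algHom_mul, mul_sub, add_mul, smul_sub, one_mul, mul_one, smul_mul_assoc,
    mul_smul_comm, smul_smul, DualNumber.eps_mul_eps, zero_smul, smul_add]
  abel

variable [Algebra.FiniteType K A] {B : LinearMap.BilinForm K (LieAlg K A K)}

/-- This is the ε-coefficient of Ad-invariance at the point 1 + εζ. Invariance is thus used over the
ring R[ε], not merely at K-valued points. -/
theorem extForm_bracket_add (hB : IsAdInvariant B) (ζ ξ η : LieAlg K A R) :
    extForm R B (bracket ζ ξ) η + extForm R B ξ (bracket ζ η) = 0 := by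
  have h := hB (DualNumber R) (infinitesimalPoint ζ)
    (lieBaseChange (TrivSqZeroExt.inlAlgHom K R R) ξ)
    (lieBaseChange (TrivSqZeroExt.inlAlgHom K R R) η)
  simp only [Ad_infinitesimalPoint, map_add, LinearMap.add_apply, map_smul, LinearMap.smul_apply,
    extForm_lieBaseChange] at h
  have h' := congrArg TrivSqZeroExt.snd h
  simpa using h'

theorem extForm_bracket_left (hB : IsAdInvariant B) (ξ ζ η : LieAlg K A R) :
    extForm R B (bracket ξ ζ) η = extForm R B ξ (bracket ζ η) := by
  rw [bracket_swap ξ, extForm_neg_left, neg_eq_iff_add_eq_zero, extForm_bracket_add hB]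

end AdInvariance

/-! ### Componentwise calculus on a product of groups. -/

section Product
variable {K : Type u} [Field K] {A : Type v} [CommRing A] [HopfAlgebra K A]
  {R : Type*} [CommRing R] [Algebra K R]

/-- The comorphism of a projection respects comultiplication: Δ(a ⊗ 1) = ∑ (a₁ ⊗ 1) ⊗ (a₂ ⊗ 1).
Hence taking components commutes with convolution, and so with Maurer-Cartan forms, brackets and Ad.
-/
theorem convMul_comp_inl (f g : WithConv (A ⊗[K] A →ₗ[K] R)) :
    toConv ((f * g).ofConv ∘ₗ (inl (K := K) (A := A)).toLinearMap) =
      toConv (f.ofConv ∘ₗ (inl (K := K) (A := A)).toLinearMap) *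
        toConv (g.ofConv ∘ₗ (inl (K := K) (A := A)).toLinearMap) := by
  apply WithConv.ext
  ext a
  simp only [LinearMap.convMul_def, LinearMap.comp_apply, AlgHom.toLinearMap_apply,
    Algebra.TensorProduct.includeLeft_apply, TensorProduct.comul_tmul, Bialgebra.comul_one]
  generalize CoalgebraStruct.comul (R := K) a = z
  induction z with
  | zero => simp
  | add x y hx hy => simp [TensorProduct.add_tmul, hx, hy]
  | tmul b c => simp [Algebra.TensorProduct.one_def]

theorem convMul_comp_inr (f g : WithConv (A ⊗[K] A →ₗ[K] R)) :
    toConv ((f * g).ofConv ∘ₗ (inr (K := K) (A := A)).toLinearMap) =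
      toConv (f.ofConv ∘ₗ (inr (K := K) (A := A)).toLinearMap) *
        toConv (g.ofConv ∘ₗ (inr (K := K) (A := A)).toLinearMap) := by
  apply WithConv.ext
  ext a
  simp only [LinearMap.convMul_def, LinearMap.comp_apply, AlgHom.toLinearMap_apply,
    Algebra.TensorProduct.includeRight_apply, TensorProduct.comul_tmul, Bialgebra.comul_one]
  generalize CoalgebraStruct.comul (R := K) a = z
  induction z with
  | zero => simp
  | add x y hx hy => simp [TensorProduct.tmul_add, hx, hy]
  | tmul b c => simp [Algebra.TensorProduct.one_def]

theorem inv_comp_inl (q : Points K (A ⊗[K] A) R) :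
    toConv ((inv q).ofConv.comp inl) = inv (toConv (q.ofConv.comp inl)) := by
  refine left_inv_eq_right_inv ?_ (mul_inv _)
  rw [← mul_comp_inl, inv_mul, one_comp_inl, toConv_ofConv]

theorem inv_comp_inr (q : Points K (A ⊗[K] A) R) :
    toConv ((inv q).ofConv.comp inr) = inv (toConv (q.ofConv.comp inr)) := by
  refine left_inv_eq_right_inv ?_ (mul_inv _)
  rw [← mul_comp_inr, inv_mul, one_comp_inr, toConv_ofConv]

theorem lieFst_maurerCartanL (q : Points K (A ⊗[K] A) R) (v : tangent q.ofConv) :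
    lieFst K A R (maurerCartanL q v) =
      maurerCartanL (toConv (q.ofConv.comp inl)) (tangentMap inl q.ofConv v) := by
  apply ofTangent_injective
  rw [ofTangent_maurerCartanL, ← inv_comp_inl]
  exact convMul_comp_inl (ofPoint (inv q)) (ofTangent v)

theorem lieSnd_maurerCartanL (q : Points K (A ⊗[K] A) R) (v : tangent q.ofConv) :
    lieSnd K A R (maurerCartanL q v) =
      maurerCartanL (toConv (q.ofConv.comp inr)) (tangentMap inr q.ofConv v) := by
  apply ofTangent_injective
  rw [ofTangent_maurerCartanL, ← inv_comp_inr]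
  exact convMul_comp_inr (ofPoint (inv q)) (ofTangent v)

theorem lieFst_maurerCartanR (q : Points K (A ⊗[K] A) R) (v : tangent q.ofConv) :
    lieFst K A R (maurerCartanR q v) =
      maurerCartanR (toConv (q.ofConv.comp inl)) (tangentMap inl q.ofConv v) := by
  apply ofTangent_injective
  rw [ofTangent_maurerCartanR, ← inv_comp_inl]
  exact convMul_comp_inl (ofTangent v) (ofPoint (inv q))

theorem lieSnd_maurerCartanR (q : Points K (A ⊗[K] A) R) (v : tangent q.ofConv) :
    lieSnd K A R (maurerCartanR q v) =
      maurerCartanR (toConv (q.ofConv.comp inr)) (tangentMap inr q.ofConv v) := by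
  apply ofTangent_injective
  rw [ofTangent_maurerCartanR, ← inv_comp_inr]
  exact convMul_comp_inr (ofTangent v) (ofPoint (inv q))

theorem lieFst_bracket (ξ η : LieAlg K (A ⊗[K] A) R) :
    lieFst K A R (bracket ξ η) = bracket (lieFst K A R ξ) (lieFst K A R η) := by
  apply ofTangent_injective
  rw [ofTangent_bracket]
  exact (congrArg₂ (· - ·) (convMul_comp_inl (ofTangent ξ) (ofTangent η))
    (convMul_comp_inl (ofTangent η) (ofTangent ξ)) :)

theorem lieSnd_bracket (ξ η : LieAlg K (A ⊗[K] A) R) :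
    lieSnd K A R (bracket ξ η) = bracket (lieSnd K A R ξ) (lieSnd K A R η) := by
  apply ofTangent_injective
  rw [ofTangent_bracket]
  exact (congrArg₂ (· - ·) (convMul_comp_inr (ofTangent ξ) (ofTangent η))
    (convMul_comp_inr (ofTangent η) (ofTangent ξ)) :)

theorem lieFst_ofLie (X : LieAlg K (A ⊗[K] A) K) :
    lieFst K A R (ofLie X) = ofLie (lieFst K A K X) := rfl

theorem lieSnd_ofLie (X : LieAlg K (A ⊗[K] A) K) :
    lieSnd K A R (ofLie X) = ofLie (lieSnd K A K X) := rfl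

/-- Both sides are R-bilinear, which leaves multiples of elements of 𝔤 ⊕ 𝔤̃; there the components
commute with extension of scalars. -/
theorem extForm_sumForm [Algebra.FiniteType K A] (B : LinearMap.BilinForm K (LieAlg K A K))
    (ξ η : LieAlg K (A ⊗[K] A) R) :
    extForm R (sumForm B) ξ η = extForm R B (lieFst K A R ξ) (lieFst K A R η) +
      extForm R B (lieSnd K A R ξ) (lieSnd K A R η) := by
  induction ξ using lieAlg_induction with
  | zero => simp
  | add x y hx hy => simp only [map_add, LinearMap.add_apply, hx, hy]; ring
  | smul r X =>
    induction η using lieAlg_induction with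
    | zero => simp
    | add x y hx hy => simp only [map_add, hx, hy]; ring
    | smul s Y =>
      simp only [extForm_smul_ofLie, map_smul (lieFst K A R), map_smul (lieSnd K A R),
        lieFst_ofLie, lieSnd_ofLie]
      simp [sumForm, add_mul]

/-- A tangent vector of a product along the first factor. -/
def tangentLeft {C D : Type*} [CommRing C] [Algebra K C] [CommRing D] [Algebra K D]
    {p : C →ₐ[K] R} (X : tangent p) (q : D →ₐ[K] R) : tangent (pair p q) :=
  ⟨LinearMap.mul' K R ∘ₗ TensorProduct.map X.1 q.toLinearMap,
    fun s t => mul'_map_point_right p q X.1 X.2 s t⟩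

/-- A tangent vector of a product along the second factor. -/
def tangentRight {C D : Type*} [CommRing C] [Algebra K C] [CommRing D] [Algebra K D]
    (p : C →ₐ[K] R) {q : D →ₐ[K] R} (Y : tangent q) : tangent (pair p q) :=
  ⟨LinearMap.mul' K R ∘ₗ TensorProduct.map p.toLinearMap Y.1,
    fun s t => mul'_map_point_left p q Y.1 Y.2 s t⟩

theorem tangent_map_one {C : Type*} [CommRing C] [Algebra K C] {p : C →ₐ[K] R} (X : tangent p) :
    X.1 1 = 0 := by
  simpa using X.2 1 1

section
variable {C D : Type*} [CommRing C] [Algebra K C] [CommRing D] [Algebra K D]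

-- A vector along one factor differentiates only points pulled back from that factor. With the
-- Leibniz rule, these four evaluations give the derivative of any word in the coordinate points.
@[simp] theorem postComp_tangentLeft_left {p : C →ₐ[K] R} (X : tangent p) (q : D →ₐ[K] R)
    (f : A →ₐ[K] C) :
    postComp (tangentLeft X q).1 (ofPoint (toConv (Algebra.TensorProduct.includeLeft.comp f))) =
      ofTangent (tangentMap f p X) := by
  apply WithConv.ext
  ext a
  simp [postComp, tangentLeft, ofPoint, ofTangent, tangentMap]

@[simp] theorem postComp_tangentLeft_right {p : C →ₐ[K] R} (X : tangent p) (q : D →ₐ[K] R)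
    (f : A →ₐ[K] D) :
    postComp (tangentLeft X q).1 (ofPoint (toConv (Algebra.TensorProduct.includeRight.comp f))) =
      0 := by
  apply WithConv.ext
  ext a
  simp [postComp, tangentLeft, ofPoint, tangent_map_one]

@[simp] theorem postComp_tangentRight_left (p : C →ₐ[K] R) {q : D →ₐ[K] R} (Y : tangent q)
    (f : A →ₐ[K] C) :
    postComp (tangentRight p Y).1 (ofPoint (toConv (Algebra.TensorProduct.includeLeft.comp f))) =
      0 := by
  apply WithConv.ext
  ext a
  simp [postComp, tangentRight, ofPoint, tangent_map_one]

@[simp] theorem postComp_tangentRight_right (p : C →ₐ[K] R) {q : D →ₐ[K] R} (Y : tangent q)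
    (f : A →ₐ[K] D) :
    postComp (tangentRight p Y).1 (ofPoint (toConv (Algebra.TensorProduct.includeRight.comp f))) =
      ofTangent (tangentMap f q Y) := by
  apply WithConv.ext
  ext a
  simp [postComp, tangentRight, ofPoint, ofTangent, tangentMap]

@[simp] theorem pair_comp_left_comp (p : C →ₐ[K] R) (q : D →ₐ[K] R) (f : A →ₐ[K] C) :
    (pair p q).comp (Algebra.TensorProduct.includeLeft.comp f) = p.comp f := by
  rw [← AlgHom.comp_assoc, pair_comp_left]

@[simp] theorem pair_comp_right_comp (p : C →ₐ[K] R) (q : D →ₐ[K] R) (f : A →ₐ[K] D) :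
    (pair p q).comp (Algebra.TensorProduct.includeRight.comp f) = q.comp f := by
  rw [← AlgHom.comp_assoc, pair_comp_right]
end

/-- Writing the components as words in the coordinate points prepares them for the Leibniz rule and
the rule for inverses. -/
theorem doubleCoact_comp_inl : (doubleCoact K A).comp inl =
    (toConv (Algebra.TensorProduct.includeLeft.comp inl) *
      toConv (Algebra.TensorProduct.includeRight.comp inl) *
      inv (toConv (Algebra.TensorProduct.includeLeft.comp inr)) : Points K A _).ofConv := by
  rw [doubleCoact, pair_comp_left]

theorem doubleCoact_comp_inr : (doubleCoact K A).comp inr =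
    (toConv (Algebra.TensorProduct.includeLeft.comp inr) *
      toConv (Algebra.TensorProduct.includeRight.comp inr) *
      inv (toConv (Algebra.TensorProduct.includeLeft.comp inl)) : Points K A _).ofConv := by
  rw [doubleCoact, pair_comp_right]

theorem doubleMap_comp_inl :
    (doubleMap K A).comp inl = (toConv inl * toConv inr : Points K A _).ofConv := by
  rw [doubleMap, pair_comp_left]

theorem doubleMap_comp_inr :
    (doubleMap K A).comp inr = (inv (toConv inl) * inv (toConv inr) : Points K A _).ofConv := by
  rw [doubleMap, pair_comp_right]

theorem comp_doubleMap_inl (m : A ⊗[K] A →ₐ[K] R) :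
    toConv ((m.comp (doubleMap K A)).comp inl) = toConv (m.comp inl) * toConv (m.comp inr) := by
  rw [AlgHom.comp_assoc, doubleMap_comp_inl, comp_mul]

theorem comp_doubleMap_inr (m : A ⊗[K] A →ₐ[K] R) :
    toConv ((m.comp (doubleMap K A)).comp inr) =
      inv (toConv (m.comp inl)) * inv (toConv (m.comp inr)) := by
  rw [AlgHom.comp_assoc, doubleMap_comp_inr, comp_mul]
  rfl

/-- This is d(q₁q₂) = dq₁ q₂ + q₁ dq₂: the push-forward of `v` is by definition the word q₁q₂
differentiated along `v`. -/
theorem ofTangent_tangentMap_doubleMap_inl (m : A ⊗[K] A →ₐ[K] R) (v : tangent m) :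
    ofTangent (tangentMap inl _ (tangentMap (doubleMap K A) m v)) =
      ofTangent (tangentMap inl m v) * ofPoint (toConv (m.comp inr)) +
        ofPoint (toConv (m.comp inl)) * ofTangent (tangentMap inr m v) := by
  have : ofTangent (tangentMap inl _ (tangentMap (doubleMap K A) m v)) =
    postComp v.1 (ofPoint (toConv ((doubleMap K A).comp inl))) := rfl
  rw [this, doubleMap_comp_inl, toConv_ofConv, ofPoint_mul, postComp_tangent_mul]
  rfl

theorem ofTangent_tangentMap_doubleMap_inr (m : A ⊗[K] A →ₐ[K] R) (v : tangent m) :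
    ofTangent (tangentMap inr _ (tangentMap (doubleMap K A) m v)) =
      -(ofPoint (inv (toConv (m.comp inl))) * ofTangent (tangentMap inl m v) *
        ofPoint (inv (toConv (m.comp inl))) * ofPoint (inv (toConv (m.comp inr)))) -
      ofPoint (inv (toConv (m.comp inl))) * (ofPoint (inv (toConv (m.comp inr))) *
        ofTangent (tangentMap inr m v) * ofPoint (inv (toConv (m.comp inr)))) := by
  have : ofTangent (tangentMap inr _ (tangentMap (doubleMap K A) m v)) =
    postComp v.1 (ofPoint (toConv ((doubleMap K A).comp inr))) := rfl
  rw [this, doubleMap_comp_inr, toConv_ofConv, ofPoint_mul, postComp_tangent_mul,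
    postComp_tangent_inv, postComp_tangent_inv, neg_mul, mul_neg, ← sub_eq_add_neg]
  rfl

end Product
-- The double: derivatives of the action and pull-backs of Maurer-Cartan forms.
section Double
variable {K : Type u} [Field K] {A : Type v} [CommRing A] [HopfAlgebra K A]
  {R : Type v} [CommRing R] [Algebra K R]

/-- The word x q₁ y⁻¹ is differentiated at x = y = 1 with q₁ fixed; the outer sign comes from
exp(-tX). -/
theorem ofTangent_tangentMap_fund_inl (X : LieAlg K (A ⊗[K] A) R) (m : A ⊗[K] A →ₐ[K] R) :
    ofTangent (tangentMap inl m ((doubleAction K A).fund X m)) =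
      -(ofTangent (lieFst K A R X) * ofPoint (toConv (m.comp inl)) -
        ofPoint (toConv (m.comp inl)) * ofTangent (lieSnd K A R X)) := by
  have : ofTangent (tangentMap inl m ((doubleAction K A).fund X m)) =
    -postComp (tangentLeft X m).1 (ofPoint (toConv ((doubleCoact K A).comp inl))) := rfl
  rw [this, doubleCoact_comp_inl]
  simp only [toConv_ofConv, ofPoint_mul, postComp_tangent_mul, postComp_tangentLeft_left,
    postComp_tangentLeft_right, postComp_algHom_mul, postComp_ofPoint, pair_comp_left_comp,
    pair_comp_right_comp, postComp_tangent_inv, comp_inv, one_comp_inl, one_comp_inr, inv_one,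
    ofPoint_one, mul_zero, add_zero, mul_one, one_mul, mul_neg, ← sub_eq_add_neg]
  rfl

theorem ofTangent_tangentMap_fund_inr (X : LieAlg K (A ⊗[K] A) R) (m : A ⊗[K] A →ₐ[K] R) :
    ofTangent (tangentMap inr m ((doubleAction K A).fund X m)) =
      -(ofTangent (lieSnd K A R X) * ofPoint (toConv (m.comp inr)) -
        ofPoint (toConv (m.comp inr)) * ofTangent (lieFst K A R X)) := by
  have : ofTangent (tangentMap inr m ((doubleAction K A).fund X m)) =
    -postComp (tangentLeft X m).1 (ofPoint (toConv ((doubleCoact K A).comp inr))) := rfl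
  rw [this, doubleCoact_comp_inr]
  simp only [toConv_ofConv, ofPoint_mul, postComp_tangent_mul, postComp_tangentLeft_left,
    postComp_tangentLeft_right, postComp_algHom_mul, postComp_ofPoint, pair_comp_left_comp,
    pair_comp_right_comp, postComp_tangent_inv, comp_inv, one_comp_inl, one_comp_inr, inv_one,
    ofPoint_one, mul_zero, add_zero, mul_one, one_mul, mul_neg, ← sub_eq_add_neg]
  rfl

theorem ofTangent_tangentMap_onTangent_inl (g : Points K (A ⊗[K] A) R) {m : A ⊗[K] A →ₐ[K] R}
    (v : tangent m) :
    ofTangent (tangentMap inl _ ((doubleAction K A).onTangent g v)) =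
      ofPoint (toConv (g.ofConv.comp inl)) * ofTangent (tangentMap inl m v) *
        ofPoint (inv (toConv (g.ofConv.comp inr))) := by
  have : ofTangent (tangentMap inl _ ((doubleAction K A).onTangent g v)) =
    postComp (tangentRight g.ofConv v).1 (ofPoint (toConv ((doubleCoact K A).comp inl))) := rfl
  rw [this, doubleCoact_comp_inl]
  simp [postComp_tangent_mul, postComp_tangent_inv, postComp_ofPoint, comp_inv]

theorem ofTangent_tangentMap_onTangent_inr (g : Points K (A ⊗[K] A) R) {m : A ⊗[K] A →ₐ[K] R}
    (v : tangent m) :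
    ofTangent (tangentMap inr _ ((doubleAction K A).onTangent g v)) =
      ofPoint (toConv (g.ofConv.comp inr)) * ofTangent (tangentMap inr m v) *
        ofPoint (inv (toConv (g.ofConv.comp inl))) := by
  have : ofTangent (tangentMap inr _ ((doubleAction K A).onTangent g v)) =
    postComp (tangentRight g.ofConv v).1 (ofPoint (toConv ((doubleCoact K A).comp inr))) := rfl
  rw [this, doubleCoact_comp_inr]
  simp [postComp_tangent_mul, postComp_tangent_inv, postComp_ofPoint, comp_inv]

theorem doubleAction_coact : (doubleAction K A).coact = doubleCoact K A := rfl

theorem ofTangent_omega₁ (m : A ⊗[K] A →ₐ[K] R) (v : tangent m) :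
    ofTangent (omega₁ m v) =
      ofPoint (inv (toConv (m.comp inl))) * ofTangent (tangentMap inl m v) := rfl

theorem ofTangent_omega₂ (m : A ⊗[K] A →ₐ[K] R) (v : tangent m) :
    ofTangent (omega₂ m v) =
      ofPoint (inv (toConv (m.comp inr))) * ofTangent (tangentMap inr m v) := rfl

theorem ofTangent_omegaBar₁ (m : A ⊗[K] A →ₐ[K] R) (v : tangent m) :
    ofTangent (omegaBar₁ m v) =
      ofTangent (tangentMap inl m v) * ofPoint (inv (toConv (m.comp inl))) := rfl

theorem ofTangent_omegaBar₂ (m : A ⊗[K] A →ₐ[K] R) (v : tangent m) :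
    ofTangent (omegaBar₂ m v) =
      ofTangent (tangentMap inr m v) * ofPoint (inv (toConv (m.comp inr))) := rfl

/-- From (x q₁ y⁻¹)⁻¹ (x v y⁻¹) = y (q₁⁻¹ v) y⁻¹ the left form sees only `y`. In the same way ω̄₂ is
transformed by Ad(y), and ω̄₁, ω₂ by Ad(x), so each product in σ^× has two factors of the same type.
-/
theorem omega₁_onTangent (g : Points K (A ⊗[K] A) R) {m : A ⊗[K] A →ₐ[K] R} (v : tangent m) :
    omega₁ _ ((doubleAction K A).onTangent g v) =
      Ad (toConv (g.ofConv.comp inr)) (omega₁ m v) := by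
  apply ofTangent_injective
  rw [ofTangent_omega₁, ofTangent_tangentMap_onTangent_inl, doubleAction_coact, act_doubleCoact_inl]
  simp only [ofTangent_omega₁, ofTangent_Ad, inv_mul_rev,
    inv_inv, ofPoint_mul, mul_assoc, ofPoint_inv_mul_cancel_left]

theorem omegaBar₁_onTangent (g : Points K (A ⊗[K] A) R) {m : A ⊗[K] A →ₐ[K] R} (v : tangent m) :
    omegaBar₁ _ ((doubleAction K A).onTangent g v) =
      Ad (toConv (g.ofConv.comp inl)) (omegaBar₁ m v) := by
  apply ofTangent_injective
  rw [ofTangent_omegaBar₁, ofTangent_tangentMap_onTangent_inl, doubleAction_coact, act_doubleCoact_inl]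
  simp only [ofTangent_omegaBar₁, ofTangent_Ad, inv_mul_rev,
    inv_inv, ofPoint_mul, mul_assoc, ofPoint_inv_mul_cancel_left]

theorem omega₂_onTangent (g : Points K (A ⊗[K] A) R) {m : A ⊗[K] A →ₐ[K] R} (v : tangent m) :
    omega₂ _ ((doubleAction K A).onTangent g v) =
      Ad (toConv (g.ofConv.comp inl)) (omega₂ m v) := by
  apply ofTangent_injective
  rw [ofTangent_omega₂, ofTangent_tangentMap_onTangent_inr, doubleAction_coact, act_doubleCoact_inr]
  simp only [ofTangent_omega₂, ofTangent_Ad, inv_mul_rev,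
    inv_inv, ofPoint_mul, mul_assoc, ofPoint_inv_mul_cancel_left]

theorem omegaBar₂_onTangent (g : Points K (A ⊗[K] A) R) {m : A ⊗[K] A →ₐ[K] R} (v : tangent m) :
    omegaBar₂ _ ((doubleAction K A).onTangent g v) =
      Ad (toConv (g.ofConv.comp inr)) (omegaBar₂ m v) := by
  apply ofTangent_injective
  rw [ofTangent_omegaBar₂, ofTangent_tangentMap_onTangent_inr, doubleAction_coact, act_doubleCoact_inr]
  simp only [ofTangent_omegaBar₂, ofTangent_Ad, inv_mul_rev,
    inv_inv, ofPoint_mul, mul_assoc, ofPoint_inv_mul_cancel_left]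

theorem omegaBar₁_eq (m : A ⊗[K] A →ₐ[K] R) (v : tangent m) :
    omegaBar₁ m v = Ad (toConv (m.comp inl)) (omega₁ m v) := by
  apply ofTangent_injective
  simp only [ofTangent_omega₁, ofTangent_omegaBar₁, ofTangent_Ad,
    ofPoint_mul_inv_cancel_left]

theorem omegaBar₂_eq (m : A ⊗[K] A →ₐ[K] R) (v : tangent m) :
    omegaBar₂ m v = Ad (toConv (m.comp inr)) (omega₂ m v) := by
  apply ofTangent_injective
  simp only [ofTangent_omega₂, ofTangent_omegaBar₂, ofTangent_Ad,
    ofPoint_mul_inv_cancel_left]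

theorem omega₁_fund (X : LieAlg K (A ⊗[K] A) R) (m : A ⊗[K] A →ₐ[K] R) :
    omega₁ m ((doubleAction K A).fund X m) =
      lieSnd K A R X - Ad (inv (toConv (m.comp inl))) (lieFst K A R X) := by
  apply ofTangent_injective
  simp only [ofTangent_omega₁, ofTangent_tangentMap_fund_inl,
    ofTangent_sub, ofTangent_Ad, inv_inv, neg_sub, mul_sub, mul_assoc, ofPoint_inv_mul_cancel_left]

theorem omega₂_fund (X : LieAlg K (A ⊗[K] A) R) (m : A ⊗[K] A →ₐ[K] R) :
    omega₂ m ((doubleAction K A).fund X m) =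
      lieFst K A R X - Ad (inv (toConv (m.comp inr))) (lieSnd K A R X) := by
  apply ofTangent_injective
  simp only [ofTangent_omega₂, ofTangent_tangentMap_fund_inr,
    ofTangent_sub, ofTangent_Ad, inv_inv, neg_sub, mul_sub, mul_assoc, ofPoint_inv_mul_cancel_left]

/-- Here (q₁q₂)⁻¹(dq₁ q₂ + q₁ dq₂) = q₂⁻¹(q₁⁻¹dq₁ + dq₂ q₂⁻¹)q₂. The right form of q₁q₂ is the
conjugate of the same sum by q₁. -/
theorem lieFst_maurerCartanL_doubleMap (m : A ⊗[K] A →ₐ[K] R) (v : tangent m) :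
    lieFst K A R (maurerCartanL (toConv (m.comp (doubleMap K A))) (tangentMap (doubleMap K A) m v)) =
      Ad (inv (toConv (m.comp inr))) (omega₁ m v + omegaBar₂ m v) := by
  rw [lieFst_maurerCartanL]
  apply ofTangent_injective
  erw [ofTangent_maurerCartanL]
  erw [ofTangent_tangentMap_doubleMap_inl, comp_doubleMap_inl]
  simp only [ofTangent_omega₁, ofTangent_omegaBar₂, ofTangent_Ad,
    ofTangent_add, inv_mul_rev, inv_inv, ofPoint_mul, mul_add, add_mul,
    mul_assoc, ofPoint_inv_mul_cancel_left, ofPoint_inv_mul, mul_one]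

theorem lieFst_maurerCartanR_doubleMap (m : A ⊗[K] A →ₐ[K] R) (v : tangent m) :
    lieFst K A R (maurerCartanR (toConv (m.comp (doubleMap K A))) (tangentMap (doubleMap K A) m v)) =
      Ad (toConv (m.comp inl)) (omega₁ m v + omegaBar₂ m v) := by
  rw [lieFst_maurerCartanR]
  apply ofTangent_injective
  rw [ofTangent_maurerCartanR]
  erw [ofTangent_tangentMap_doubleMap_inl, comp_doubleMap_inl]
  simp only [ofTangent_omega₁, ofTangent_omegaBar₂, ofTangent_Ad,
    ofTangent_add, inv_mul_rev, ofPoint_mul, mul_add, add_mul,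
    mul_assoc, ofPoint_mul_inv_cancel_left]

/-- Inversion exchanges left and right forms and changes the sign, so ω̄₁ + ω₂ takes the place of ω₁
+ ω̄₂. -/
theorem lieSnd_maurerCartanL_doubleMap (m : A ⊗[K] A →ₐ[K] R) (v : tangent m) :
    lieSnd K A R (maurerCartanL (toConv (m.comp (doubleMap K A))) (tangentMap (doubleMap K A) m v)) =
      -Ad (toConv (m.comp inr)) (omegaBar₁ m v + omega₂ m v) := by
  rw [lieSnd_maurerCartanL]
  apply ofTangent_injective
  erw [ofTangent_maurerCartanL]
  erw [ofTangent_tangentMap_doubleMap_inr, comp_doubleMap_inr]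
  simp only [ofTangent_omega₂, ofTangent_omegaBar₁, ofTangent_Ad,
    ofTangent_add, ofTangent_neg, inv_mul_rev, inv_inv, ofPoint_mul,
    mul_add, add_mul, mul_sub, mul_neg, mul_assoc, ofPoint_mul_inv_cancel_left]
  abel

theorem lieSnd_maurerCartanR_doubleMap (m : A ⊗[K] A →ₐ[K] R) (v : tangent m) :
    lieSnd K A R (maurerCartanR (toConv (m.comp (doubleMap K A))) (tangentMap (doubleMap K A) m v)) =
      -Ad (inv (toConv (m.comp inl))) (omegaBar₁ m v + omega₂ m v) := by
  rw [lieSnd_maurerCartanR]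
  apply ofTangent_injective
  rw [ofTangent_maurerCartanR]
  erw [ofTangent_tangentMap_doubleMap_inr, comp_doubleMap_inr]
  simp only [ofTangent_omega₂, ofTangent_omegaBar₁, ofTangent_Ad,
    ofTangent_add, ofTangent_neg, inv_mul_rev, inv_inv, ofPoint_mul,
    mul_add, add_mul, sub_mul, neg_mul, mul_assoc, ofPoint_inv_mul_cancel_left]
  abel

end Double

/-! ### The structure equations in the convolution algebra. -/

section MaurerCartan
variable {K : Type u} [Field K] {A : Type*} [CommRing A] [HopfAlgebra K A]
  {C : Type*} [CommRing C] [Algebra K C]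

theorem postComp_derivation_mul (X : Derivation K C C) (f g : WithConv (A →ₗ[K] C)) :
    postComp (ofDerivation X).1 (f * g) =
      postComp (ofDerivation X).1 f * g + f * postComp (ofDerivation X).1 g :=
  postComp_tangent_mul (ofDerivation X) f g

theorem postComp_derivation_inv (X : Derivation K C C) (q : Points K A C) :
    postComp (ofDerivation X).1 (ofPoint (inv q)) =
      -(ofPoint (inv q) * postComp (ofDerivation X).1 (ofPoint q) * ofPoint (inv q)) :=
  postComp_tangent_inv (ofDerivation X) q

theorem postComp_derivation_lie (X Y : Derivation K C C) (f : WithConv (A →ₗ[K] C)) :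
    postComp (ofDerivation X).1 (postComp (ofDerivation Y).1 f) =
      postComp (ofDerivation Y).1 (postComp (ofDerivation X).1 f) +
        postComp (ofDerivation ⁅X, Y⁆).1 f := by
  apply WithConv.ext
  ext a
  simp [postComp, ofDerivation, LieRing.of_associative_ring_bracket]

/-- The Leibniz rule gives X(q⁻¹ Yq) = -q⁻¹Xq q⁻¹Yq + q⁻¹XYq. Exchanging X and Y produces the
commutator and turns XY - YX into [X, Y]. -/
theorem maurerCartan_left (q : Points K A C) (X Y : Derivation K C C) :
    postComp (ofDerivation X).1 (ofPoint (inv q) * postComp (ofDerivation Y).1 (ofPoint q)) =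
      postComp (ofDerivation Y).1 (ofPoint (inv q) * postComp (ofDerivation X).1 (ofPoint q)) +
      ofPoint (inv q) * postComp (ofDerivation ⁅X, Y⁆).1 (ofPoint q) -
      (ofPoint (inv q) * postComp (ofDerivation X).1 (ofPoint q) *
        (ofPoint (inv q) * postComp (ofDerivation Y).1 (ofPoint q)) -
      ofPoint (inv q) * postComp (ofDerivation Y).1 (ofPoint q) *
        (ofPoint (inv q) * postComp (ofDerivation X).1 (ofPoint q))) := by
  rw [postComp_derivation_mul, postComp_derivation_mul, postComp_derivation_inv,
    postComp_derivation_inv, postComp_derivation_lie X Y]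
  noncomm_ring

/-- With q⁻¹ on the right its derivative contributes -Yq q⁻¹ Xq q⁻¹, in the opposite order; this is
the source of the opposite sign of the commutator. -/
theorem maurerCartan_right (q : Points K A C) (X Y : Derivation K C C) :
    postComp (ofDerivation X).1 (postComp (ofDerivation Y).1 (ofPoint q) * ofPoint (inv q)) =
      postComp (ofDerivation Y).1 (postComp (ofDerivation X).1 (ofPoint q) * ofPoint (inv q)) +
      postComp (ofDerivation ⁅X, Y⁆).1 (ofPoint q) * ofPoint (inv q) +
      (postComp (ofDerivation X).1 (ofPoint q) * ofPoint (inv q) *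
        (postComp (ofDerivation Y).1 (ofPoint q) * ofPoint (inv q)) -
      postComp (ofDerivation Y).1 (ofPoint q) * ofPoint (inv q) *
        (postComp (ofDerivation X).1 (ofPoint q) * ofPoint (inv q))) := by
  rw [postComp_derivation_mul, postComp_derivation_mul, postComp_derivation_inv,
    postComp_derivation_inv, postComp_derivation_lie X Y]
  noncomm_ring

theorem derivation_algebraMap_mul (X : Derivation K C C) (c : K) (x y z w : C) :
    X (algebraMap K C c * (x - y + (z - w))) = algebraMap K C c * (X x - X y + (X z - X w)) := by
  rw [Derivation.leibniz, Derivation.map_algebraMap, smul_zero, add_zero, smul_eq_mul, map_add,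
    map_sub, map_sub]

end MaurerCartan

/-! ### The three assertions in the algebraic setting. -/

section Double
variable {K : Type u} [Field K] {A : Type v} [CommRing A] [HopfAlgebra K A]

/-- A projection G × G → G is itself a point of G with values in the coordinate ring of G × G; the
structure equation is applied to this point. -/
theorem lieDeriv_omega₁ (X Y : Derivation K (A ⊗[K] A) (A ⊗[K] A)) :
    lieDeriv X (omega₁ _ (ofDerivation Y)) = lieDeriv Y (omega₁ _ (ofDerivation X)) +
      omega₁ _ (ofDerivation ⁅X, Y⁆) +
        -bracket (omega₁ _ (ofDerivation X)) (omega₁ _ (ofDerivation Y)) :=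
  ofTangent_injective ((maurerCartan_left (toConv inl) X Y).trans (sub_eq_add_neg _ _))

theorem lieDeriv_omega₂ (X Y : Derivation K (A ⊗[K] A) (A ⊗[K] A)) :
    lieDeriv X (omega₂ _ (ofDerivation Y)) = lieDeriv Y (omega₂ _ (ofDerivation X)) +
      omega₂ _ (ofDerivation ⁅X, Y⁆) +
        -bracket (omega₂ _ (ofDerivation X)) (omega₂ _ (ofDerivation Y)) :=
  ofTangent_injective ((maurerCartan_left (toConv inr) X Y).trans (sub_eq_add_neg _ _))

theorem lieDeriv_omegaBar₁ (X Y : Derivation K (A ⊗[K] A) (A ⊗[K] A)) :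
    lieDeriv X (omegaBar₁ _ (ofDerivation Y)) = lieDeriv Y (omegaBar₁ _ (ofDerivation X)) +
      omegaBar₁ _ (ofDerivation ⁅X, Y⁆) +
        bracket (omegaBar₁ _ (ofDerivation X)) (omegaBar₁ _ (ofDerivation Y)) :=
  ofTangent_injective (maurerCartan_right (toConv inl) X Y)

theorem lieDeriv_omegaBar₂ (X Y : Derivation K (A ⊗[K] A) (A ⊗[K] A)) :
    lieDeriv X (omegaBar₂ _ (ofDerivation Y)) = lieDeriv Y (omegaBar₂ _ (ofDerivation X)) +
      omegaBar₂ _ (ofDerivation ⁅X, Y⁆) +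
        bracket (omegaBar₂ _ (ofDerivation X)) (omegaBar₂ _ (ofDerivation Y)) :=
  ofTangent_injective (maurerCartan_right (toConv inr) X Y)

variable [Algebra.FiniteType K A] {B : LinearMap.BilinForm K (LieAlg K A K)}

theorem doubleForm_apply {R : Type v} [CommRing R] [Algebra K R] (m : A ⊗[K] A →ₐ[K] R)
    (v : Fin 2 → tangent m) :
    doubleForm B R m v = algebraMap K R (-(1 / 2)) *
      (extForm R B (omega₁ m (v 0)) (omegaBar₂ m (v 1)) -
        extForm R B (omega₁ m (v 1)) (omegaBar₂ m (v 0)) +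
      (extForm R B (omegaBar₁ m (v 0)) (omega₂ m (v 1)) -
        extForm R B (omegaBar₁ m (v 1)) (omega₂ m (v 0)))) := by
  simp only [doubleForm, AlternatingMap.smul_apply, AlternatingMap.add_apply, smul_eq_mul]
  rfl

theorem doubleForm_isRegular : (doubleForm B).IsRegular := by
  intro R S _ _ _ _ h m v
  have h₁ (w : tangent m) :
      omega₁ (h.comp m) (tangentBaseChange h w) = lieBaseChange h (omega₁ m w) := by
    apply ofTangent_injective
    rw [ofTangent_omega₁, ofTangent_lieBaseChange, ofTangent_omega₁, postComp_algHom_mul]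
    rfl
  have h₂ (w : tangent m) :
      omega₂ (h.comp m) (tangentBaseChange h w) = lieBaseChange h (omega₂ m w) := by
    apply ofTangent_injective
    rw [ofTangent_omega₂, ofTangent_lieBaseChange, ofTangent_omega₂, postComp_algHom_mul]
    rfl
  have h₁' (w : tangent m) :
      omegaBar₁ (h.comp m) (tangentBaseChange h w) = lieBaseChange h (omegaBar₁ m w) := by
    apply ofTangent_injective
    rw [ofTangent_omegaBar₁, ofTangent_lieBaseChange, ofTangent_omegaBar₁, postComp_algHom_mul]
    rfl
  have h₂' (w : tangent m) :
      omegaBar₂ (h.comp m) (tangentBaseChange h w) = lieBaseChange h (omegaBar₂ m w) := by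
    apply ofTangent_injective
    rw [ofTangent_omegaBar₂, ofTangent_lieBaseChange, ofTangent_omegaBar₂, postComp_algHom_mul]
    rfl
  simp only [doubleForm_apply, h₁, h₂, h₁', h₂', extForm_lieBaseChange, map_mul, map_add, map_sub,
    AlgHom.commutes]

theorem doubleForm_isInvariant (hB : IsAdInvariant B) :
    IsInvariant (doubleAction K A) (doubleForm B) := by
  intro R _ _ g m v
  simp only [doubleForm_apply]
  rw [omega₁_onTangent, omega₁_onTangent, omega₂_onTangent, omega₂_onTangent, omegaBar₁_onTangent,
    omegaBar₁_onTangent, omegaBar₂_onTangent, omegaBar₂_onTangent, hB, hB, hB, hB]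

theorem doubleMap_isEquivariant : IsEquivariant (doubleAction K A) (doubleMap K A) := by
  intro R _ _ g m
  apply toConv_injective.eq_iff.1 ∘ congrArg toConv
  apply WithConv.ofConv_injective
  apply point_ext
  · rw [mul_comp_inl, mul_comp_inl, inv_comp_inl]
    erw [comp_doubleMap_inl, comp_doubleMap_inl]
    rw [doubleAction_coact, act_doubleCoact_inl, act_doubleCoact_inr]
    simp only [mul_assoc]
    rw [← mul_assoc (inv _), inv_mul, one_mul]
  · rw [mul_comp_inr, mul_comp_inr, inv_comp_inr]
    erw [comp_doubleMap_inr, comp_doubleMap_inr]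
    rw [doubleAction_coact, act_doubleCoact_inl, act_doubleCoact_inr]
    simp only [mul_assoc, inv_mul_rev, inv_inv]
    rw [← mul_assoc (inv (toConv (g.ofConv.comp inl))), inv_mul, one_mul]

theorem extForm_Ad_left (hB : IsAdInvariant B) {R : Type v} [CommRing R] [Algebra K R]
    (g : Points K A R) (ξ η : LieAlg K A R) :
    extForm R B (Ad g ξ) η = extForm R B ξ (Ad (inv g) η) := by
  rw [← hB R g ξ, Ad_Ad_inv]

theorem extForm_sub_left {R : Type v} [CommRing R] [Algebra K R] (ξ ξ' η : LieAlg K A R) :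
    extForm R B (ξ - ξ') η = extForm R B ξ η - extForm R B ξ' η :=
  LinearMap.map_sub₂ (extForm R B) ξ ξ' η

theorem isMomentumMap_double (hs : B.IsSymm) (hB : IsAdInvariant B) :
    IsMomentumMap (doubleAction K A) (sumForm B) (doubleForm B) (doubleMap K A) where
  form_regular := doubleForm_isRegular
  form_invariant := doubleForm_isInvariant hB
  map_equivariant := doubleMap_isEquivariant
  momentum R _ _ X m v := by
    rw [extForm_sumForm, map_add (lieFst K A R), map_add (lieSnd K A R),
      lieFst_maurerCartanL_doubleMap, lieFst_maurerCartanR_doubleMap,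
      lieSnd_maurerCartanL_doubleMap, lieSnd_maurerCartanR_doubleMap, doubleForm_apply]
    -- Normal form: the components of `X` on the left, ω₁(v) and ω₂(v) on the right, every Ad moved
    -- to the right argument. Both sides then have the same terms.
    simp only [Matrix.cons_val_zero, Matrix.cons_val_one, omega₁_fund, omega₂_fund,
      Ad_add, extForm_sub_left, map_add, extForm_neg_right,
      extForm_Ad_left hB, inv_inv, omegaBar₁_eq, omegaBar₂_eq, Ad_inv_Ad, Ad_Ad_inv,
      extForm_symm hs (omega₁ m v), map_neg (algebraMap K R)]
    ring

/-- The tangent vector of `G` at `p` with `ω(v) = ξ`. -/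
def leftTranslate {R : Type v} [CommRing R] [Algebra K R] (p : A →ₐ[K] R)
    (ξ : LieAlg K A R) : tangent p :=
  ⟨conv p.toLinearMap ξ.1, by
    have h := conv_mem_left (toConv p) 1 ξ.1 ξ.2
    rwa [mul_one] at h⟩

/-- The tangent vector of `G × G` at `m` with `ω₁(v) = ξ` and `ω₂(v) = 0`. -/
def leftVector {R : Type v} [CommRing R] [Algebra K R] (m : A ⊗[K] A →ₐ[K] R)
    (ξ : LieAlg K A R) : tangent m :=
  ⟨(tangentLeft (leftTranslate (m.comp inl) ξ) (m.comp inr)).1, by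
    have h := (tangentLeft (leftTranslate (m.comp inl) ξ) (m.comp inr)).2
    have e : pair (m.comp inl) (m.comp inr) = m :=
      point_ext (congrArg toConv (pair_comp_left _ _)) (congrArg toConv (pair_comp_right _ _))
    simp only [e] at h
    exact h⟩

theorem omega₁_leftVector {R : Type v} [CommRing R] [Algebra K R] (m : A ⊗[K] A →ₐ[K] R)
    (ξ : LieAlg K A R) : omega₁ m (leftVector m ξ) = ξ := by
  apply ofTangent_injective
  have h : ofTangent (tangentMap inl m (leftVector m ξ)) =
      ofPoint (toConv (m.comp inl)) * ofTangent ξ := by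
    exact postComp_tangentLeft_left (leftTranslate (m.comp inl) ξ) (m.comp inr) (AlgHom.id K A)
  rw [ofTangent_omega₁, h, ofPoint_inv_mul_cancel_left]

theorem omega₂_leftVector {R : Type v} [CommRing R] [Algebra K R] (m : A ⊗[K] A →ₐ[K] R)
    (ξ : LieAlg K A R) : omega₂ m (leftVector m ξ) = 0 := by
  apply ofTangent_injective
  have h : ofTangent (tangentMap inr m (leftVector m ξ)) = 0 := by
    exact postComp_tangentLeft_right (leftTranslate (m.comp inl) ξ) (m.comp inr) (AlgHom.id K A)
  rw [ofTangent_omega₂, h, mul_zero, ofTangent_zero]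

/-- The forms ω₁ and ω₂ trivialise the tangent space: they determine a derivation on a ⊗ 1 and 1 ⊗
b, hence on their product a ⊗ b. -/
theorem eq_zero_of_omega_eq_zero {R : Type v} [CommRing R] [Algebra K R] {m : A ⊗[K] A →ₐ[K] R}
    {u : tangent m} (h₁ : omega₁ m u = 0) (h₂ : omega₂ m u = 0) : u = 0 := by
  have e₁ : ofTangent (tangentMap inl m u) = 0 := by
    rw [← ofPoint_mul_inv_cancel_left (toConv (m.comp inl)) (ofTangent (tangentMap inl m u)),
      ← ofTangent_omega₁, h₁, ofTangent_zero, mul_zero]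
  have e₂ : ofTangent (tangentMap inr m u) = 0 := by
    rw [← ofPoint_mul_inv_cancel_left (toConv (m.comp inr)) (ofTangent (tangentMap inr m u)),
      ← ofTangent_omega₂, h₂, ofTangent_zero, mul_zero]
  apply Subtype.ext
  apply TensorProduct.ext'
  intro a b
  have f₁ : u.1 (a ⊗ₜ 1) = 0 := congrArg (fun f => f.ofConv a) e₁
  have f₂ : u.1 (1 ⊗ₜ b) = 0 := congrArg (fun f => f.ofConv b) e₂
  have := u.2 (a ⊗ₜ 1) (1 ⊗ₜ b)
  rw [Algebra.TensorProduct.tmul_mul_tmul, mul_one, one_mul, f₁, f₂] at this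
  simp [this]

theorem isNondegenerateRel_double [CharZero K] (hs : B.IsSymm) (hB : IsAdInvariant B)
    (hn : B.Nondegenerate) :
    IsNondegenerateRel (doubleForm B) (doubleMap K A) := by
  intro R _ _ m u hσ hΦ
  -- Both components of dΦ(u) vanish, and they are conjugates of ω₁ + ω̄₂ and -(ω̄₁ + ω₂); Ad is
  -- invertible.
  have h₁ : omega₁ m u + omegaBar₂ m u = 0 := by
    have h := lieFst_maurerCartanR_doubleMap m u
    rw [hΦ, map_zero, map_zero] at h
    rw [← Ad_inv_Ad (toConv (m.comp inl)) (omega₁ m u + omegaBar₂ m u), ← h]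
    exact map_zero (adLinear _)
  have h₂ : omegaBar₁ m u + omega₂ m u = 0 := by
    have h := lieSnd_maurerCartanL_doubleMap m u
    rw [hΦ, map_zero, map_zero] at h
    have h' : Ad (toConv (m.comp inr)) (omegaBar₁ m u + omega₂ m u) = 0 :=
      ofTangent_injective (neg_eq_zero.1 (congrArg ofTangent h).symm)
    rw [← Ad_inv_Ad (toConv (m.comp inr)) (omegaBar₁ m u + omega₂ m u), h']
    exact map_zero (adLinear _)
  have e₁ : omegaBar₂ m u = -omega₁ m u :=
    ofTangent_injective (eq_neg_of_add_eq_zero_right (congrArg ofTangent h₁))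
  have e₂ : omega₂ m u = -omegaBar₁ m u :=
    ofTangent_injective (eq_neg_of_add_eq_zero_right (congrArg ofTangent h₂))
  have hz : ∀ g : Points K A R, Ad g (0 : LieAlg K A R) = 0 := fun g => map_zero (adLinear g)
  have hω : omega₁ m u = 0 := by
    refine extForm_zero_right_of_ofLie _ (fun Y => ?_) hn
    -- The test vector has ω₁ = Y and ω₂ = 0, hence ω̄₂ = 0, which kills two of the four terms of
    -- σ^×.
    have h := hσ (leftVector m (ofLie Y))
    rw [doubleForm_apply] at h
    simp only [Matrix.cons_val_zero, Matrix.cons_val_one, omega₁_leftVector, omega₂_leftVector,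
      omegaBar₁_eq m (leftVector _ _), omegaBar₂_eq m (leftVector _ _), hz, map_zero, e₁, e₂,
      extForm_neg_right] at h
    -- The remaining two terms differ by Ad(q₁) in both arguments, so they agree and add up; the
    -- factor 2 cancels the 1/2 of σ^×.
    rw [omegaBar₁_eq, hB, extForm_symm hs] at h
    have h2 : algebraMap K R (-(1 / 2)) * 2 = -1 := by
      rw [← map_ofNat (algebraMap K R) 2, ← map_mul]
      norm_num
    linear_combination -h + (extForm R B (omega₁ m u) (ofLie Y)) * h2
  refine eq_zero_of_omega_eq_zero hω ?_
  rw [e₂, omegaBar₁_eq, hω, hz]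
  exact ofTangent_injective neg_zero

theorem lieFst_Ad {R : Type v} [CommRing R] [Algebra K R] (g : Points K (A ⊗[K] A) R)
    (ξ : LieAlg K (A ⊗[K] A) R) :
    lieFst K A R (Ad g ξ) = Ad (toConv (g.ofConv.comp inl)) (lieFst K A R ξ) := by
  apply ofTangent_injective
  rw [ofTangent_Ad, ← inv_comp_inl]
  refine (convMul_comp_inl (ofPoint g * ofTangent ξ) (ofPoint (inv g))).trans ?_
  exact congrArg (· * ofPoint (toConv ((inv g).ofConv.comp inl)))
    (convMul_comp_inl (ofPoint g) (ofTangent ξ))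

theorem lieSnd_Ad {R : Type v} [CommRing R] [Algebra K R] (g : Points K (A ⊗[K] A) R)
    (ξ : LieAlg K (A ⊗[K] A) R) :
    lieSnd K A R (Ad g ξ) = Ad (toConv (g.ofConv.comp inr)) (lieSnd K A R ξ) := by
  apply ofTangent_injective
  rw [ofTangent_Ad, ← inv_comp_inr]
  refine (convMul_comp_inr (ofPoint g * ofTangent ξ) (ofPoint (inv g))).trans ?_
  exact congrArg (· * ofPoint (toConv ((inv g).ofConv.comp inr)))
    (convMul_comp_inr (ofPoint g) (ofTangent ξ))

theorem sumForm_isSymm (hs : B.IsSymm) : (sumForm B).IsSymm :=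
  ⟨fun _ _ => congrArg₂ (· + ·) (hs.eq _ _) (hs.eq _ _)⟩

theorem sumForm_isAdInvariant (hB : IsAdInvariant B) : IsAdInvariant (sumForm B) := by
  intro R _ _ g ξ η
  rw [extForm_sumForm, extForm_sumForm, lieFst_Ad, lieFst_Ad, lieSnd_Ad, lieSnd_Ad, hB, hB]

/-- The six summands are equal, and 6/12 = 1/2. -/
theorem cartanForm_eq [CharZero K] {R : Type v} [CommRing R] [Algebra K R] (hs : B.IsSymm)
    (hB : IsAdInvariant B) (q : Points K A R) (v : Fin 3 → tangent q.ofConv) :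
    cartanForm B q v = algebraMap K R (1 / 2) * extForm R B
      (bracket (maurerCartanL q (v 0)) (maurerCartanL q (v 1))) (maurerCartanL q (v 2)) := by
  have h12 : algebraMap K R (1 / 12) * 6 = algebraMap K R (1 / 2) := by
    rw [← map_ofNat (algebraMap K R) 6, ← map_mul]
    norm_num
  have h := sum_perm_bracket (E := extForm R B) (br := bracketBilin) (extForm_symm hs) bracket_swap
    (extForm_bracket_left hB) fun i => maurerCartanL q (v i)
  simp only [bracketBilin_apply] at h
  rw [cartanForm, h, ← h12, mul_assoc]

theorem extForm_bracket_Ad (hB : IsAdInvariant B) {R : Type v} [CommRing R] [Algebra K R]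
    (g : Points K A R) (x y z : LieAlg K A R) :
    extForm R B (bracket (Ad g x) (Ad g y)) (Ad g z) = extForm R B (bracket x y) z := by
  rw [← Ad_bracket, hB]

/-- The expression is cubic, hence odd. This gives the second factor of Φ its minus sign in Φ^*λ. -/
theorem extForm_bracket_neg {R : Type v} [CommRing R] [Algebra K R] (x y z : LieAlg K A R) :
    extForm R B (bracket (-x) (-y)) (-z) = -extForm R B (bracket x y) z := by
  have h : bracket (-x) (-y) = bracket x y := ofTangent_injective (by simp)
  rw [h, extForm_neg_right]

theorem cartanForm_doubleMap [CharZero K] {R : Type v} [CommRing R] [Algebra K R] (hs : B.IsSymm)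
    (hB : IsAdInvariant B) (m : A ⊗[K] A →ₐ[K] R) (v : Fin 3 → tangent m) :
    cartanForm (sumForm B) (toConv (m.comp (doubleMap K A)))
        (fun i => tangentMap (doubleMap K A) m (v i)) = algebraMap K R (1 / 2) *
      (extForm R B (bracket (omega₁ m (v 0) + omegaBar₂ m (v 0))
          (omega₁ m (v 1) + omegaBar₂ m (v 1))) (omega₁ m (v 2) + omegaBar₂ m (v 2)) -
        extForm R B (bracket (omegaBar₁ m (v 0) + omega₂ m (v 0))
          (omegaBar₁ m (v 1) + omega₂ m (v 1))) (omegaBar₁ m (v 2) + omega₂ m (v 2))) := by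
  rw [cartanForm_eq (sumForm_isSymm hs) (sumForm_isAdInvariant hB), extForm_sumForm,
    lieFst_bracket, lieSnd_bracket, lieFst_maurerCartanL_doubleMap, lieFst_maurerCartanL_doubleMap,
    lieFst_maurerCartanL_doubleMap, lieSnd_maurerCartanL_doubleMap, lieSnd_maurerCartanL_doubleMap,
    lieSnd_maurerCartanL_doubleMap, extForm_bracket_neg, extForm_bracket_Ad hB,
    extForm_bracket_Ad hB, ← sub_eq_add_neg]

/-- Pure algebra: `wedge_extDeriv` for ω₁ • ω̄₂ and for ω̄₁ • ω₂, then `cartan_identity`. Arbitrary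
families stand for the values of the forms (`a`), their derivatives (`Da`) and their values on
brackets of fields (`ka`). -/
theorem extForm_wedge_extDeriv {R : Type v} [CommRing R] [Algebra K R] (hs : B.IsSymm)
    (hB : IsAdInvariant B) {a a' b b' : Fin 3 → LieAlg K A R}
    {Da Da' Db Db' ka ka' kb kb' : Fin 3 → Fin 3 → LieAlg K A R}
    (ha : ∀ i j, Da i j = Da j i + ka i j + -bracket (a i) (a j))
    (ha' : ∀ i j, Da' i j = Da' j i + ka' i j + bracket (a' i) (a' j))
    (hb : ∀ i j, Db i j = Db j i + kb i j + -bracket (b i) (b j))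
    (hb' : ∀ i j, Db' i j = Db' j i + kb' i j + bracket (b' i) (b' j))
    (haa : extForm R B (bracket (a 0) (a 1)) (a 2) = extForm R B (bracket (a' 0) (a' 1)) (a' 2))
    (hbb : extForm R B (bracket (b 0) (b 1)) (b 2) = extForm R B (bracket (b' 0) (b' 1)) (b' 2))
    {E : LieAlg K A R → LieAlg K A R → R} (hE : E = fun x y => extForm R B x y) :
    (E (Da 0 1) (b' 2) + E (a 1) (Db' 0 2) - (E (Da 0 2) (b' 1) + E (a 2) (Db' 0 1))) -
    (E (Da 1 0) (b' 2) + E (a 0) (Db' 1 2) - (E (Da 1 2) (b' 0) + E (a 2) (Db' 1 0))) +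
    (E (Da 2 0) (b' 1) + E (a 0) (Db' 2 1) - (E (Da 2 1) (b' 0) + E (a 1) (Db' 2 0))) -
    (E (ka 0 1) (b' 2) - E (a 2) (kb' 0 1)) + (E (ka 0 2) (b' 1) - E (a 1) (kb' 0 2)) -
    (E (ka 1 2) (b' 0) - E (a 0) (kb' 1 2)) +
    ((E (Da' 0 1) (b 2) + E (a' 1) (Db 0 2) - (E (Da' 0 2) (b 1) + E (a' 2) (Db 0 1))) -
    (E (Da' 1 0) (b 2) + E (a' 0) (Db 1 2) - (E (Da' 1 2) (b 0) + E (a' 2) (Db 1 0))) +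
    (E (Da' 2 0) (b 1) + E (a' 0) (Db 2 1) - (E (Da' 2 1) (b 0) + E (a' 1) (Db 2 0))) -
    (E (ka' 0 1) (b 2) - E (a' 2) (kb 0 1)) + (E (ka' 0 2) (b 1) - E (a' 1) (kb 0 2)) -
    (E (ka' 1 2) (b 0) - E (a' 0) (kb 1 2))) =
    -(E (bracket (a 0 + b' 0) (a 1 + b' 1)) (a 2 + b' 2) -
      E (bracket (a' 0 + b 0) (a' 1 + b 1)) (a' 2 + b 2)) := by
  subst hE
  have t₁ := wedge_extDeriv (L := LieAlg K A R) (E := extForm R B) (α := a) (β := b') ha hb'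
  have t₂ := wedge_extDeriv (L := LieAlg K A R) (E := extForm R B) (α := a') (β := b) ha' hb
  have t₃ := cartan_identity (L := LieAlg K A R) (E := extForm R B) (br := bracketBilin)
    (a := a) (a' := a') (b := b) (b' := b')
    (extForm_symm hs) bracket_swap (extForm_bracket_left hB) haa hbb
  simp only [bracketBilin_apply] at t₃
  exact (congrArg₂ (· + ·) t₁ t₂).trans t₃

/-- The invariant formula for dσ^×, with each X(α • β) expanded by the Leibniz rule
`derivation_extForm`. The values are named as in `extForm_wedge_extDeriv`, to which the result is
handed over. -/
theorem doubleForm_extDeriv (V : Fin 3 → Derivation K (A ⊗[K] A) (A ⊗[K] A))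
    {a a' b b' : Fin 3 → LieAlg K A (A ⊗[K] A)}
    {Da Da' Db Db' ka ka' kb kb' : Fin 3 → Fin 3 → LieAlg K A (A ⊗[K] A)}
    (ha : ∀ i, omega₁ _ (ofDerivation (V i)) = a i)
    (ha' : ∀ i, omegaBar₁ _ (ofDerivation (V i)) = a' i)
    (hb : ∀ i, omega₂ _ (ofDerivation (V i)) = b i)
    (hb' : ∀ i, omegaBar₂ _ (ofDerivation (V i)) = b' i)
    (hDa : ∀ i j, lieDeriv (V i) (a j) = Da i j) (hDa' : ∀ i j, lieDeriv (V i) (a' j) = Da' i j)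
    (hDb : ∀ i j, lieDeriv (V i) (b j) = Db i j) (hDb' : ∀ i j, lieDeriv (V i) (b' j) = Db' i j)
    (hka : ∀ i j, omega₁ _ (ofDerivation ⁅V i, V j⁆) = ka i j)
    (hka' : ∀ i j, omegaBar₁ _ (ofDerivation ⁅V i, V j⁆) = ka' i j)
    (hkb : ∀ i j, omega₂ _ (ofDerivation ⁅V i, V j⁆) = kb i j)
    (hkb' : ∀ i j, omegaBar₂ _ (ofDerivation ⁅V i, V j⁆) = kb' i j)
    {E : LieAlg K A (A ⊗[K] A) → LieAlg K A (A ⊗[K] A) → A ⊗[K] A}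
    (hE : ∀ x y, extForm _ B x y = E x y) :
    (doubleForm B).extDeriv (V 0) (V 1) (V 2) = -algebraMap K (A ⊗[K] A) (1 / 2) * (
    (E (Da 0 1) (b' 2) + E (a 1) (Db' 0 2) - (E (Da 0 2) (b' 1) + E (a 2) (Db' 0 1))) -
    (E (Da 1 0) (b' 2) + E (a 0) (Db' 1 2) - (E (Da 1 2) (b' 0) + E (a 2) (Db' 1 0))) +
    (E (Da 2 0) (b' 1) + E (a 0) (Db' 2 1) - (E (Da 2 1) (b' 0) + E (a 1) (Db' 2 0))) -
    (E (ka 0 1) (b' 2) - E (a 2) (kb' 0 1)) + (E (ka 0 2) (b' 1) - E (a 1) (kb' 0 2)) -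
    (E (ka 1 2) (b' 0) - E (a 0) (kb' 1 2)) +
    ((E (Da' 0 1) (b 2) + E (a' 1) (Db 0 2) - (E (Da' 0 2) (b 1) + E (a' 2) (Db 0 1))) -
    (E (Da' 1 0) (b 2) + E (a' 0) (Db 1 2) - (E (Da' 1 2) (b 0) + E (a' 2) (Db 1 0))) +
    (E (Da' 2 0) (b 1) + E (a' 0) (Db 2 1) - (E (Da' 2 1) (b 0) + E (a' 1) (Db 2 0))) -
    (E (ka' 0 1) (b 2) - E (a' 2) (kb 0 1)) + (E (ka' 0 2) (b 1) - E (a' 1) (kb 0 2)) -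
    (E (ka' 1 2) (b 0) - E (a' 0) (kb 1 2)))) := by
  have hD (X : Derivation K (A ⊗[K] A) (A ⊗[K] A)) (x y : LieAlg K A (A ⊗[K] A)) :
      X (E x y) = E (lieDeriv X x) y + E x (lieDeriv X y) := by
    rw [← hE, ← hE, ← hE]
    exact derivation_extForm _ X x y
  simp only [FormField.extDeriv, FormField.onFields, doubleForm_apply, Matrix.cons_val_zero,
    Matrix.cons_val_one, derivation_algebraMap_mul, hD, ha, ha', hb, hb', hDa, hDa',
    hDb, hDb', hka, hka', hkb, hkb', hE]
  rw [map_neg (algebraMap K (A ⊗[K] A))]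
  ring

theorem isQuasiClosed_double [CharZero K] (hs : B.IsSymm) (hB : IsAdInvariant B) :
    IsQuasiClosed (sumForm B) (doubleForm B) (doubleMap K A) := by
  intro X Y Z
  rw [cartanForm_doubleMap hs hB]
  let V : Fin 3 → Derivation K (A ⊗[K] A) (A ⊗[K] A) := ![X, Y, Z]
  have h := doubleForm_extDeriv (B := B) V (fun _ => rfl) (fun _ => rfl) (fun _ => rfl)
    (fun _ => rfl) (fun _ _ => rfl) (fun _ _ => rfl) (fun _ _ => rfl) (fun _ _ => rfl)
    (fun _ _ => rfl) (fun _ _ => rfl) (fun _ _ => rfl) (fun _ _ => rfl) (fun _ _ => rfl)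
  -- The two `by` blocks say that the pure cubic terms in ωⱼ and ω̄ⱼ agree, by Ad-invariance. The
  -- coefficient -1/2 of σ^× meets the minus sign of `cartan_identity`.
  rw [extForm_wedge_extDeriv hs hB (fun i j => lieDeriv_omega₁ (V i) (V j))
    (fun i j => lieDeriv_omegaBar₁ (V i) (V j)) (fun i j => lieDeriv_omega₂ (V i) (V j))
    (fun i j => lieDeriv_omegaBar₂ (V i) (V j))
    (by
      simp only [omegaBar₁_eq]
      exact (extForm_bracket_Ad hB _ _ _ _).symm)
    (by
      simp only [omegaBar₂_eq]
      exact (extForm_bracket_Ad hB _ _ _ _).symm) rfl, neg_mul_neg] at h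
  exact h

end Double

end Alg

namespace Lie

open Set Filter Topology

/-! ### Lie setting: calculus of second derivatives. -/

section SecondDerivative
variable {𝕜 : Type*} [RCLike 𝕜] {E : Type*} [NormedAddCommGroup E] [NormedSpace 𝕜 E]
  {F : Type*} [NormedAddCommGroup F] [NormedSpace 𝕜 F]
  {F' : Type*} [NormedAddCommGroup F'] [NormedSpace 𝕜 F']

variable (𝕜) in
/-- The second derivative. -/
abbrev sndDeriv (f : E → F) (x : E) : E →L[𝕜] E →L[𝕜] F := fderiv 𝕜 (fderiv 𝕜 f) x

theorem differentiableAt_fderiv {f : E → F} {x : E} (hf : ContDiffAt 𝕜 2 f x) :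
    DifferentiableAt 𝕜 (fderiv 𝕜 f) x :=
  (hf.fderiv_right (m := 1) (by norm_num)).differentiableAt one_ne_zero

theorem sndDeriv_symm {f : E → F} {x : E} (hf : ContDiffAt 𝕜 2 f x) (u v : E) :
    sndDeriv 𝕜 f x u v = sndDeriv 𝕜 f x v u :=
  hf.isSymmSndFDerivAt (by simp) u v

theorem sndDeriv_congr {f g : E → F} {x : E} (h : f =ᶠ[𝓝 x] g) :
    sndDeriv 𝕜 f x = sndDeriv 𝕜 g x := h.fderiv.fderiv_eq

theorem sndDeriv_clm (L : E →L[𝕜] F) (x : E) : sndDeriv 𝕜 L x = 0 := by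
  have : fderiv 𝕜 L = fun _ => L := by ext1; simp
  simp [sndDeriv, this]

theorem sndDeriv_id (x : E) : sndDeriv 𝕜 (fun y : E => y) x = 0 :=
  sndDeriv_clm (.id 𝕜 E) x

theorem sndDeriv_fst (x : E × F) : sndDeriv 𝕜 (fun y : E × F => y.1) x = 0 :=
  sndDeriv_clm (.fst 𝕜 E F) x

theorem sndDeriv_snd (x : E × F) : sndDeriv 𝕜 (fun y : E × F => y.2) x = 0 :=
  sndDeriv_clm (.snd 𝕜 E F) x

theorem sndDeriv_const (c : F) (x : E) : sndDeriv 𝕜 (fun _ : E => c) x = 0 := by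
  simp [sndDeriv]

theorem sndDeriv_comp {g : F → F'} {f : E → F} {x : E} (hg : ContDiffAt 𝕜 2 g (f x))
    (hf : ContDiffAt 𝕜 2 f x) (u v : E) :
    sndDeriv 𝕜 (fun y => g (f y)) x u v =
      sndDeriv 𝕜 g (f x) (fderiv 𝕜 f x u) (fderiv 𝕜 f x v) +
        fderiv 𝕜 g (f x) (sndDeriv 𝕜 f x u v) := by
  -- The first order chain rule is about to be differentiated, so it is needed on a neighbourhood of
  -- `x`.
  have h : fderiv 𝕜 (fun y => g (f y)) =ᶠ[𝓝 x]
      fun y => (fderiv 𝕜 g (f y)).comp (fderiv 𝕜 f y) := by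
    filter_upwards [hf.continuousAt.eventually (hg.eventually (by simp)), hf.eventually (by simp)]
      with y h₁ h₂
    exact fderiv_comp y (h₁.differentiableAt two_ne_zero) (h₂.differentiableAt two_ne_zero)
  have h' := ((differentiableAt_fderiv hg).hasFDerivAt.comp x
    (hf.differentiableAt two_ne_zero).hasFDerivAt).clm_comp (differentiableAt_fderiv hf).hasFDerivAt
  rw [sndDeriv, h.fderiv_eq.trans (HasFDerivAt.fderiv h')]
  simp [add_comm]

/-- The second order chain rule for the two projections, which are linear, isolates the components.
-/
theorem sndDeriv_prodMk {f : E → F} {g : E → F'} {x : E} (hf : ContDiffAt 𝕜 2 f x)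
    (hg : ContDiffAt 𝕜 2 g x) (u v : E) :
    sndDeriv 𝕜 (fun y => (f y, g y)) x u v = (sndDeriv 𝕜 f x u v, sndDeriv 𝕜 g x u v) := by
  have h := hf.prodMk hg
  have h₁ := sndDeriv_comp (g := Prod.fst) contDiffAt_fst h u v
  have h₂ := sndDeriv_comp (g := Prod.snd) contDiffAt_snd h u v
  rw [sndDeriv_fst, fderiv_fst] at h₁
  rw [sndDeriv_snd, fderiv_snd] at h₂
  ext
  · simpa using h₁.symm
  · simpa using h₂.symm

theorem fderiv_comp_fst {f : E → F'} {p : E × F} (hf : DifferentiableAt 𝕜 f p.1) (u : E × F) :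
    fderiv 𝕜 (fun q : E × F => f q.1) p u = fderiv 𝕜 f p.1 u.1 := by
  rw [show fderiv 𝕜 (fun q : E × F => f q.1) p = _ from
    (hf.hasFDerivAt.comp p (hasFDerivAt_fst (𝕜 := 𝕜) (p := p))).fderiv]
  rfl

theorem fderiv_comp_snd {f : F → F'} {p : E × F} (hf : DifferentiableAt 𝕜 f p.2) (u : E × F) :
    fderiv 𝕜 (fun q : E × F => f q.2) p u = fderiv 𝕜 f p.2 u.2 := by
  rw [show fderiv 𝕜 (fun q : E × F => f q.2) p = _ from
    (hf.hasFDerivAt.comp p (hasFDerivAt_snd (𝕜 := 𝕜) (p := p))).fderiv]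
  rfl

theorem sndDeriv_comp_fst {f : E → F'} {p : E × F} (hf : ContDiffAt 𝕜 2 f p.1) (u v : E × F) :
    sndDeriv 𝕜 (fun q : E × F => f q.1) p u v = sndDeriv 𝕜 f p.1 u.1 v.1 := by
  rw [sndDeriv_comp (f := fun q : E × F => q.1) hf contDiffAt_fst, sndDeriv_fst,
    (hasFDerivAt_fst (𝕜 := 𝕜) (p := p)).fderiv]
  simp

theorem sndDeriv_comp_snd {f : F → F'} {p : E × F} (hf : ContDiffAt 𝕜 2 f p.2) (u v : E × F) :
    sndDeriv 𝕜 (fun q : E × F => f q.2) p u v = sndDeriv 𝕜 f p.2 u.2 v.2 := by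
  rw [sndDeriv_comp (f := fun q : E × F => q.2) hf contDiffAt_snd, sndDeriv_snd,
    (hasFDerivAt_snd (𝕜 := 𝕜) (p := p)).fderiv]
  simp

end SecondDerivative

/-! ### Local groups to second order. -/

section LocalMul
variable {𝕜 : Type*} [RCLike 𝕜] {E : Type*} [NormedAddCommGroup E] [NormedSpace 𝕜 E]
  {F : Type*} [NormedAddCommGroup F] [NormedSpace 𝕜 F] {μ : E × E → E} {e : E}
  {μ' : F × F → F} {e' : F} {V : Type*} [NormedAddCommGroup V] [NormedSpace 𝕜 V]

variable (𝕜) in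
/-- The multiplication of a local group with unit `e`, to second order. -/
structure IsLocalMul (μ : E × E → E) (e : E) : Prop where
  contDiffAt : ContDiffAt 𝕜 2 μ (e, e)
  mul_unit : ∀ᶠ x in 𝓝 e, μ (x, e) = x
  unit_mul : ∀ᶠ x in 𝓝 e, μ (e, x) = x

variable (𝕜) in
/-- The mixed second derivative of a function of two variables. -/
def mixed (f : E × F → V) (p : E × F) : E →ₗ[𝕜] F →ₗ[𝕜] V :=
  LinearMap.mk₂ 𝕜 (fun X Y => sndDeriv 𝕜 f p (X, 0) (0, Y))
    (fun X X' Y => by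
      rw [← _root_.add_apply, ← map_add]; simp)
    (fun c X Y => by
      rw [← _root_.smul_apply, ← map_smul]; simp)
    (fun X Y Y' => by rw [← map_add]; simp) (fun c X Y => by rw [← map_smul]; simp)

theorem mixed_apply (f : E × F → V) (p : E × F) (X : E) (Y : F) :
    mixed 𝕜 f p X Y = sndDeriv 𝕜 f p (X, 0) (0, Y) := rfl

namespace IsLocalMul

variable (h : IsLocalMul 𝕜 μ e) {a b : V → E} {x : V}
include h

theorem apply_unit : μ (e, e) = e := h.mul_unit.self_of_nhds

theorem fderiv_left (X : E) : fderiv 𝕜 μ (e, e) (X, 0) = X := by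
  have := (h.contDiffAt.differentiableAt two_ne_zero).hasFDerivAt.comp (f := fun x => (x, e)) e
    (hasFDerivAt_prodMk_left e e)
  have h₁ := (this.congr_of_eventuallyEq (f₁ := id)
    (by filter_upwards [h.mul_unit] with x hx using hx.symm)).unique (hasFDerivAt_id e)
  simpa using DFunLike.congr_fun h₁ X

theorem fderiv_right (X : E) : fderiv 𝕜 μ (e, e) (0, X) = X := by
  have := (h.contDiffAt.differentiableAt two_ne_zero).hasFDerivAt.comp (f := fun x => (e, x)) e
    (hasFDerivAt_prodMk_right e e)
  have h₁ := (this.congr_of_eventuallyEq (f₁ := id)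
    (by filter_upwards [h.unit_mul] with x hx using hx.symm)).unique (hasFDerivAt_id e)
  simpa using DFunLike.congr_fun h₁ X

theorem fderiv_apply (X Y : E) : fderiv 𝕜 μ (e, e) (X, Y) = X + Y := by
  have : (X, Y) = (X, 0) + (0, Y) := by simp
  rw [this, map_add, h.fderiv_left, h.fderiv_right]

theorem sndDeriv_left (X Y : E) : sndDeriv 𝕜 μ (e, e) (X, 0) (Y, 0) = 0 := by
  have hc : ContDiffAt 𝕜 2 (fun x : E => (x, e)) e := contDiffAt_id.prodMk contDiffAt_const
  have h₁ := sndDeriv_comp (f := fun x => (x, e)) (x := e) h.contDiffAt hc X Y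
  rw [sndDeriv_congr h.mul_unit, sndDeriv_id,
    sndDeriv_prodMk (f := fun x => x) contDiffAt_id contDiffAt_const,
    (hasFDerivAt_prodMk_left (𝕜 := 𝕜) e e).fderiv] at h₁
  simpa [sndDeriv_id, sndDeriv_const, Prod.zero_eq_mk.symm] using h₁.symm

theorem sndDeriv_right (X Y : E) : sndDeriv 𝕜 μ (e, e) (0, X) (0, Y) = 0 := by
  have hc : ContDiffAt 𝕜 2 (fun x : E => (e, x)) e := contDiffAt_const.prodMk contDiffAt_id
  have h₁ := sndDeriv_comp (f := fun x => (e, x)) (x := e) h.contDiffAt hc X Y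
  rw [sndDeriv_congr h.unit_mul, sndDeriv_id,
    sndDeriv_prodMk (g := fun x => x) contDiffAt_const contDiffAt_id,
    (hasFDerivAt_prodMk_right (𝕜 := 𝕜) e e).fderiv] at h₁
  simpa [sndDeriv_id, sndDeriv_const, Prod.zero_eq_mk.symm] using h₁.symm

/-- The unit laws annihilate both pure second derivatives, so the mixed one is the whole second
order part of `μ`. -/
theorem sndDeriv_apply (u v : E × E) : sndDeriv 𝕜 μ (e, e) u v =
    mixed 𝕜 μ (e, e) u.1 v.2 + mixed 𝕜 μ (e, e) v.1 u.2 := by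
  obtain ⟨u₁, u₂⟩ := u
  obtain ⟨v₁, v₂⟩ := v
  have hu : (u₁, u₂) = (u₁, 0) + (0, u₂) := by simp
  have hv : (v₁, v₂) = (v₁, 0) + (0, v₂) := by simp
  have s : sndDeriv 𝕜 μ (e, e) (0, u₂) (v₁, 0) = mixed 𝕜 μ (e, e) v₁ u₂ :=
    sndDeriv_symm h.contDiffAt _ _
  rw [hu, hv, map_add (sndDeriv 𝕜 μ (e, e)), _root_.add_apply,
    map_add, map_add, h.sndDeriv_left, h.sndDeriv_right, s]
  simp [mixed_apply]

theorem fderiv_mul (ha : DifferentiableAt 𝕜 a x) (hb : DifferentiableAt 𝕜 b x) (hae : a x = e)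
    (hbe : b x = e) (u : V) :
    fderiv 𝕜 (fun y => μ (a y, b y)) x u = fderiv 𝕜 a x u + fderiv 𝕜 b x u := by
  have h₁ : DifferentiableAt 𝕜 μ (a x, b x) := by
    rw [hae, hbe]; exact h.contDiffAt.differentiableAt two_ne_zero
  have := h₁.hasFDerivAt.comp (f := fun y => (a y, b y)) x (ha.hasFDerivAt.prodMk hb.hasFDerivAt)
  rw [show (fun y => μ (a y, b y)) = μ ∘ fun y => (a y, b y) from rfl, this.fderiv, hae, hbe]
  simp [h.fderiv_apply]

/-- Product rule to second order at a point sent to the unit: the first derivative of `μ` there is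
addition. -/
theorem sndDeriv_mul (ha : ContDiffAt 𝕜 2 a x) (hb : ContDiffAt 𝕜 2 b x) (hae : a x = e)
    (hbe : b x = e) (u v : V) :
    sndDeriv 𝕜 (fun y => μ (a y, b y)) x u v =
      mixed 𝕜 μ (e, e) (fderiv 𝕜 a x u) (fderiv 𝕜 b x v) +
      mixed 𝕜 μ (e, e) (fderiv 𝕜 a x v) (fderiv 𝕜 b x u) +
      (sndDeriv 𝕜 a x u v + sndDeriv 𝕜 b x u v) := by
  have h₁ : ContDiffAt 𝕜 2 μ (a x, b x) := by rw [hae, hbe]; exact h.contDiffAt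
  have hd := ((ha.differentiableAt two_ne_zero).hasFDerivAt.prodMk
    (hb.differentiableAt two_ne_zero).hasFDerivAt).fderiv
  rw [sndDeriv_comp (f := fun y => (a y, b y)) h₁ (ha.prodMk hb), sndDeriv_prodMk ha hb, hae, hbe,
    h.sndDeriv_apply, h.fderiv_apply, hd]
  rfl

/-- The second derivative of a homomorphism of local groups. -/
theorem fderiv_mixed_of_hom (h' : IsLocalMul 𝕜 μ' e') {f : E → F} (hf : ContDiffAt 𝕜 2 f e)
    (hfe : f e = e') (hm : ∀ᶠ p in 𝓝 (e, e), f (μ p) = μ' (f p.1, f p.2)) (X Y : E) :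
    sndDeriv 𝕜 f e X Y + fderiv 𝕜 f e (mixed 𝕜 μ (e, e) X Y) =
      mixed 𝕜 μ' (e', e') (fderiv 𝕜 f e X) (fderiv 𝕜 f e Y) := by
  have h₁ : ContDiffAt 𝕜 2 f (μ (e, e)) := by rwa [h.apply_unit]
  have h₂ : ContDiffAt 𝕜 2 (fun p : E × E => f p.1) (e, e) := hf.comp (e, e) contDiffAt_fst
  have h₃ : ContDiffAt 𝕜 2 (fun p : E × E => f p.2) (e, e) := hf.comp (e, e) contDiffAt_snd
  -- Both sides of f(μ(p)) = μ'(f(p₁), f(p₂)) are differentiated once in each variable.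
  have hc := sndDeriv_comp h₁ h.contDiffAt (X, 0) (0, Y)
  rw [sndDeriv_congr hm, h'.sndDeriv_mul h₂ h₃ hfe hfe, sndDeriv_comp_fst hf, sndDeriv_comp_snd hf,
    fderiv_comp_fst (p := (_, _)) (hf.differentiableAt two_ne_zero),
    fderiv_comp_fst (p := (_, _)) (hf.differentiableAt two_ne_zero),
    fderiv_comp_snd (p := (_, _)) (hf.differentiableAt two_ne_zero),
    fderiv_comp_snd (p := (_, _)) (hf.differentiableAt two_ne_zero), h.apply_unit, h.fderiv_left,
    h.fderiv_right, ← mixed_apply] at hc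
  simpa using hc.symm

variable {ν : E × E → E} (hν : ContDiffAt 𝕜 2 ν (e, e)) (hνe : ν (e, e) = e)
include hν hνe

/-- The derivatives of left division. -/
theorem leftDiv (hm : ∀ᶠ p in 𝓝 (e, e), μ (p.1, ν p) = p.2) (X Y : E) :
    fderiv 𝕜 ν (e, e) (X, Y) = Y - X ∧ mixed 𝕜 ν (e, e) X Y = -mixed 𝕜 μ (e, e) X Y := by
  have d (u : E × E) : fderiv 𝕜 ν (e, e) u = u.2 - u.1 := by
    have := h.fderiv_mul (differentiableAt_fst (𝕜 := 𝕜) (p := (e, e)))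
      (hν.differentiableAt two_ne_zero) rfl hνe u
    rw [EventuallyEq.fderiv_eq hm, fderiv_fst, fderiv_snd] at this
    simp only [ContinuousLinearMap.coe_fst', ContinuousLinearMap.coe_snd'] at this
    rw [this]; abel
  refine ⟨d _, ?_⟩
  -- The product p₁ · ν(p) equals the linear map p₂, so its second derivative is zero; solving the
  -- product rule gives the mixed derivative of ν.
  have := h.sndDeriv_mul (contDiffAt_fst (n := 2) (p := (e, e))) hν rfl hνe (X, 0) (0, Y)
  rw [sndDeriv_congr hm, sndDeriv_fst, sndDeriv_snd, d, d, fderiv_fst] at this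
  simp only [ContinuousLinearMap.coe_fst', _root_.zero_apply, map_zero,
    LinearMap.zero_apply, sub_zero, zero_add, add_zero] at this
  rw [mixed_apply, eq_neg_iff_add_eq_zero, add_comm, ← this]

/-- The derivatives of right division. -/
theorem rightDiv (hm : ∀ᶠ p in 𝓝 (e, e), μ (ν p, p.1) = p.2) (X Y : E) :
    fderiv 𝕜 ν (e, e) (X, Y) = Y - X ∧ mixed 𝕜 ν (e, e) X Y = -mixed 𝕜 μ (e, e) Y X := by
  have d (u : E × E) : fderiv 𝕜 ν (e, e) u = u.2 - u.1 := by
    have := h.fderiv_mul (hν.differentiableAt two_ne_zero)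
      (differentiableAt_fst (𝕜 := 𝕜) (p := (e, e))) hνe rfl u
    rw [EventuallyEq.fderiv_eq hm, fderiv_fst, fderiv_snd] at this
    simp only [ContinuousLinearMap.coe_fst', ContinuousLinearMap.coe_snd'] at this
    rw [this]; abel
  refine ⟨d _, ?_⟩
  have := h.sndDeriv_mul hν (contDiffAt_fst (n := 2) (p := (e, e))) hνe rfl (X, 0) (0, Y)
  rw [sndDeriv_congr hm, sndDeriv_fst, sndDeriv_snd, d, d, fderiv_fst] at this
  simp only [ContinuousLinearMap.coe_fst', _root_.zero_apply, map_zero,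
    LinearMap.zero_apply, sub_zero, zero_add, add_zero] at this
  rw [mixed_apply, eq_neg_iff_add_eq_zero, add_comm, ← this]

/-- The derivatives of conjugation. -/
theorem conj (hm : ∀ᶠ p in 𝓝 (e, e), μ (ν p, p.1) = μ p) (X Y : E) :
    fderiv 𝕜 ν (e, e) (X, Y) = Y ∧
      mixed 𝕜 ν (e, e) X Y = mixed 𝕜 μ (e, e) X Y - mixed 𝕜 μ (e, e) Y X := by
  have d (u : E × E) : fderiv 𝕜 ν (e, e) u = u.2 := by
    have := h.fderiv_mul (hν.differentiableAt two_ne_zero)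
      (differentiableAt_fst (𝕜 := 𝕜) (p := (e, e))) hνe rfl u
    rw [EventuallyEq.fderiv_eq hm, fderiv_fst] at this
    change _ = _ + u.1 at this
    rw [← sub_eq_iff_eq_add.mpr this, h.fderiv_apply]; abel
  refine ⟨d _, ?_⟩
  have := h.sndDeriv_mul hν (contDiffAt_fst (n := 2) (p := (e, e))) hνe rfl (X, 0) (0, Y)
  rw [sndDeriv_congr hm, sndDeriv_fst, d, d, fderiv_fst] at this
  simp only [ContinuousLinearMap.coe_fst', _root_.zero_apply, map_zero,
    LinearMap.zero_apply, sub_zero, zero_add, add_zero] at this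
  rw [mixed_apply ν, mixed_apply μ _ X Y, this]; abel

end IsLocalMul

/-- The Maurer-Cartan equation for the second partial derivative on the diagonal of a function of
the form `N(f(y), f(z))`. -/
theorem maurerCartan_of_div {N : E × E → F} {G : V × V → F} {f : V → E} {x : V}
    (hN : ContDiffAt 𝕜 2 N (f x, f x)) (hf : ContDiffAt 𝕜 2 f x)
    (hG : ∀ᶠ p in 𝓝 (x, x), G p = N (f p.1, f p.2)) (u v : V) :
    fderiv 𝕜 (fun y => (fderiv 𝕜 G (y, y)).comp (.inr 𝕜 V V)) x u v -
      fderiv 𝕜 (fun y => (fderiv 𝕜 G (y, y)).comp (.inr 𝕜 V V)) x v u =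
    mixed 𝕜 N (f x, f x) (fderiv 𝕜 f x u) (fderiv 𝕜 f x v) -
      mixed 𝕜 N (f x, f x) (fderiv 𝕜 f x v) (fderiv 𝕜 f x u) := by
  have h₁ : ContDiffAt 𝕜 2 (fun p : V × V => f p.1) (x, x) := hf.comp (x, x) contDiffAt_fst
  have h₂ : ContDiffAt 𝕜 2 (fun p : V × V => f p.2) (x, x) := hf.comp (x, x) contDiffAt_snd
  have hc : ContDiffAt 𝕜 2 (fun p : V × V => (f p.1, f p.2)) (x, x) := h₁.prodMk h₂
  have hd := ((h₁.differentiableAt two_ne_zero).hasFDerivAt.prodMk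
    (h₂.differentiableAt two_ne_zero).hasFDerivAt).fderiv
  have hG' : ContDiffAt 𝕜 2 G (x, x) :=
    (ContDiffAt.comp (g := N) (x, x) hN hc).congr_of_eventuallyEq hG
  -- On arguments from different slots the second derivative of (f(y), f(z)) vanishes, so only that
  -- of `N` contributes.
  have hm (u v : V) : sndDeriv 𝕜 G (x, x) (u, 0) (0, v) =
      mixed 𝕜 N (f x, f x) (fderiv 𝕜 f x u) (fderiv 𝕜 f x v) := by
    rw [sndDeriv_congr hG, sndDeriv_comp (f := fun p : V × V => (f p.1, f p.2)) hN hc,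
      sndDeriv_prodMk h₁ h₂, sndDeriv_comp_fst hf, sndDeriv_comp_snd hf, hd, mixed_apply]
    simp [fderiv_comp_fst (p := (_, _)) (hf.differentiableAt two_ne_zero),
      fderiv_comp_snd (p := (_, _)) (hf.differentiableAt two_ne_zero), Prod.zero_eq_mk.symm]
  -- Along the diagonal both slots move, which adds a second term. That term is symmetric in `u` and
  -- `v` and drops out of the difference.
  have hθ (u v : V) : fderiv 𝕜 (fun y => (fderiv 𝕜 G (y, y)).comp (.inr 𝕜 V V)) x u v =
      sndDeriv 𝕜 G (x, x) (u, 0) (0, v) + sndDeriv 𝕜 G (x, x) (0, u) (0, v) := by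
    have hδ : HasFDerivAt (𝕜 := 𝕜) (fun y : V => (y, y)) (.prod (.id 𝕜 V) (.id 𝕜 V)) x :=
      (hasFDerivAt_id x).prodMk (hasFDerivAt_id x)
    have := (HasFDerivAt.comp (g := fderiv 𝕜 G) (f := fun y => (y, y)) x
      (differentiableAt_fderiv hG').hasFDerivAt hδ).clm_comp
        (hasFDerivAt_const (ContinuousLinearMap.inr 𝕜 V V) x)
    rw [show fderiv 𝕜 (fun y => (fderiv 𝕜 G (y, y)).comp (.inr 𝕜 V V)) x = _ from
      HasFDerivAt.fderiv this, ← _root_.add_apply, ← map_add]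
    simp
  rw [hθ, hθ, hm, hm, sndDeriv_symm hG' (0, u)]
  abel

end LocalMul

/-! ### Derivatives on manifolds read in charts. -/

section Charts
variable {𝕜 : Type*} [RCLike 𝕜] {E : Type*} [NormedAddCommGroup E] [NormedSpace 𝕜 E]
  {H : Type*} [TopologicalSpace H] {I : ModelWithCorners 𝕜 E H}
  {M : Type*} [TopologicalSpace M] [ChartedSpace H M]
  {E' : Type*} [NormedAddCommGroup E'] [NormedSpace 𝕜 E']
  {H' : Type*} [TopologicalSpace H'] {J : ModelWithCorners 𝕜 E' H'}
  {N : Type*} [TopologicalSpace N] [ChartedSpace H' N]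

/-- The point `p` is kept apart from `g y` so that the target chart can be centred at 1 once `g y =
1` is known. -/
theorem mfderiv_eq_fderiv_extChartAt {g : E → N} {y : E} {p : N}
    (hg : MDifferentiableAt 𝓘(𝕜, E) J g y) (hp : g y = p) :
    (mfderiv 𝓘(𝕜, E) J g y : E →L[𝕜] E') = fderiv 𝕜 (fun z => extChartAt J p (g z)) y := by
  subst hp
  refine hg.mfderiv.trans ?_
  simp only [writtenInExtChartAt, extChartAt_model_space_eq_id, modelWithCornersSelf_coe, range_id,
    fderivWithin_univ]
  rfl

theorem mfderiv_eq_fderiv_charts [I.Boundaryless] {g : M → N} {q : M} {p : N}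
    (hg : MDifferentiableAt I J g q) (hp : g q = p) :
    (mfderiv I J g q : E →L[𝕜] E') =
      fderiv 𝕜 (fun z => extChartAt J p (g ((extChartAt I q).symm z))) (extChartAt I q q) := by
  subst hp
  refine hg.mfderiv.trans ?_
  rw [I.range_eq_univ, fderivWithin_univ]
  rfl

theorem contMDiffAt_extChartAt_symm [I.Boundaryless] {n : ℕ∞ω} [IsManifold I n M] {q : M} {y : E}
    (hy : y ∈ (extChartAt I q).target) : ContMDiffAt 𝓘(𝕜, E) I n (extChartAt I q).symm y :=
  (contMDiffOn_extChartAt_symm q).contMDiffAt (extChartAt_target_mem_nhds' hy)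

variable {G : Type*} [TopologicalSpace G] [ChartedSpace H G] [Group G]

variable {V : Type*} [NormedAddCommGroup V] [NormedSpace 𝕜 V]

variable (I) in
/-- The function `w(f(x), f(y))` of two variables, for a map `w : G × G → G`, in the chart at the
unit. -/
def inCharts (w : G × G → G) (f : V → G) (z : V × V) : E := extChartAt I 1 (w (f z.1, f z.2))

theorem contDiffAt_inCharts {n : ℕ∞ω} [IsManifold I n G] {w : G × G → G}
    (hw : ContMDiff (I.prod I) I n w) {f : V → G} {z : V × V}
    (h₁ : ContMDiffAt 𝓘(𝕜, V) I n f z.1) (h₂ : ContMDiffAt 𝓘(𝕜, V) I n f z.2)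
    (h : w (f z.1, f z.2) ∈ (extChartAt I 1).source) :
    ContDiffAt 𝕜 n (inCharts I w f) z := by
  rw [← contMDiffAt_iff_contDiffAt]
  have c₁ : ContMDiffAt 𝓘(𝕜, V × V) I n (fun z : V × V => f z.1) z :=
    h₁.comp z contDiffAt_fst.contMDiffAt
  have c₂ : ContMDiffAt 𝓘(𝕜, V × V) I n (fun z : V × V => f z.2) z :=
    h₂.comp z contDiffAt_snd.contMDiffAt
  rw [extChartAt_source] at h
  exact (contMDiffAt_extChartAt' h).comp z (hw.contMDiffAt.comp z (c₁.prodMk c₂))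

theorem eventually_mem_source {w : G × G → G} (hw : Continuous w) {f : V → G} {z : V × V}
    (h₁ : ContinuousAt f z.1) (h₂ : ContinuousAt f z.2)
    (h : w (f z.1, f z.2) ∈ (extChartAt I 1).source) :
    ∀ᶠ z in 𝓝 z, w (f z.1, f z.2) ∈ (extChartAt I 1).source :=
  (hw.continuousAt.comp ((h₁.comp continuousAt_fst).prodMk (h₂.comp continuousAt_snd))).eventually
    ((isOpen_extChartAt_source 1).mem_nhds h)

variable (I) in
/-- The expression of a map `w : G × G → G` in the chart at the unit. -/
abbrev inUnitChart (w : G × G → G) : E × E → E := inCharts I w (extChartAt I (1 : G)).symm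

variable (I G) in
/-- The coordinates of the unit. -/
abbrev unitCoord : E := extChartAt I (1 : G) 1

theorem symm_unitCoord : (extChartAt I (1 : G)).symm (unitCoord I G) = 1 :=
  extChartAt_to_inv 1

theorem symm_inCharts {w : G × G → G} {f : V → G} {z : V × V}
    (h : w (f z.1, f z.2) ∈ (extChartAt I 1).source) :
    (extChartAt I 1).symm (inCharts I w f z) = w (f z.1, f z.2) :=
  (extChartAt I 1).left_inv h

theorem inCharts_unit {w : G × G → G} (h : w (1, 1) = 1) :
    inUnitChart I w (unitCoord I G, unitCoord I G) = unitCoord I G := by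
  simp only [inCharts, symm_unitCoord, h]

end Charts

/-! ### The group and its bracket in the chart at the unit. -/

section LocalGroup
variable {𝕜 : Type*} [RCLike 𝕜] {E : Type*} [NormedAddCommGroup E] [NormedSpace 𝕜 E]
  {H : Type*} [TopologicalSpace H] {I : ModelWithCorners 𝕜 E H} [I.Boundaryless]
  {G : Type*} [TopologicalSpace G] [ChartedSpace H G] [Group G]

variable (G) in
/-- The multiplication of `G`. -/
def mulWord (p : G × G) : G := p.1 * p.2

variable (G) in
/-- Left division in `G`. -/
def leftDivWord (p : G × G) : G := p.1⁻¹ * p.2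

variable (G) in
/-- Right division in `G`. -/
def rightDivWord (p : G × G) : G := p.2 * p.1⁻¹

variable (G) in
/-- Conjugation in `G`. -/
def conjWord (p : G × G) : G := p.1 * p.2 * p.1⁻¹

variable (I) in
theorem contMDiff_words (n : ℕ∞ω) [LieGroup I n G] :
    ContMDiff (I.prod I) I n (mulWord G) ∧ ContMDiff (I.prod I) I n (leftDivWord G) ∧
    ContMDiff (I.prod I) I n (rightDivWord G) ∧ ContMDiff (I.prod I) I n (conjWord G) :=
  ⟨contMDiff_fst.mul contMDiff_snd, contMDiff_fst.inv.mul contMDiff_snd,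
    contMDiff_snd.mul contMDiff_fst.inv, (contMDiff_fst.mul contMDiff_snd).mul contMDiff_fst.inv⟩

variable (I) in
theorem contDiffAt_unit {n : ℕ∞ω} [IsManifold I n G] {w : G × G → G}
    (hw : ContMDiff (I.prod I) I n w) (h : w (1, 1) = 1) :
    ContDiffAt 𝕜 n (inUnitChart I w) (unitCoord I G, unitCoord I G) := by
  refine contDiffAt_inCharts hw (contMDiffAt_extChartAt_symm (mem_extChartAt_target _))
    (contMDiffAt_extChartAt_symm (mem_extChartAt_target _)) ?_
  simp only [symm_unitCoord, h]
  exact mem_extChartAt_source _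

-- Near the unit the values of the word stay in the chart domain, so identities between words in the
-- group carry over to coordinate expressions.
variable (I) in
theorem eventually_unit {n : ℕ∞ω} [IsManifold I n G] {w : G × G → G}
    (hw : ContMDiff (I.prod I) I n w) (h : w (1, 1) = 1) :
    ∀ᶠ z in 𝓝 (unitCoord I G, unitCoord I G),
      w ((extChartAt I 1).symm z.1, (extChartAt I 1).symm z.2) ∈ (extChartAt I 1).source := by
  refine eventually_mem_source hw.continuous (continuousAt_extChartAt_symm _)
    (continuousAt_extChartAt_symm _) ?_
  simp only [symm_unitCoord, h]
  exact mem_extChartAt_source _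

variable (I G) in
/-- The Lie bracket of the Lie algebra of `G`, on the model vector space. -/
def lieBilin : E →ₗ[𝕜] E →ₗ[𝕜] E :=
  mixed 𝕜 (inUnitChart I (mulWord G)) (unitCoord I G, unitCoord I G) -
    (mixed 𝕜 (inUnitChart I (mulWord G)) (unitCoord I G, unitCoord I G)).flip

theorem lieBilin_apply (X Y : E) : lieBilin I G X Y =
    mixed 𝕜 (inUnitChart I (mulWord G)) (unitCoord I G, unitCoord I G) X Y -
      mixed 𝕜 (inUnitChart I (mulWord G)) (unitCoord I G, unitCoord I G) Y X := rfl

theorem lieBilin_swap (X Y : E) : lieBilin I G X Y = -lieBilin I G Y X := by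
  rw [lieBilin_apply, lieBilin_apply, neg_sub]

variable [LieGroup I ∞ G]

variable (I G) in
theorem isLocalMul : IsLocalMul 𝕜 (inUnitChart I (mulWord G)) (unitCoord I G) where
  contDiffAt := contDiffAt_unit I (contMDiff_words I 2).1 (mul_one 1)
  mul_unit := by
    filter_upwards [extChartAt_target_mem_nhds (I := I) (1 : G)] with x hx
    simp only [inCharts, symm_unitCoord, mulWord, mul_one, (extChartAt I 1).right_inv hx]
  unit_mul := by
    filter_upwards [extChartAt_target_mem_nhds (I := I) (1 : G)] with x hx
    simp only [inCharts, symm_unitCoord, mulWord, one_mul, (extChartAt I 1).right_inv hx]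

variable (I G) in
theorem eventually_target : ∀ᶠ z in 𝓝 (unitCoord I G, unitCoord I G),
    z.2 ∈ (extChartAt I (1 : G)).target :=
  continuousAt_snd.eventually (extChartAt_target_mem_nhds (I := I) (1 : G))

-- Division and conjugation are characterised by a(a⁻¹b) = b, (ba⁻¹)a = b and (aba⁻¹)a = ab, which
-- hold in the chart near the unit; their derivatives then follow from those of the multiplication.
variable (I G) in
theorem leftDivWord_unit (X Y : E) :
    fderiv 𝕜 (inUnitChart I (leftDivWord G)) (unitCoord I G, unitCoord I G) (X, Y) = Y - X ∧
    mixed 𝕜 (inUnitChart I (leftDivWord G)) (unitCoord I G, unitCoord I G) X Y =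
      -mixed 𝕜 (inUnitChart I (mulWord G)) (unitCoord I G, unitCoord I G) X Y := by
  have h₁ : leftDivWord G (1, 1) = 1 := by simp [leftDivWord]
  have hw := (contMDiff_words (G := G) I 2).2.1
  refine (isLocalMul I G).leftDiv (contDiffAt_unit I hw h₁) (inCharts_unit h₁) ?_ X Y
  filter_upwards [eventually_unit I hw h₁, eventually_target I G] with z hz hz₂
  change extChartAt I 1 (mulWord G ((extChartAt I 1).symm z.1, (extChartAt I 1).symm (inUnitChart I (leftDivWord G) z))) = _
  rw [symm_inCharts hz, mulWord, leftDivWord, mul_inv_cancel_left, (extChartAt I 1).right_inv hz₂]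

variable (I G) in
theorem rightDivWord_unit (X Y : E) :
    fderiv 𝕜 (inUnitChart I (rightDivWord G)) (unitCoord I G, unitCoord I G) (X, Y) = Y - X ∧
    mixed 𝕜 (inUnitChart I (rightDivWord G)) (unitCoord I G, unitCoord I G) X Y =
      -mixed 𝕜 (inUnitChart I (mulWord G)) (unitCoord I G, unitCoord I G) Y X := by
  have h₁ : rightDivWord G (1, 1) = 1 := by simp [rightDivWord]
  have hw := (contMDiff_words (G := G) I 2).2.2.1
  refine (isLocalMul I G).rightDiv (contDiffAt_unit I hw h₁) (inCharts_unit h₁) ?_ X Y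
  filter_upwards [eventually_unit I hw h₁, eventually_target I G] with z hz hz₂
  change extChartAt I 1 (mulWord G ((extChartAt I 1).symm (inUnitChart I (rightDivWord G) z), (extChartAt I 1).symm z.1)) = _
  rw [symm_inCharts hz, mulWord, rightDivWord, inv_mul_cancel_right, (extChartAt I 1).right_inv hz₂]

variable (I G) in
theorem conjWord_unit (X Y : E) :
    fderiv 𝕜 (inUnitChart I (conjWord G)) (unitCoord I G, unitCoord I G) (X, Y) = Y ∧
    mixed 𝕜 (inUnitChart I (conjWord G)) (unitCoord I G, unitCoord I G) X Y =
      lieBilin I G X Y := by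
  have h₁ : conjWord G (1, 1) = 1 := by simp [conjWord]
  have hw := (contMDiff_words (G := G) I 2).2.2.2
  refine (isLocalMul I G).conj (contDiffAt_unit I hw h₁) (inCharts_unit h₁) ?_ X Y
  filter_upwards [eventually_unit I hw h₁] with z hz
  change extChartAt I 1 (mulWord G ((extChartAt I 1).symm (inUnitChart I (conjWord G) z), (extChartAt I 1).symm z.1)) = _
  rw [symm_inCharts hz, mulWord, conjWord, inv_mul_cancel_right]
  rfl

open VectorField in
/-- The Lie bracket in the chart at the unit. -/
theorem bracket_eq_lieBilin (X Y : E) :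
    (Bracket.bracket (L := GroupLieAlgebra I G) (M := GroupLieAlgebra I G) X Y : E) =
      lieBilin I G X Y := by
  rw [lieBilin_apply]
  have hμ := isLocalMul I G
  let W (X : E) : E → E :=
    mpullbackWithin 𝓘(𝕜, E) I (extChartAt I (1 : G)).symm (mulInvariantVectorField X) (range I)
  -- In coordinates a left invariant field is the derivative of the multiplication in its second
  -- argument at the unit.
  have hV (X : E) : W X =ᶠ[𝓝 (unitCoord I G)]
      fun y => fderiv 𝕜 (inUnitChart I (mulWord G)) (y, unitCoord I G) (0, X) := by
    filter_upwards [extChartAt_target_mem_nhds (I := I) (1 : G)] with y hy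
    have hs : (extChartAt I (1 : G)).symm y ∈ (extChartAt I 1).source :=
      (extChartAt I (1 : G)).map_target hy
    have hi : (mfderivWithin 𝓘(𝕜, E) I (extChartAt I (1 : G)).symm (range I) y).inverse =
        mfderiv I 𝓘(𝕜, E) (extChartAt I (1 : G)) ((extChartAt I (1 : G)).symm y) :=
      ContinuousLinearMap.inverse_eq (mfderivWithin_extChartAt_symm_comp_mfderiv_extChartAt hy)
        (mfderiv_extChartAt_comp_mfderivWithin_extChartAt_symm hy)
    have hl : MDifferentiableAt I I (fun b : G => (extChartAt I (1 : G)).symm y * b) 1 :=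
      (contMDiff_mul_left (n := 1)).contMDiffAt.mdifferentiableAt one_ne_zero
    have hc : MDifferentiableAt I 𝓘(𝕜, E) (extChartAt I (1 : G))
        ((extChartAt I (1 : G)).symm y * 1) := by
      rw [mul_one]
      exact mdifferentiableAt_extChartAt (by rwa [extChartAt_source] at hs)
    have hμy : ContDiffAt 𝕜 1 (inUnitChart I (mulWord G)) (y, unitCoord I G) := by
      refine contDiffAt_inCharts (contMDiff_words I 1).1 (contMDiffAt_extChartAt_symm hy)
        (contMDiffAt_extChartAt_symm (mem_extChartAt_target _)) ?_
      simp only [symm_unitCoord, mulWord, mul_one]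
      exact hs
    have e₁ := mfderiv_comp (1 : G) hc hl
    have e₂ := mfderiv_eq_fderiv_charts (hc.comp (1 : G) hl) rfl
    have e₃ := ((hμy.differentiableAt one_ne_zero).hasFDerivAt.comp (f := fun z => (y, z))
      (unitCoord I G) (hasFDerivAt_prodMk_right y (unitCoord I G))).fderiv
    refine (DFunLike.congr_fun hi _).trans ?_
    refine Eq.trans ?_ (DFunLike.congr_fun e₃ X)
    refine Eq.trans ?_ (DFunLike.congr_fun e₂ X)
    rw [e₁, mul_one]
    rfl
  -- Differentiating this field in the base point gives the mixed derivative, so the bracket of two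
  -- such fields is its skew part.
  have hd (X Y : E) : fderiv 𝕜 (fun y => fderiv 𝕜 (inUnitChart I (mulWord G))
      (y, unitCoord I G) (0, X)) (unitCoord I G) Y =
      mixed 𝕜 (inUnitChart I (mulWord G)) (unitCoord I G, unitCoord I G) Y X := by
    have h := (((differentiableAt_fderiv hμ.contDiffAt).hasFDerivAt.comp
      (f := fun y => (y, unitCoord I G)) (unitCoord I G)
      (hasFDerivAt_prodMk_left (unitCoord I G) (unitCoord I G))).clm_apply
      (hasFDerivAt_const ((0, X) : E × E) (unitCoord I G)))
    rw [show fderiv 𝕜 (fun y => fderiv 𝕜 (inUnitChart I (mulWord G))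
      (y, unitCoord I G) (0, X)) (unitCoord I G) = _ from h.fderiv]
    simp [mixed_apply]
  -- The chart at the unit has derivative the identity there, so transporting the bracket back
  -- changes nothing.
  have hinv : (mfderiv I 𝓘(𝕜, E) (extChartAt I (1 : G)) 1).inverse = .id 𝕜 E := by
    rw [mfderiv_extChartAt_self]
    exact ContinuousLinearMap.inverse_id
  refine (DFunLike.congr_fun hinv _).trans ?_
  have hr : (extChartAt I (1 : G)).symm ⁻¹' univ ∩ range I = univ := by
    rw [I.range_eq_univ, preimage_univ, univ_inter]
  rw [hr]
  change lieBracketWithin 𝕜 (W X) (W Y) univ (unitCoord I G) = _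
  rw [lieBracketWithin_univ, (hV X).lieBracket_vectorField_eq (hV Y), lieBracket, hd, hd, hμ.fderiv_right,
    hμ.fderiv_right]

end LocalGroup

/-! ### Tangent maps between the model vector spaces. -/

section ChainRule
variable {𝕜 : Type*} [NontriviallyNormedField 𝕜] {E : Type*} [NormedAddCommGroup E]
  [NormedSpace 𝕜 E]
  {H : Type*} [TopologicalSpace H] {I : ModelWithCorners 𝕜 E H}
  {M : Type*} [TopologicalSpace M] [ChartedSpace H M]
  {E' : Type*} [NormedAddCommGroup E'] [NormedSpace 𝕜 E']
  {H' : Type*} [TopologicalSpace H'] {J : ModelWithCorners 𝕜 E' H'}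
  {N : Type*} [TopologicalSpace N] [ChartedSpace H' N]
  {E'' : Type*} [NormedAddCommGroup E''] [NormedSpace 𝕜 E'']
  {H'' : Type*} [TopologicalSpace H''] {K : ModelWithCorners 𝕜 E'' H''}
  {P : Type*} [TopologicalSpace P] [ChartedSpace H'' P]

variable (I J) in
/-- The derivative of a map of manifolds, on the model vector spaces. -/
def tderiv (f : M → N) (x : M) : E →L[𝕜] E' := mfderiv I J f x

/-- The chain rule, on the model vector spaces. -/
theorem mfderiv_mfderiv_apply {f : M → N} {g : N → P} {x : M} {y : N}
    (hg : MDifferentiableAt J K g y) (hf : MDifferentiableAt I J f x) (hy : f x = y) {k : M → P}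
    (hk : ∀ z, k z = g (f z)) (v : E) :
    (tderiv J K g y (tderiv I J f x v : E') : E'') = tderiv I K k x v := by
  subst hy
  rw [show k = g ∘ f from funext hk]
  exact (DFunLike.congr_fun (mfderiv_comp x hg hf) v).symm

theorem mfderiv_congr_apply {f g : M → N} (h : ∀ z, f z = g z) (x : M) (v : E) :
    (tderiv I J f x v : E') = tderiv I J g x v := by
  obtain rfl := funext h
  rfl

end ChainRule

/-! ### Logarithmic derivatives and the adjoint action. -/

section Logarithmic
variable {𝕜 : Type*} [RCLike 𝕜] {E : Type*} [NormedAddCommGroup E] [NormedSpace 𝕜 E]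
  {H : Type*} [TopologicalSpace H] {I : ModelWithCorners 𝕜 E H}
  {G : Type*} [TopologicalSpace G] [ChartedSpace H G] [Group G]
  {E' : Type*} [NormedAddCommGroup E'] [NormedSpace 𝕜 E']
  {H' : Type*} [TopologicalSpace H'] {J : ModelWithCorners 𝕜 E' H'}
  {M : Type*} [TopologicalSpace M] [ChartedSpace H' M]
  {E'' : Type*} [NormedAddCommGroup E''] [NormedSpace 𝕜 E'']
  {H'' : Type*} [TopologicalSpace H''] {K : ModelWithCorners 𝕜 E'' H''}
  {N : Type*} [TopologicalSpace N] [ChartedSpace H'' N]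

variable (I) in
/-- The adjoint action, on the model vector space. -/
def adE (g : G) : E →L[𝕜] E := Ad (I := I) g

variable (I J) in
/-- The left logarithmic derivative `f⁻¹ df`, on the model vector spaces. -/
def logL (f : M → G) (m : M) : E' →L[𝕜] E :=
  (maurerCartanL (I := I) (f m)).comp (mfderiv J I f m)

variable (I J) in
/-- The right logarithmic derivative `df f⁻¹`, on the model vector spaces. -/
def logR (f : M → G) (m : M) : E' →L[𝕜] E :=
  (maurerCartanR (I := I) (f m)).comp (mfderiv J I f m)

variable [LieGroup I ∞ G] {f g : M → G} {m : M}

theorem mdifferentiable_mulLeft (a : G) : MDifferentiable I I fun h : G => a * h :=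
  (contMDiff_mul_left (n := 1)).mdifferentiable one_ne_zero

theorem mdifferentiable_mulRight (a : G) : MDifferentiable I I fun h : G => h * a :=
  (contMDiff_mul_right (n := 1)).mdifferentiable one_ne_zero

theorem mdifferentiable_inv : MDifferentiable I I fun h : G => h⁻¹ :=
  (contMDiff_inv I 1).mdifferentiable one_ne_zero

theorem mdifferentiable_conj (a : G) : MDifferentiable I I fun h : G => a * h * a⁻¹ :=
  (mdifferentiable_mulRight a⁻¹).comp (mdifferentiable_mulLeft a)

theorem mdifferentiableAt_mul (hf : MDifferentiableAt J I f m) (hg : MDifferentiableAt J I g m) :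
    MDifferentiableAt J I (fun x => f x * g x) m :=
  ((contMDiff_mul I 1).mdifferentiable one_ne_zero (f m, g m)).comp m (hf.prodMk hg)

theorem mdifferentiableAt_inv (hf : MDifferentiableAt J I f m) :
    MDifferentiableAt J I (fun x => (f x)⁻¹) m :=
  (mdifferentiable_inv (f m)).comp m hf

/-- The chain rule turns f⁻¹df at `m` into the ordinary derivative of x ↦ f(m)⁻¹f(x), a map that
sends `m` to the unit. -/
theorem logL_apply (hf : MDifferentiableAt J I f m) (v : E') :
    logL I J f m v = tderiv J I (fun x => (f m)⁻¹ * f x) m v :=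
  mfderiv_mfderiv_apply (mdifferentiable_mulLeft _ _) hf rfl (fun _ => rfl) v

theorem logR_apply (hf : MDifferentiableAt J I f m) (v : E') :
    logR I J f m v = tderiv J I (fun x => f x * (f m)⁻¹) m v :=
  mfderiv_mfderiv_apply (mdifferentiable_mulRight _ _) hf rfl (fun _ => rfl) v

theorem logL_one (hf : MDifferentiableAt J I f m) (h : f m = 1) (v : E') :
    logL I J f m v = tderiv J I f m v := by
  exact (logL_apply hf v).trans (mfderiv_congr_apply (fun z => by rw [h, inv_one, one_mul]) m v)

theorem logR_one (hf : MDifferentiableAt J I f m) (h : f m = 1) (v : E') :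
    logR I J f m v = tderiv J I f m v := by
  exact (logR_apply hf v).trans (mfderiv_congr_apply (fun z => by rw [h, inv_one, mul_one]) m v)

theorem logL_const (c : G) (v : E') : logL I J (fun _ : M => c) m v = 0 := by
  rw [logL_apply mdifferentiableAt_const]
  exact DFunLike.congr_fun mfderiv_const v

/-- Conjugating f(m)⁻¹f(x) by f(m) gives f(x)f(m)⁻¹. -/
theorem adE_logL (hf : MDifferentiableAt J I f m) (v : E') :
    adE I (f m) (logL I J f m v) = logR I J f m v := by
  rw [logL_apply hf, logR_apply hf]
  exact mfderiv_mfderiv_apply (mdifferentiable_conj _ _)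
    (mdifferentiableAt_mul mdifferentiableAt_const hf) (inv_mul_cancel _) (fun x => by group) v

theorem adE_mul (a b : G) (X : E) : adE I (a * b) X = adE I a (adE I b X) :=
  (mfderiv_mfderiv_apply (mdifferentiable_conj a 1) (mdifferentiable_conj b 1) (by group)
    (fun x => by group) X).symm

theorem adE_one (X : E) : adE I (1 : G) X = X := by
  have : (fun h : G => 1 * h * 1⁻¹) = id := by ext h; simp
  rw [adE, Ad, this, mfderiv_id]
  rfl

theorem adE_inv_adE (a : G) (X : E) : adE I a⁻¹ (adE I a X) = X := by
  rw [← adE_mul, inv_mul_cancel, adE_one]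

theorem adE_adE_inv (a : G) (X : E) : adE I a (adE I a⁻¹ X) = X := by
  rw [← adE_mul, mul_inv_cancel, adE_one]

theorem adE_inv_logR (hf : MDifferentiableAt J I f m) (v : E') :
    adE I (f m)⁻¹ (logR I J f m v) = logL I J f m v := by
  rw [← adE_logL hf, adE_inv_adE]

/-- The partial derivatives at (1, 1) are those of z ↦ z · 1 and z ↦ 1 · z, both the identity. -/
theorem mfderiv_mul_unit (w : E × E) :
    (tderiv (I.prod I) I (fun p : G × G => p.1 * p.2) (1, 1) w : E) = w.1 + w.2 := by
  have e₁ : (tderiv I I (fun z : G => z * 1) 1 w.1 : E) = w.1 :=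
    (mfderiv_congr_apply (g := id) (fun z => mul_one z) 1 w.1).trans
      (DFunLike.congr_fun mfderiv_id w.1)
  have e₂ : (tderiv I I (fun z : G => 1 * z) 1 w.2 : E) = w.2 :=
    (mfderiv_congr_apply (g := id) (fun z => one_mul z) 1 w.2).trans
      (DFunLike.congr_fun mfderiv_id w.2)
  exact (mfderiv_prod_eq_add_apply
    ((contMDiff_mul I 1).mdifferentiable one_ne_zero _)).trans
      (congrArg₂ (fun a b : E => a + b) e₁ e₂)

/-- The derivative of a product of maps at a point that they send to the unit. -/
theorem mfderiv_mul_of_unit (hf : MDifferentiableAt J I f m) (hg : MDifferentiableAt J I g m)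
    (hfm : f m = 1) (hgm : g m = 1) (v : E') :
    (tderiv J I (fun x => f x * g x) m v : E) =
      tderiv J I f m v + tderiv J I g m v := by
  have h₁ := mfderiv_mfderiv_apply (f := fun x => (f x, g x)) (y := (1, 1))
    ((contMDiff_mul I 1).mdifferentiable one_ne_zero _) (hf.prodMk hg)
    (by rw [hfm, hgm]) (k := fun x => f x * g x) (fun _ => rfl) v
  refine h₁.symm.trans ((mfderiv_mul_unit _).trans ?_)
  exact congrArg (fun w : E × E => w.1 + w.2) (DFunLike.congr_fun (hf.mfderiv_prod hg) v)

/-- Up to the constant factor (f(m)g(m))⁻¹ on the left, f(x)g(x) is the product of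
g(m)⁻¹(f(m)⁻¹f(x))g(m) and g(m)⁻¹g(x). Both factors are 1 at `m`, where the derivative of
multiplication is addition. -/
theorem logL_mul (hf : MDifferentiableAt J I f m) (hg : MDifferentiableAt J I g m) (v : E') :
    logL I J (fun x => f x * g x) m v = adE I (g m)⁻¹ (logL I J f m v) + logL I J g m v := by
  have hf' : MDifferentiableAt J I (fun x => (f m)⁻¹ * f x) m :=
    mdifferentiableAt_mul mdifferentiableAt_const hf
  rw [logL_apply hf, logL_apply hg, logL_apply (mdifferentiableAt_mul hf hg)]
  have h₁ := mfderiv_mfderiv_apply (k := fun x => (g m)⁻¹ * ((f m)⁻¹ * f x) * (g m)⁻¹⁻¹)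
    (mdifferentiable_conj _ _) hf' (inv_mul_cancel _) (fun x => rfl) v
  have h₂ := mfderiv_mul_of_unit ((mdifferentiable_conj (g m)⁻¹ _).comp m hf')
    (mdifferentiableAt_mul mdifferentiableAt_const hg) (by simp) (inv_mul_cancel (g m)) v
  refine Eq.trans ?_ (h₂.trans (congrArg₂ (fun a b : E => a + b) h₁.symm rfl))
  exact mfderiv_congr_apply (fun x => by simp only [Function.comp]; group) m v

theorem logR_mul (hf : MDifferentiableAt J I f m) (hg : MDifferentiableAt J I g m) (v : E') :
    logR I J (fun x => f x * g x) m v = logR I J f m v + adE I (f m) (logR I J g m v) := by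
  rw [← adE_logL (mdifferentiableAt_mul hf hg), logL_mul hf hg, map_add, adE_mul, adE_mul,
    adE_adE_inv, adE_logL hf, adE_logL hg]

/-- The product rule is applied to the constant map f f⁻¹. -/
theorem logL_inv (hf : MDifferentiableAt J I f m) (v : E') :
    logL I J (fun x => (f x)⁻¹) m v = -logR I J f m v := by
  have h := logL_mul hf (mdifferentiableAt_inv hf) v
  simp only [mul_inv_cancel, inv_inv, logL_const] at h
  rw [adE_logL hf, add_comm] at h
  exact eq_neg_of_add_eq_zero_left h.symm

theorem logR_inv (hf : MDifferentiableAt J I f m) (v : E') :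
    logR I J (fun x => (f x)⁻¹) m v = -logL I J f m v := by
  rw [← adE_logL (mdifferentiableAt_inv hf), logL_inv hf, map_neg, adE_inv_logR hf]

theorem logL_comp {h : N → M} {x : N} (hf : MDifferentiableAt J I f m)
    (hh : MDifferentiableAt K J h x) (hx : h x = m) (v : E'') :
    logL I J f m (tderiv K J h x v) = logL I K (fun y => f (h y)) x v := by
  subst hx
  exact congrArg (maurerCartanL (I := I) (f (h x)))
    (mfderiv_mfderiv_apply hf hh rfl (fun _ => rfl) v)

theorem logR_comp {h : N → M} {x : N} (hf : MDifferentiableAt J I f m)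
    (hh : MDifferentiableAt K J h x) (hx : h x = m) (v : E'') :
    logR I J f m (tderiv K J h x v) = logR I K (fun y => f (h y)) x v := by
  subst hx
  exact congrArg (maurerCartanR (I := I) (f (h x)))
    (mfderiv_mfderiv_apply hf hh rfl (fun _ => rfl) v)

end Logarithmic

/-! ### Translations, orbit maps and components. -/

section Product
variable {𝕜 : Type*} [RCLike 𝕜] {E : Type*} [NormedAddCommGroup E] [NormedSpace 𝕜 E]
  {H : Type*} [TopologicalSpace H] {I : ModelWithCorners 𝕜 E H}
  {G : Type*} [TopologicalSpace G] [ChartedSpace H G] [Group G] [LieGroup I ∞ G]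
  {E' : Type*} [NormedAddCommGroup E'] [NormedSpace 𝕜 E']
  {H' : Type*} [TopologicalSpace H'] {J : ModelWithCorners 𝕜 E' H'}
  {M : Type*} [TopologicalSpace M] [ChartedSpace H' M] {f g : M → G} {m : M}

theorem tderiv_fst (p : M × M) (w : E' × E') :
    tderiv (J.prod J) J Prod.fst p w = w.1 := DFunLike.congr_fun mfderiv_fst w

theorem tderiv_snd (p : M × M) (w : E' × E') :
    tderiv (J.prod J) J Prod.snd p w = w.2 := DFunLike.congr_fun mfderiv_snd w

theorem logL_translate (hf : MDifferentiableAt J I f m) (a b : G) (v : E') :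
    logL I J (fun x => a * f x * b) m v = adE I b⁻¹ (logL I J f m v) := by
  rw [logL_mul (mdifferentiableAt_mul mdifferentiableAt_const hf) mdifferentiableAt_const,
    logL_mul mdifferentiableAt_const hf, logL_const, logL_const, map_zero, zero_add, add_zero]

theorem logR_translate (hf : MDifferentiableAt J I f m) (a b : G) (v : E') :
    logR I J (fun x => a * f x * b) m v = adE I a (logR I J f m v) := by
  rw [← adE_logL (mdifferentiableAt_mul (mdifferentiableAt_mul mdifferentiableAt_const hf)
    mdifferentiableAt_const), logL_translate hf, ← adE_mul, mul_inv_cancel_right, adE_mul,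
    adE_logL hf]

theorem logL_orbit (hf : MDifferentiableAt J I f m) (hg : MDifferentiableAt J I g m)
    (hfm : f m = 1) (hgm : g m = 1) (a : G) (v : E') :
    logL I J (fun x => f x * a * (g x)⁻¹) m v =
      adE I a⁻¹ (tderiv J I f m v) - tderiv J I g m v := by
  rw [logL_mul (mdifferentiableAt_mul hf mdifferentiableAt_const) (mdifferentiableAt_inv hg),
    logL_mul hf mdifferentiableAt_const, logL_const, logL_inv hg, logR_one hg hgm,
    logL_one hf hfm, hgm, inv_one, inv_one, adE_one, add_zero, sub_eq_add_neg]

/-- A projection of G × G is a homomorphism, so it commutes with forming Ψ(m)⁻¹Ψ(x). -/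
theorem fst_logL {Ψ : M → G × G} (hΨ : MDifferentiableAt J (I.prod I) Ψ m) (v : E') :
    (logL (I.prod I) J Ψ m v).1 = logL I J (fun x => (Ψ x).1) m v := by
  rw [logL_apply hΨ, logL_apply (f := fun x => (Ψ x).1) (mdifferentiableAt_fst.comp m hΨ),
    ← mfderiv_mfderiv_apply (f := fun x => (Ψ m)⁻¹ * Ψ x) (I := J) (J := I.prod I)
    (g := Prod.fst) mdifferentiableAt_fst
    (mdifferentiableAt_mul mdifferentiableAt_const hΨ) rfl
    (k := fun x => (Ψ m).1⁻¹ * (Ψ x).1) (fun _ => rfl) v, tderiv_fst]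

theorem snd_logL {Ψ : M → G × G} (hΨ : MDifferentiableAt J (I.prod I) Ψ m) (v : E') :
    (logL (I.prod I) J Ψ m v).2 = logL I J (fun x => (Ψ x).2) m v := by
  rw [logL_apply hΨ, logL_apply (f := fun x => (Ψ x).2) (mdifferentiableAt_snd.comp m hΨ),
    ← mfderiv_mfderiv_apply (f := fun x => (Ψ m)⁻¹ * Ψ x) (I := J) (J := I.prod I)
    (g := Prod.snd) mdifferentiableAt_snd
    (mdifferentiableAt_mul mdifferentiableAt_const hΨ) rfl
    (k := fun x => (Ψ m).2⁻¹ * (Ψ x).2) (fun _ => rfl) v, tderiv_snd]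

theorem fst_logR {Ψ : M → G × G} (hΨ : MDifferentiableAt J (I.prod I) Ψ m) (v : E') :
    (logR (I.prod I) J Ψ m v).1 = logR I J (fun x => (Ψ x).1) m v := by
  rw [logR_apply hΨ, logR_apply (f := fun x => (Ψ x).1) (mdifferentiableAt_fst.comp m hΨ),
    ← mfderiv_mfderiv_apply (f := fun x => Ψ x * (Ψ m)⁻¹) (I := J) (J := I.prod I)
    (g := Prod.fst) mdifferentiableAt_fst
    (mdifferentiableAt_mul hΨ mdifferentiableAt_const) rfl
    (k := fun x => (Ψ x).1 * (Ψ m).1⁻¹) (fun _ => rfl) v, tderiv_fst]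

theorem snd_logR {Ψ : M → G × G} (hΨ : MDifferentiableAt J (I.prod I) Ψ m) (v : E') :
    (logR (I.prod I) J Ψ m v).2 = logR I J (fun x => (Ψ x).2) m v := by
  rw [logR_apply hΨ, logR_apply (f := fun x => (Ψ x).2) (mdifferentiableAt_snd.comp m hΨ),
    ← mfderiv_mfderiv_apply (f := fun x => Ψ x * (Ψ m)⁻¹) (I := J) (J := I.prod I)
    (g := Prod.snd) mdifferentiableAt_snd
    (mdifferentiableAt_mul hΨ mdifferentiableAt_const) rfl
    (k := fun x => (Ψ x).2 * (Ψ m).2⁻¹) (fun _ => rfl) v, tderiv_snd]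

end Product

/-! ### The bilinear form on the model vector space. -/

section Form
variable {𝕜 : Type*} [RCLike 𝕜] {E : Type*} [NormedAddCommGroup E] [NormedSpace 𝕜 E]
  {H : Type*} [TopologicalSpace H] {I : ModelWithCorners 𝕜 E H}
  {G : Type*} [TopologicalSpace G] [ChartedSpace H G] [Group G]
  {B : LinearMap.BilinForm 𝕜 (GroupLieAlgebra I G)}

/-- A bilinear form on the Lie algebra, on the model vector space. -/
def formE (B : LinearMap.BilinForm 𝕜 (GroupLieAlgebra I G)) : E →ₗ[𝕜] E →ₗ[𝕜] 𝕜 := B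

theorem formE_symm (hs : B.IsSymm) (X Y : E) : formE B X Y = formE B Y X := hs.eq X Y

theorem formE_adE_adE (hB : IsAdInvariant B) (g : G) (X Y : E) :
    formE B (adE I g X) (adE I g Y) = formE B X Y := hB g X Y

theorem formE_adE [LieGroup I ∞ G] (hB : IsAdInvariant B) (g : G) (X Y : E) :
    formE B (adE I g X) Y = formE B X (adE I g⁻¹ Y) := by
  rw [← formE_adE_adE hB g X, adE_adE_inv]

theorem sumForm_apply (X Y : E × E) :
    formE (sumForm B) X Y = formE B X.1 Y.1 + formE B X.2 Y.2 := by
  rw [← tderiv_fst (J := I) (1 : G × G) X, ← tderiv_fst (J := I) (1 : G × G) Y,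
    ← tderiv_snd (J := I) (1 : G × G) X, ← tderiv_snd (J := I) (1 : G × G) Y]
  rfl

end Form

/-! ### The double of a Lie group: invariance, momentum, non-degeneracy. -/

section Double
variable {𝕜 : Type*} [RCLike 𝕜] {E : Type*} [NormedAddCommGroup E] [NormedSpace 𝕜 E]
  {H : Type*} [TopologicalSpace H] {I : ModelWithCorners 𝕜 E H}
  {G : Type*} [TopologicalSpace G] [ChartedSpace H G] [Group G]
  {B : LinearMap.BilinForm 𝕜 (GroupLieAlgebra I G)}

variable (I) in
/-- The `1`-form `ω₁` on `G × G`, the index `j` meaning pullback along the projection to the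
`j`-th factor. -/
def omega₁ (q : G × G) : E × E →L[𝕜] E := logL I (I.prod I) Prod.fst q

variable (I) in
/-- The `1`-form `ω₂` on `G × G`. -/
def omega₂ (q : G × G) : E × E →L[𝕜] E := logL I (I.prod I) Prod.snd q

variable (I) in
/-- The `1`-form `ω̄₁` on `G × G`. -/
def omegaBar₁ (q : G × G) : E × E →L[𝕜] E := logR I (I.prod I) Prod.fst q

variable (I) in
/-- The `1`-form `ω̄₂` on `G × G`. -/
def omegaBar₂ (q : G × G) : E × E →L[𝕜] E := logR I (I.prod I) Prod.snd q

variable (B) in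
/-- The form `σ^×`, on the model vector space. -/
def doubleFormE [FiniteDimensional 𝕜 E] (q : G × G) : (E × E) [⋀^Fin 2]→L[𝕜] 𝕜 := doubleForm B q

theorem doubleFormE_apply [FiniteDimensional 𝕜 E] (q : G × G) (v : Fin 2 → E × E) :
    doubleFormE B q v = (-(1 / 2) : 𝕜) *
      (formE B (omega₁ I q (v 0)) (omegaBar₂ I q (v 1)) -
        formE B (omega₁ I q (v 1)) (omegaBar₂ I q (v 0)) +
      (formE B (omegaBar₁ I q (v 0)) (omega₂ I q (v 1)) -
        formE B (omegaBar₁ I q (v 1)) (omega₂ I q (v 0)))) := rfl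

theorem doubleMap_isEquivariant :
    IsEquivariant (G := G × G) doubleAct (doubleMap : G × G → G × G) := by
  intro g m
  ext <;> simp [doubleAct, doubleMap, mul_assoc]

theorem doubleAct_isAction {n : ℕ∞ω} [LieGroup I n G] :
    IsAction (I.prod I) (I.prod I) n (doubleAct : G × G → G × G → G × G) where
  one_act m := by simp [doubleAct]
  mul_act x y m := by simp [doubleAct, mul_assoc]
  contMDiff := by
    have x₁ : ContMDiff ((I.prod I).prod (I.prod I)) I n fun p : (G × G) × (G × G) => p.1.1 :=
      contMDiff_fst.comp contMDiff_fst
    have x₂ : ContMDiff ((I.prod I).prod (I.prod I)) I n fun p : (G × G) × (G × G) => p.1.2 :=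
      contMDiff_snd.comp contMDiff_fst
    have q₁ : ContMDiff ((I.prod I).prod (I.prod I)) I n fun p : (G × G) × (G × G) => p.2.1 :=
      contMDiff_fst.comp contMDiff_snd
    have q₂ : ContMDiff ((I.prod I).prod (I.prod I)) I n fun p : (G × G) × (G × G) => p.2.2 :=
      contMDiff_snd.comp contMDiff_snd
    exact ((x₁.mul q₁).mul x₂.inv).prodMk ((x₂.mul q₂).mul x₁.inv)

theorem contMDiff_doubleMap {n : ℕ∞ω} [LieGroup I n G] :
    ContMDiff (I.prod I) (I.prod I) n (doubleMap : G × G → G × G) :=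
  (contMDiff_fst.mul contMDiff_snd).prodMk (contMDiff_fst.inv.mul contMDiff_snd.inv)

variable [LieGroup I ∞ G]

theorem omegaBar₁_eq (q : G × G) (v : E × E) : omegaBar₁ I q v = adE I q.1 (omega₁ I q v) :=
  (adE_logL mdifferentiableAt_fst v).symm

theorem omegaBar₂_eq (q : G × G) (v : E × E) : omegaBar₂ I q v = adE I q.2 (omega₂ I q v) :=
  (adE_logL mdifferentiableAt_snd v).symm

theorem mdifferentiableAt_doubleAct (g q : G × G) :
    MDifferentiableAt (I.prod I) (I.prod I) (doubleAct g) q :=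
  (((doubleAct_isAction (I := I) (n := 1)).contMDiff.comp
    (contMDiff_const.prodMk contMDiff_id)).mdifferentiable one_ne_zero) q

theorem mdifferentiableAt_orbit (q g : G × G) :
    MDifferentiableAt (I.prod I) (I.prod I) (fun x => doubleAct x q) g :=
  (((doubleAct_isAction (I := I) (n := 1)).contMDiff.comp
    (contMDiff_id.prodMk contMDiff_const)).mdifferentiable one_ne_zero) g

theorem mdifferentiableAt_doubleMap (q : G × G) :
    MDifferentiableAt (I.prod I) (I.prod I) doubleMap q :=
  (contMDiff_doubleMap (I := I) (n := 1)).mdifferentiable one_ne_zero q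

section Translates
variable (g q : G × G) (v : E × E)

/-- In x q₁ y⁻¹ the left logarithmic derivative sees only the right factor y⁻¹, the right one only
x. The pairs (ω₁, ω̄₂) and (ω̄₁, ω₂) are each transformed by a single Ad. -/
theorem omega₁_doubleAct :
    omega₁ I (doubleAct g q) (tderiv (I.prod I) (I.prod I) (doubleAct g) q v) =
      adE I g.2 (omega₁ I q v) :=
  (logL_comp mdifferentiableAt_fst (mdifferentiableAt_doubleAct g q) rfl v).trans
    ((logL_translate mdifferentiableAt_fst g.1 g.2⁻¹ v).trans (by rw [inv_inv]; rfl))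

theorem omegaBar₁_doubleAct :
    omegaBar₁ I (doubleAct g q) (tderiv (I.prod I) (I.prod I) (doubleAct g) q v) =
      adE I g.1 (omegaBar₁ I q v) :=
  (logR_comp mdifferentiableAt_fst (mdifferentiableAt_doubleAct g q) rfl v).trans
    (logR_translate mdifferentiableAt_fst g.1 g.2⁻¹ v)

theorem omega₂_doubleAct :
    omega₂ I (doubleAct g q) (tderiv (I.prod I) (I.prod I) (doubleAct g) q v) =
      adE I g.1 (omega₂ I q v) :=
  (logL_comp mdifferentiableAt_snd (mdifferentiableAt_doubleAct g q) rfl v).trans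
    ((logL_translate mdifferentiableAt_snd g.2 g.1⁻¹ v).trans (by rw [inv_inv]; rfl))

theorem omegaBar₂_doubleAct :
    omegaBar₂ I (doubleAct g q) (tderiv (I.prod I) (I.prod I) (doubleAct g) q v) =
      adE I g.2 (omegaBar₂ I q v) :=
  (logR_comp mdifferentiableAt_snd (mdifferentiableAt_doubleAct g q) rfl v).trans
    (logR_translate mdifferentiableAt_snd g.2 g.1⁻¹ v)

end Translates

theorem doubleForm_isInvariant [FiniteDimensional 𝕜 E] (hB : IsAdInvariant B) :
    IsInvariant doubleAct (doubleForm B) := by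
  intro g m v
  let w (i : Fin 2) : E × E := v i
  change doubleFormE B (doubleAct g m)
    (fun i => tderiv (I.prod I) (I.prod I) (doubleAct g) m (w i)) = doubleFormE B m w
  rw [doubleFormE_apply, doubleFormE_apply]
  simp only [omega₁_doubleAct, omega₂_doubleAct, omegaBar₁_doubleAct, omegaBar₂_doubleAct,
    formE_adE_adE hB]

section Fundamental
variable (X : E × E) (q : G × G)

variable (I) in
/-- The fundamental vector fields of the action on `G × G`, on the model vector space. -/
def doubleFund : E × E := fund (I := I.prod I) (J := I.prod I) doubleAct X q

/-- The first component of the orbit map is (x, y) ↦ x q₁ y⁻¹. It is differentiated at the unit in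
the direction -X, which exchanges the signs of the two terms. -/
theorem omega₁_fund : omega₁ I q (doubleFund I X q) = X.2 - adE I q.1⁻¹ X.1 := by
  refine (logL_comp mdifferentiableAt_fst (mdifferentiableAt_orbit (I := I) q 1)
    (by simp [doubleAct]) (-X)).trans
    ((logL_orbit mdifferentiableAt_fst mdifferentiableAt_snd rfl rfl q.1 (-X)).trans ?_)
  rw [tderiv_fst, tderiv_snd]
  simp [sub_eq_add_neg, add_comm]

theorem omegaBar₁_fund : omegaBar₁ I q (doubleFund I X q) = adE I q.1 X.2 - X.1 := by
  rw [omegaBar₁_eq, omega₁_fund, map_sub, adE_adE_inv]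

theorem omega₂_fund : omega₂ I q (doubleFund I X q) = X.1 - adE I q.2⁻¹ X.2 := by
  refine (logL_comp mdifferentiableAt_snd (mdifferentiableAt_orbit (I := I) q 1)
    (by simp [doubleAct]) (-X)).trans
    ((logL_orbit mdifferentiableAt_snd mdifferentiableAt_fst rfl rfl q.2 (-X)).trans ?_)
  rw [tderiv_fst, tderiv_snd]
  simp [sub_eq_add_neg, add_comm]

theorem omegaBar₂_fund : omegaBar₂ I q (doubleFund I X q) = adE I q.2 X.1 - X.2 := by
  rw [omegaBar₂_eq, omega₂_fund, map_sub, adE_adE_inv]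

end Fundamental

section Moment
variable (q : G × G) (v : E × E)

/-- The product rule gives Ad(q₂⁻¹)ω₁ + ω₂, and ω₂ = Ad(q₂⁻¹)ω̄₂. -/
theorem fst_logL_doubleMap : (logL (I.prod I) (I.prod I) doubleMap q v).1 =
    adE I q.2⁻¹ (omega₁ I q v + omegaBar₂ I q v) := by
  rw [fst_logL (mdifferentiableAt_doubleMap (I := I) q)]
  refine (logL_mul mdifferentiableAt_fst mdifferentiableAt_snd v).trans ?_
  rw [map_add, omegaBar₂_eq, adE_inv_adE]
  rfl

theorem fst_logR_doubleMap : (logR (I.prod I) (I.prod I) doubleMap q v).1 =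
    adE I q.1 (omega₁ I q v + omegaBar₂ I q v) := by
  rw [fst_logR (mdifferentiableAt_doubleMap (I := I) q)]
  refine (logR_mul mdifferentiableAt_fst mdifferentiableAt_snd v).trans ?_
  rw [map_add, ← omegaBar₁_eq]
  rfl

theorem snd_logL_doubleMap : (logL (I.prod I) (I.prod I) doubleMap q v).2 =
    -adE I q.2 (omegaBar₁ I q v + omega₂ I q v) := by
  rw [snd_logL (mdifferentiableAt_doubleMap (I := I) q)]
  refine (logL_mul (mdifferentiableAt_inv mdifferentiableAt_fst)
    (mdifferentiableAt_inv mdifferentiableAt_snd) v).trans ?_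
  rw [logL_inv mdifferentiableAt_fst, logL_inv mdifferentiableAt_snd, inv_inv, map_neg, map_add,
    neg_add, ← omegaBar₂_eq]
  rfl

theorem snd_logR_doubleMap : (logR (I.prod I) (I.prod I) doubleMap q v).2 =
    -adE I q.1⁻¹ (omegaBar₁ I q v + omega₂ I q v) := by
  rw [snd_logR (mdifferentiableAt_doubleMap (I := I) q)]
  refine (logR_mul (mdifferentiableAt_inv mdifferentiableAt_fst)
    (mdifferentiableAt_inv mdifferentiableAt_snd) v).trans ?_
  rw [logR_inv mdifferentiableAt_fst, logR_inv mdifferentiableAt_snd, map_neg, map_add, neg_add,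
    omegaBar₁_eq, adE_inv_adE]
  rfl

end Moment

theorem doubleForm_momentum [FiniteDimensional 𝕜 E] (hs : B.IsSymm) (hB : IsAdInvariant B)
    (X : E × E) (q : G × G) (v : E × E) :
    doubleFormE B q ![doubleFund I X q, v] = (1 / 2 : 𝕜) * formE (sumForm B) X
      (logL (I.prod I) (I.prod I) doubleMap q v + logR (I.prod I) (I.prod I) doubleMap q v) := by
  rw [doubleFormE_apply, sumForm_apply, Prod.fst_add, Prod.snd_add, fst_logL_doubleMap,
    fst_logR_doubleMap, snd_logL_doubleMap, snd_logR_doubleMap]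
  simp only [Matrix.cons_val_zero, Matrix.cons_val_one, omega₁_fund, omega₂_fund, omegaBar₁_fund,
    omegaBar₂_fund, omegaBar₁_eq q v, omegaBar₂_eq q v]
  -- Symmetry brings the components of `X` to the left; Ad-invariance then moves every Ad to the
  -- right argument, where the terms match.
  rw [formE_symm hs (omega₁ I q v), formE_symm hs (adE I q.1 (omega₁ I q v))]
  simp only [map_add, map_sub, map_neg, LinearMap.sub_apply, formE_adE hB, adE_inv_adE, inv_inv]
  ring

theorem omega₁_apply (q : G × G) (v : E × E) :
    omega₁ I q v = tderiv I I (fun h => q.1⁻¹ * h) q.1 v.1 :=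
  congrArg (maurerCartanL (I := I) q.1) (tderiv_fst q v)

theorem omega₂_apply (q : G × G) (v : E × E) :
    omega₂ I q v = tderiv I I (fun h => q.2⁻¹ * h) q.2 v.2 :=
  congrArg (maurerCartanL (I := I) q.2) (tderiv_snd q v)

theorem tderiv_mulLeft_inv (a : G) (X : E) :
    tderiv I I (fun h => a⁻¹ * h) a (tderiv I I (fun h => a * h) 1 X) = X :=
  (mfderiv_mfderiv_apply (k := id) (mdifferentiable_mulLeft _ _) (mdifferentiable_mulLeft _ _)
    (mul_one a) (fun x => by simp) X).trans (DFunLike.congr_fun mfderiv_id X)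

theorem tderiv_mulLeft_injective (a : G) {v : E}
    (h : tderiv I I (fun h => a⁻¹ * h) a v = 0) : v = 0 := by
  have h₁ := (mfderiv_mfderiv_apply (f := fun h => a⁻¹ * h) (g := fun h => a * h) (k := id)
    (mdifferentiable_mulLeft (I := I) a 1) (mdifferentiable_mulLeft (I := I) a⁻¹ a)
    (inv_mul_cancel a)
    (fun x => by simp) v).trans (DFunLike.congr_fun mfderiv_id v)
  rw [h, map_zero] at h₁
  exact h₁.symm

theorem isNondegenerateRel_double [FiniteDimensional 𝕜 E] (hB : IsAdInvariant B)
    (hn : B.Nondegenerate) :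
    IsNondegenerateRel (I.prod I) (I.prod I) (doubleForm B) (doubleMap : G × G → G × G) := by
  intro q u' hu' hΦ
  obtain ⟨u, rfl⟩ : ∃ u : E × E, u = u' := ⟨u', rfl⟩
  have hu (v : E × E) : doubleFormE B q ![u, v] = 0 := hu' v
  have hl : logL (I.prod I) (I.prod I) doubleMap q u = 0 :=
    (congrArg (maurerCartanL (I := I.prod I) (doubleMap q)) hΦ).trans (map_zero _)
  have h₁ : omega₁ I q u + omegaBar₂ I q u = 0 := by
    rw [← adE_adE_inv (I := I) q.2 (omega₁ I q u + omegaBar₂ I q u), ← fst_logL_doubleMap, hl,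
      Prod.fst_zero, map_zero]
  have h₂ : omegaBar₁ I q u + omega₂ I q u = 0 := by
    rw [← adE_inv_adE (I := I) q.2 (omegaBar₁ I q u + omega₂ I q u), ← neg_neg (adE I q.2 _),
      ← snd_logL_doubleMap, hl, Prod.snd_zero, neg_zero, map_zero]
  have h₃ : omega₁ I q u = 0 := by
    refine hn.2 (omega₁ I q u) fun Y => ?_
    change formE B Y (omega₁ I q u) = 0
    -- The test vector is `Y` translated from the unit to q₁ in the first factor, with zero second
    -- component.
    obtain ⟨v, hv₁, hv₂⟩ : ∃ v : E × E, omega₁ I q v = Y ∧ omega₂ I q v = 0 := by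
      refine ⟨(tderiv I I (fun h => q.1 * h) 1 (show E from Y), 0), ?_, ?_⟩
      · rw [omega₁_apply]
        exact tderiv_mulLeft_inv q.1 _
      · rw [omega₂_apply, map_zero]
    have h := hu v
    rw [doubleFormE_apply] at h
    simp only [Matrix.cons_val_zero, Matrix.cons_val_one] at h
    -- The relations from dΦ(u) = 0 leave -½ times two terms, equal by Ad-invariance, so their sum
    -- is -Y • ω₁(u).
    rw [omegaBar₁_eq q v, omegaBar₂_eq q v, hv₂, eq_neg_of_add_eq_zero_right h₁,
      eq_neg_of_add_eq_zero_right h₂, omegaBar₁_eq q u, map_zero, map_zero, map_zero, map_neg,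
      map_neg, formE_adE_adE hB, hv₁] at h
    linear_combination -h

  have h₄ : omega₂ I q u = 0 := by
    rw [eq_neg_of_add_eq_zero_right h₂, omegaBar₁_eq, h₃, map_zero, neg_zero]
  rw [omega₁_apply] at h₃
  rw [omega₂_apply] at h₄
  exact Prod.ext (tderiv_mulLeft_injective q.1 h₃) (tderiv_mulLeft_injective q.2 h₄)

end Double

/-! ### The structure equations for logarithmic derivatives. -/

section LogarithmicCharts
variable {𝕜 : Type*} [RCLike 𝕜] {E : Type*} [NormedAddCommGroup E] [NormedSpace 𝕜 E]
  {H : Type*} [TopologicalSpace H] {I : ModelWithCorners 𝕜 E H} [I.Boundaryless]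
  {G : Type*} [TopologicalSpace G] [ChartedSpace H G] [Group G]
  {V : Type*} [NormedAddCommGroup V] [NormedSpace 𝕜 V] {f : V → G} {x : V}

/-- Since z ↦ w(f(x), f(z)) hits the unit at z = x, the chart at the unit serves for every base
point. The derivative becomes a partial derivative on the diagonal of one function of two variables.
-/
theorem tderiv_eq_fderiv_inCharts [IsManifold I 1 G] {w : G × G → G}
    (hw : ContMDiff (I.prod I) I 1 w) (hf : ContMDiffAt 𝓘(𝕜, V) I 1 f x)
    (h : w (f x, f x) = 1) :
    tderiv 𝓘(𝕜, V) I (fun z => w (f x, f z)) x =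
      (fderiv 𝕜 (inCharts I w f) (x, x)).comp (.inr 𝕜 V V) := by
  have hg : MDifferentiableAt 𝓘(𝕜, V) I (fun z => w (f x, f z)) x :=
    ((hw.contMDiffAt (x := (f x, f x))).comp x
      (contMDiffAt_const.prodMk hf)).mdifferentiableAt one_ne_zero
  refine (mfderiv_eq_fderiv_extChartAt hg h).trans ?_
  have hc : ContDiffAt 𝕜 1 (inCharts I w f) (x, x) := by
    refine contDiffAt_inCharts hw hf hf ?_
    rw [h]
    exact mem_extChartAt_source _
  exact ((hc.differentiableAt one_ne_zero).hasFDerivAt.comp (f := fun z => (x, z))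
      x (hasFDerivAt_prodMk_right x x)).fderiv

/-- One derivative is lost; the hypothesis `n + 1 ≤ n` says that the class absorbs the loss. -/
theorem contDiffAt_fderiv_inCharts {n : ℕ∞ω} (hn : n + 1 ≤ n) [IsManifold I n G] {w : G × G → G}
    (hw : ContMDiff (I.prod I) I n w) (hf : ContMDiffAt 𝓘(𝕜, V) I n f x)
    (h : w (f x, f x) = 1) :
    ContDiffAt 𝕜 n (fun y => (fderiv 𝕜 (inCharts I w f) (y, y)).comp (.inr 𝕜 V V)) x := by
  have hc : ContDiffAt 𝕜 n (inCharts I w f) (x, x) := by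
    refine contDiffAt_inCharts hw hf hf ?_
    rw [h]
    exact mem_extChartAt_source _
  exact (ContDiffAt.comp (f := fun y : V => (y, y)) x (hc.fderiv_right hn)
    (contDiffAt_id.prodMk contDiffAt_id)).clm_comp contDiffAt_const

/-- The point f(x) may be far from the unit. A translate `g` with g(x) = 1 leaves w(f(y), f(z))
unchanged and brings the situation into the chart at the unit. -/
theorem maurerCartan_inCharts [IsManifold I 2 G] {w : G × G → G}
    (hw : ContMDiff (I.prod I) I 2 w) (hw₁ : w (1, 1) = 1) {g : V → G}
    (hg : ContMDiffAt 𝓘(𝕜, V) I 2 g x) (hgx : g x = 1)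
    (h : ∀ y z, w (f y, f z) = w (g y, g z)) (u v : V) :
    fderiv 𝕜 (fun y => (fderiv 𝕜 (inCharts I w f) (y, y)).comp (.inr 𝕜 V V)) x u v -
      fderiv 𝕜 (fun y => (fderiv 𝕜 (inCharts I w f) (y, y)).comp (.inr 𝕜 V V)) x v u =
    mixed 𝕜 (inUnitChart I w) (unitCoord I G, unitCoord I G)
        (tderiv 𝓘(𝕜, V) I g x u) (tderiv 𝓘(𝕜, V) I g x v) -
      mixed 𝕜 (inUnitChart I w) (unitCoord I G, unitCoord I G)
        (tderiv 𝓘(𝕜, V) I g x v) (tderiv 𝓘(𝕜, V) I g x u) := by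
  have hs : g x ∈ (chartAt H (1 : G)).source := by
    rw [hgx]
    exact mem_chart_source H 1
  have hk : ContDiffAt 𝕜 2 (fun y => extChartAt I (1 : G) (g y)) x :=
    contMDiffAt_iff_contDiffAt.mp ((contMDiffAt_extChartAt' hs).comp x hg)
  have hd : tderiv 𝓘(𝕜, V) I g x = fderiv 𝕜 (fun y => extChartAt I (1 : G) (g y)) x :=
    mfderiv_eq_fderiv_extChartAt (hg.mdifferentiableAt two_ne_zero) hgx
  have e : extChartAt I (1 : G) (g x) = unitCoord I G := by rw [hgx]
  have hN : ContDiffAt 𝕜 2 (inUnitChart I w)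
      (extChartAt I (1 : G) (g x), extChartAt I (1 : G) (g x)) := by
    rw [e]
    exact contDiffAt_unit I hw hw₁
  have hev : ∀ᶠ y in 𝓝 x, (extChartAt I (1 : G)).symm (extChartAt I (1 : G) (g y)) = g y := by
    have := hg.continuousAt.eventually ((isOpen_extChartAt_source (I := I) (1 : G)).mem_nhds
      (by rw [extChartAt_source]; exact hs))
    filter_upwards [this] with y hy
    exact (extChartAt I (1 : G)).left_inv hy
  have := maurerCartan_of_div (G := inCharts I w f) hN hk ?_ u v
  · rwa [e, ← hd] at this
  · rw [nhds_prod_eq]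
    filter_upwards [hev.prod_mk hev] with p hp
    simp only [inCharts, hp.1, hp.2, h]

variable [LieGroup I ∞ G]

theorem logL_eventuallyEq (hf : ∀ᶠ y in 𝓝 x, ContMDiffAt 𝓘(𝕜, V) I 1 f y) :
    logL I 𝓘(𝕜, V) f =ᶠ[𝓝 x]
      fun y => (fderiv 𝕜 (inCharts I (leftDivWord G) f) (y, y)).comp (.inr 𝕜 V V) := by
  filter_upwards [hf] with y hy
  rw [← tderiv_eq_fderiv_inCharts (contMDiff_words I 1).2.1 hy (inv_mul_cancel _)]
  ext v
  exact logL_apply (hy.mdifferentiableAt one_ne_zero) v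

theorem logR_eventuallyEq (hf : ∀ᶠ y in 𝓝 x, ContMDiffAt 𝓘(𝕜, V) I 1 f y) :
    logR I 𝓘(𝕜, V) f =ᶠ[𝓝 x]
      fun y => (fderiv 𝕜 (inCharts I (rightDivWord G) f) (y, y)).comp (.inr 𝕜 V V) := by
  filter_upwards [hf] with y hy
  rw [← tderiv_eq_fderiv_inCharts (contMDiff_words I 1).2.2.1 hy (mul_inv_cancel _)]
  ext v
  exact logR_apply (hy.mdifferentiableAt one_ne_zero) v

/-- The Maurer-Cartan equation `dω + 1/2 [ω, ω] = 0`. -/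
theorem maurerCartan_logL (hf : ∀ᶠ y in 𝓝 x, ContMDiffAt 𝓘(𝕜, V) I 2 f y) (u v : V) :
    fderiv 𝕜 (logL I 𝓘(𝕜, V) f) x u v = fderiv 𝕜 (logL I 𝓘(𝕜, V) f) x v u -
      lieBilin I G (logL I 𝓘(𝕜, V) f x u) (logL I 𝓘(𝕜, V) f x v) := by
  have hfx := hf.self_of_nhds
  have hd (v : V) := logL_apply (hfx.mdifferentiableAt two_ne_zero) v
  -- Left division does not change under left translation, hence the choice of the left translate by
  -- f(x)⁻¹.
  have := maurerCartan_inCharts (f := f) (contMDiff_words I 2).2.1 (inv_mul_cancel (1 : G))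
    (g := fun y => (f x)⁻¹ * f y) (contMDiffAt_const.mul hfx) (inv_mul_cancel _)
    (fun y z => by simp [leftDivWord]) u v
  rw [← (logL_eventuallyEq (hf.mono fun y hy => hy.of_le one_le_two)).fderiv_eq,
    (leftDivWord_unit I G _ _).2, (leftDivWord_unit I G _ _).2, ← hd, ← hd] at this
  rw [lieBilin_apply, sub_eq_iff_eq_add'.mp this]
  abel

/-- The Maurer-Cartan equation for the right invariant form. -/
theorem maurerCartan_logR (hf : ∀ᶠ y in 𝓝 x, ContMDiffAt 𝓘(𝕜, V) I 2 f y) (u v : V) :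
    fderiv 𝕜 (logR I 𝓘(𝕜, V) f) x u v = fderiv 𝕜 (logR I 𝓘(𝕜, V) f) x v u +
      lieBilin I G (logR I 𝓘(𝕜, V) f x u) (logR I 𝓘(𝕜, V) f x v) := by
  have hfx := hf.self_of_nhds
  have hd (v : V) := logR_apply (hfx.mdifferentiableAt two_ne_zero) v
  have := maurerCartan_inCharts (f := f) (contMDiff_words I 2).2.2.1 (mul_inv_cancel (1 : G))
    (g := fun y => f y * (f x)⁻¹) (hfx.mul contMDiffAt_const) (mul_inv_cancel _)
    (fun y z => by simp [rightDivWord]) u v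
  rw [← (logR_eventuallyEq (hf.mono fun y hy => hy.of_le one_le_two)).fderiv_eq,
    (rightDivWord_unit I G _ _).2, (rightDivWord_unit I G _ _).2, ← hd, ← hd] at this
  rw [lieBilin_apply, sub_eq_iff_eq_add'.mp this]
  abel

end LogarithmicCharts

/-! ### Homomorphisms, the adjoint action and invariance of the form. -/

section LieAlgebra
variable {𝕜 : Type*} [RCLike 𝕜] {E : Type*} [NormedAddCommGroup E] [NormedSpace 𝕜 E]
  {H : Type*} [TopologicalSpace H] {I : ModelWithCorners 𝕜 E H} [I.Boundaryless]
  {G : Type*} [TopologicalSpace G] [ChartedSpace H G] [Group G]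

section Hom
variable [LieGroup I ∞ G]
  {F : Type*} [NormedAddCommGroup F] [NormedSpace 𝕜 F]
  {H' : Type*} [TopologicalSpace H'] {J : ModelWithCorners 𝕜 F H'} [J.Boundaryless]
  {K : Type*} [TopologicalSpace K] [ChartedSpace H' K] [Group K] [LieGroup J ∞ K]

/-- The derivative at the unit of a homomorphism of Lie groups is a homomorphism of Lie
algebras. -/
theorem tderiv_lieBilin {φ : G → K} (hφ : ContMDiffAt I J 2 φ 1)
    (hm : ∀ a b, φ (a * b) = φ a * φ b) (X Y : E) :
    tderiv I J φ 1 (lieBilin I G X Y) =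
      lieBilin J K (tderiv I J φ 1 X) (tderiv I J φ 1 Y) := by
  have h₁ : φ 1 = 1 := by
    have := hm 1 1
    rwa [mul_one, left_eq_mul] at this
  have hc : ContMDiffAt 𝓘(𝕜, E) I 2 (extChartAt I (1 : G)).symm (unitCoord I G) :=
    contMDiffAt_extChartAt_symm (mem_extChartAt_target _)
  have hφ' : ContMDiffAt I J 2 φ ((extChartAt I (1 : G)).symm (unitCoord I G)) := by
    rwa [symm_unitCoord]
  have hs : φ ((extChartAt I (1 : G)).symm (unitCoord I G)) ∈ (chartAt H' (1 : K)).source := by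
    rw [symm_unitCoord, h₁]
    exact mem_chart_source H' 1
  set ψ : E → F := fun y => extChartAt J (1 : K) (φ ((extChartAt I (1 : G)).symm y)) with hψ
  have hψc : ContDiffAt 𝕜 2 ψ (unitCoord I G) := contMDiffAt_iff_contDiffAt.mp
    (ContMDiffAt.comp (unitCoord I G)
    (g := fun a => extChartAt J (1 : K) (φ a)) (f := (extChartAt I (1 : G)).symm)
    ((contMDiffAt_extChartAt' hs).comp _ hφ') hc)
  have hd : tderiv I J φ 1 = fderiv 𝕜 ψ (unitCoord I G) :=
    mfderiv_eq_fderiv_charts (hφ.mdifferentiableAt two_ne_zero) h₁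
  have hev : ∀ᶠ y in 𝓝 (unitCoord I G), (extChartAt J (1 : K)).symm (ψ y) =
      φ ((extChartAt I (1 : G)).symm y) := by
    have := (hφ'.comp (unitCoord I G) hc).continuousAt.eventually
      ((isOpen_extChartAt_source (I := J) (1 : K)).mem_nhds (by rw [extChartAt_source]; exact hs))
    filter_upwards [this] with y hy
    exact (extChartAt J (1 : K)).left_inv hy
  have hψm : ∀ᶠ p in 𝓝 (unitCoord I G, unitCoord I G), ψ (inUnitChart I (mulWord G) p) =
      inUnitChart J (mulWord K) (ψ p.1, ψ p.2) := by
    filter_upwards [eventually_unit I (contMDiff_words (G := G) I 2).1 (mul_one 1),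
      (hev.prod_mk hev).filter_mono nhds_prod_eq.le] with p hp hp'
    change extChartAt J 1 (φ ((extChartAt I 1).symm (inUnitChart I (mulWord G) p))) =
      extChartAt J 1 (mulWord K ((extChartAt J 1).symm (ψ p.1), (extChartAt J 1).symm (ψ p.2)))
    rw [symm_inCharts hp, hp'.1, hp'.2, mulWord, hm, mulWord]
  have key := (isLocalMul I G).fderiv_mixed_of_hom (isLocalMul J K) hψc
    (by simp only [hψ, symm_unitCoord, h₁]) hψm
  -- The second derivative of φ in the charts is symmetric and cancels in the skew part.
  rw [hd, lieBilin_apply, lieBilin_apply, map_sub, ← key X Y, ← key Y X, sndDeriv_symm hψc X Y]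
  abel

theorem adE_lieBilin (g : G) (X Y : E) :
    adE I g (lieBilin I G X Y) = lieBilin I G (adE I g X) (adE I g Y) :=
  tderiv_lieBilin (φ := fun h => g * h * g⁻¹)
    ((contMDiffAt_const.mul contMDiffAt_id).mul contMDiffAt_const) (fun a b => by group) X Y

theorem fst_lieBilin (X Y : E × E) :
    (lieBilin (I.prod I) (G × G) X Y).1 = lieBilin I G X.1 Y.1 := by
  have := tderiv_lieBilin (I := I.prod I) (J := I) (φ := (Prod.fst : G × G → G)) contMDiffAt_fst (fun _ _ => rfl) X Y
  rwa [tderiv_fst, tderiv_fst, tderiv_fst] at this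

theorem snd_lieBilin (X Y : E × E) :
    (lieBilin (I.prod I) (G × G) X Y).2 = lieBilin I G X.2 Y.2 := by
  have := tderiv_lieBilin (I := I.prod I) (J := I) (φ := (Prod.snd : G × G → G)) contMDiffAt_snd (fun _ _ => rfl) X Y
  rwa [tderiv_snd, tderiv_snd, tderiv_snd] at this

end Hom

variable [LieGroup I ∞ G] {B : LinearMap.BilinForm 𝕜 (GroupLieAlgebra I G)}

/-- The derivative of the adjoint action is the Lie bracket. -/
theorem hasFDerivAt_adE (Z X : E) :
    ∃ A : E →L[𝕜] E, HasFDerivAt (fun y => adE I ((extChartAt I (1 : G)).symm y) X) A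
      (unitCoord I G) ∧ A Z = lieBilin I G Z X := by
  have hw := (contMDiff_words (G := G) I 2).2.2.2
  have h₁ : conjWord G (1, 1) = 1 := by simp [conjWord]
  have hν := contDiffAt_unit I hw h₁
  -- In coordinates Ad is the derivative of conjugation in the conjugated variable at the unit, so
  -- its own derivative is a mixed second derivative.
  have hev : (fun y => adE I ((extChartAt I (1 : G)).symm y) X) =ᶠ[𝓝 (unitCoord I G)]
      fun y => fderiv 𝕜 (inUnitChart I (conjWord G)) (y, unitCoord I G) (0, X) := by
    filter_upwards [extChartAt_target_mem_nhds (I := I) (1 : G)] with y hy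
    have hμy : ContDiffAt 𝕜 1 (inUnitChart I (conjWord G)) (y, unitCoord I G) := by
      refine contDiffAt_inCharts (contMDiff_words I 1).2.2.2 (contMDiffAt_extChartAt_symm hy)
        (contMDiffAt_extChartAt_symm (mem_extChartAt_target _)) ?_
      simp only [symm_unitCoord, conjWord, mul_one, mul_inv_cancel]
      exact mem_extChartAt_source _
    have e₂ := mfderiv_eq_fderiv_charts (I := I) (q := 1)
      (mdifferentiable_conj ((extChartAt I (1 : G)).symm y) (1 : G)) (p := 1) (by simp)
    have e₃ := ((hμy.differentiableAt one_ne_zero).hasFDerivAt.comp (f := fun z => (y, z))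
      (unitCoord I G) (hasFDerivAt_prodMk_right y (unitCoord I G))).fderiv
    exact (DFunLike.congr_fun e₂ X).trans (DFunLike.congr_fun e₃ X)
  have h := (((differentiableAt_fderiv hν).hasFDerivAt.comp
    (f := fun y => (y, unitCoord I G)) (unitCoord I G)
    (hasFDerivAt_prodMk_left (unitCoord I G) (unitCoord I G))).clm_apply
    (hasFDerivAt_const ((0, X) : E × E) (unitCoord I G)))
  refine ⟨_, HasFDerivAt.congr_of_eventuallyEq h hev, ?_⟩
  rw [← (conjWord_unit I G Z X).2, mixed_apply]
  simp

/-- The function g ↦ (Ad(g)X) • (Ad(g)Z) is constant; its derivative at the unit in the direction Y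
gives [Y, X] • Z + X • [Y, Z] = 0. -/
theorem formE_lieBilin [FiniteDimensional 𝕜 E] (hB : IsAdInvariant B) (X Y Z : E) :
    formE B (lieBilin I G X Y) Z = formE B X (lieBilin I G Y Z) := by
  obtain ⟨A₁, h₁, e₁⟩ := hasFDerivAt_adE (I := I) (G := G) Y X
  obtain ⟨A₂, h₂, e₂⟩ := hasFDerivAt_adE (I := I) (G := G) Y Z
  have h := (formE B).toContinuousBilinearMap.hasFDerivAt_of_bilinear h₁ h₂
  have hc : (fun y => (formE B).toContinuousBilinearMap
      (adE I ((extChartAt I (1 : G)).symm y) X) (adE I ((extChartAt I (1 : G)).symm y) Z)) =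
      fun _ => formE B X Z := by
    ext y
    exact formE_adE_adE hB _ X Z
  rw [hc] at h
  have := DFunLike.congr_fun (h.unique (hasFDerivAt_const _ _)) Y
  have h' : formE B (adE I ((extChartAt I (1 : G)).symm (unitCoord I G)) X) (A₂ Y) +
      formE B (A₁ Y) (adE I ((extChartAt I (1 : G)).symm (unitCoord I G)) Z) = 0 := this
  rw [symm_unitCoord, adE_one, adE_one, e₁, e₂, lieBilin_swap Y X, map_neg,
    LinearMap.neg_apply] at h'
  linear_combination -h'

end LieAlgebra

/-! ### Exterior derivative of α • β on a vector space. -/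

section Wedge
variable {𝕜 : Type*} [RCLike 𝕜] {E : Type*} [NormedAddCommGroup E] [NormedSpace 𝕜 E]
  [FiniteDimensional 𝕜 E]
  {H : Type*} [TopologicalSpace H] {I : ModelWithCorners 𝕜 E H}
  {G : Type*} [TopologicalSpace G] [ChartedSpace H G] [Group G]
  {V : Type*} [NormedAddCommGroup V] [NormedSpace 𝕜 V]
  {B : LinearMap.BilinForm 𝕜 (GroupLieAlgebra I G)}

variable (B) in
/-- The `2`-form `α • β`, on the model vector space. -/
def wedgeE (α β : V →L[𝕜] E) : V [⋀^Fin 2]→L[𝕜] 𝕜 := wedge B α β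

theorem wedgeE_apply (α β : V →L[𝕜] E) (v : Fin 2 → V) :
    wedgeE B α β v = formE B (α (v 0)) (β (v 1)) - formE B (α (v 1)) (β (v 0)) := rfl

theorem contDiffAt_wedgeE [FiniteDimensional 𝕜 V] {n : ℕ∞ω} {α β : V → V →L[𝕜] E} {x : V}
    (hα : ContDiffAt 𝕜 n α x) (hβ : ContDiffAt 𝕜 n β x) :
    ContDiffAt 𝕜 n (fun y => wedgeE B (α y) (β y)) x := by
  -- The map (α, β) ↦ α • β is bilinear between finite-dimensional spaces, hence continuous and of
  -- every class.
  have hb : IsBilinearMap 𝕜 fun α β : V →L[𝕜] E => wedgeE B α β := by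
    constructor <;> intros <;> ext v <;>
      simp only [wedgeE_apply, ContinuousAlternatingMap.add_apply,
        ContinuousAlternatingMap.smul_apply, _root_.add_apply,
        _root_.smul_apply, map_add, map_smul, LinearMap.add_apply,
        LinearMap.smul_apply, smul_eq_mul] <;> ring
  exact (hb.toContinuousBilinearMap.contDiff.contDiffAt.comp x hα).clm_apply hβ

theorem extDeriv_wedgeE [FiniteDimensional 𝕜 V] {α β : V → V →L[𝕜] E} {x : V}
    (hα : ContDiffAt 𝕜 1 α x) (hβ : ContDiffAt 𝕜 1 β x) {dα dβ : V → V → E}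
    (hdα : ∀ u v, fderiv 𝕜 α x u v = fderiv 𝕜 α x v u + dα u v)
    (hdβ : ∀ u v, fderiv 𝕜 β x u v = fderiv 𝕜 β x v u + dβ u v) (v : Fin 3 → V) :
    extDeriv (fun y => wedgeE B (α y) (β y)) x v =
      formE B (dα (v 0) (v 1)) (β x (v 2)) - formE B (dα (v 0) (v 2)) (β x (v 1)) +
        formE B (dα (v 1) (v 2)) (β x (v 0)) -
      (formE B (α x (v 2)) (dβ (v 0) (v 1)) - formE B (α x (v 1)) (dβ (v 0) (v 2)) +
        formE B (α x (v 0)) (dβ (v 1) (v 2))) := by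
  have hα' := hα.differentiableAt one_ne_zero
  have hβ' := hβ.differentiableAt one_ne_zero
  have key (s t : V) : HasFDerivAt (fun y => formE B (α y s) (β y t)) _ x :=
    (formE B).toContinuousBilinearMap.hasFDerivAt_of_bilinear
      (hα'.hasFDerivAt.clm_apply (hasFDerivAt_const s x))
      (hβ'.hasFDerivAt.clm_apply (hasFDerivAt_const t x))
  have hd (w : Fin 2 → V) (u : V) : fderiv 𝕜 (fun y => wedgeE B (α y) (β y) w) x u =
      formE B (fderiv 𝕜 α x u (w 0)) (β x (w 1)) + formE B (α x (w 0)) (fderiv 𝕜 β x u (w 1)) -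
      (formE B (fderiv 𝕜 α x u (w 1)) (β x (w 0)) +
        formE B (α x (w 1)) (fderiv 𝕜 β x u (w 0))) := by
    simp only [wedgeE_apply]
    rw [fderiv_fun_sub (key (w 0) (w 1)).differentiableAt (key (w 1) (w 0)).differentiableAt,
      (key (w 0) (w 1)).fderiv, (key (w 1) (w 0)).fderiv]
    simp only [_root_.sub_apply, _root_.add_apply,
      ContinuousLinearMap.precompR_apply, ContinuousLinearMap.precompL_apply,
      ContinuousLinearMap.comp_zero, zero_add,
      ContinuousLinearMap.flip_apply, ContinuousLinearMap.compL_apply,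
      ContinuousLinearMap.comp_apply, LinearMap.toContinuousBilinearMap_apply]
    ring
  rw [extDeriv_apply ((contDiffAt_wedgeE hα hβ).differentiableAt one_ne_zero)]
  simp only [hd]
  refine (Fin.sum_univ_three _).trans ?_
  -- Constant vector fields commute, so the terms `kα` and `kβ` are zero.
  rw [← wedge_extDeriv (E := formE B) (α := fun i => α x (v i)) (β := fun i => β x (v i))
    (Dα := fun i j => fderiv 𝕜 α x (v i) (v j)) (Dβ := fun i j => fderiv 𝕜 β x (v i) (v j))
    (kα := 0) (kβ := 0) (dα := fun i j => dα (v i) (v j)) (dβ := fun i j => dβ (v i) (v j))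
    (by simp [← hdα]) (by simp [← hdβ])]
  have e : (Fin.succAbove (1 : Fin 3) (0 : Fin 2)) = 0 := rfl
  have e' : (Fin.succAbove (2 : Fin 3) (1 : Fin 2)) = 1 := rfl
  simp [Fin.removeNth, e, e']
  ring

end Wedge

/-! ### The Cartan form through logarithmic derivatives. -/

section Cartan
variable {𝕜 : Type*} [RCLike 𝕜] {E : Type*} [NormedAddCommGroup E] [NormedSpace 𝕜 E]
  {H : Type*} [TopologicalSpace H] {I : ModelWithCorners 𝕜 E H} [I.Boundaryless]
  {G : Type*} [TopologicalSpace G] [ChartedSpace H G] [Group G] [LieGroup I ∞ G]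
  {B : LinearMap.BilinForm 𝕜 (GroupLieAlgebra I G)}
  {E' : Type*} [NormedAddCommGroup E'] [NormedSpace 𝕜 E']
  {H' : Type*} [TopologicalSpace H'] {J : ModelWithCorners 𝕜 E' H'}
  {M : Type*} [TopologicalSpace M] [ChartedSpace H' M]

theorem cartanForm_logL (f : M → G) (m : M) (v : Fin 3 → E') :
    cartanForm B (f m) (fun i => tderiv J I f m (v i)) =
      (1 / 12) * ∑ π : Equiv.Perm (Fin 3), ((Equiv.Perm.sign π : ℤ) : 𝕜) *
        formE B (lieBilin I G (logL I J f m (v (π 0))) (logL I J f m (v (π 1))))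
          (logL I J f m (v (π 2))) :=
  congrArg _ (Finset.sum_congr rfl fun _ _ => congrArg _
    (congrArg (fun X : E => formE B X _) (bracket_eq_lieBilin _ _)))

end Cartan

/-! ### The double of a Lie group: regularity and quasi-closedness. -/

section Double
variable {𝕜 : Type*} [RCLike 𝕜] {E : Type*} [NormedAddCommGroup E] [NormedSpace 𝕜 E]
  [FiniteDimensional 𝕜 E]
  {H : Type*} [TopologicalSpace H] {I : ModelWithCorners 𝕜 E H} [I.Boundaryless]
  {G : Type*} [TopologicalSpace G] [ChartedSpace H G] [Group G]
  {B : LinearMap.BilinForm 𝕜 (GroupLieAlgebra I G)} {q : G × G} {y : E × E}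

variable (I q) in
/-- The first component of the inverse of the chart at `q`. -/
def chartFst (y : E × E) : G := ((extChartAt (I.prod I) q).symm y).1

variable (I q) in
/-- The second component of the inverse of the chart at `q`. -/
def chartSnd (y : E × E) : G := ((extChartAt (I.prod I) q).symm y).2

theorem eventually_contMDiffAt_chartFst {n : ℕ∞ω} [IsManifold I n G]
    (hy : y ∈ (extChartAt (I.prod I) q).target) :
    ∀ᶠ z in 𝓝 y, ContMDiffAt 𝓘(𝕜, E × E) I n (chartFst I q) z := by
  filter_upwards [extChartAt_target_mem_nhds' hy] with z hz
  exact contMDiffAt_fst.comp z (contMDiffAt_extChartAt_symm hz)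

theorem eventually_contMDiffAt_chartSnd {n : ℕ∞ω} [IsManifold I n G]
    (hy : y ∈ (extChartAt (I.prod I) q).target) :
    ∀ᶠ z in 𝓝 y, ContMDiffAt 𝓘(𝕜, E × E) I n (chartSnd I q) z := by
  filter_upwards [extChartAt_target_mem_nhds' hy] with z hz
  exact contMDiffAt_snd.comp z (contMDiffAt_extChartAt_symm hz)

variable (B q) in
/-- The local expression of the form `σ^×` in the chart at `q`. -/
def doubleChart (y : E × E) : (E × E) [⋀^Fin 2]→L[𝕜] 𝕜 :=
  (-(1 / 2) : 𝕜) •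
    (wedgeE B (logL I 𝓘(𝕜, E × E) (chartFst I q) y) (logR I 𝓘(𝕜, E × E) (chartSnd I q) y) +
      wedgeE B (logR I 𝓘(𝕜, E × E) (chartFst I q) y) (logL I 𝓘(𝕜, E × E) (chartSnd I q) y))

/-- Pulling back a logarithmic derivative gives that of the composite, so in a chart σ^× is built
from the two components of the inverse chart. -/
theorem inChart_doubleForm [LieGroup I ∞ G] (hy : y ∈ (extChartAt (I.prod I) q).target) :
    (doubleForm B).inChart q y = doubleChart B q y := by
  have hc : MDifferentiableAt 𝓘(𝕜, E × E) (I.prod I) (extChartAt (I.prod I) q).symm y :=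
    (contMDiffAt_extChartAt_symm (n := 1) hy).mdifferentiableAt one_ne_zero
  have hr : mfderivWithin 𝓘(𝕜, E × E) (I.prod I) (extChartAt (I.prod I) q).symm
      (range (I.prod I)) y =
      tderiv 𝓘(𝕜, E × E) (I.prod I) (extChartAt (I.prod I) q).symm y := by
    rw [(I.prod I).range_eq_univ, mfderivWithin_univ]
    rfl
  rw [FormField.inChart, hr]
  ext v
  change doubleFormE B ((extChartAt (I.prod I) q).symm y)
    (fun i => tderiv 𝓘(𝕜, E × E) (I.prod I) (extChartAt (I.prod I) q).symm y (v i)) =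
      (-(1 / 2) : 𝕜) * (_ + _)
  have e₁ (w : E × E) := logL_comp (I := I) mdifferentiableAt_fst hc rfl w
  have e₂ (w : E × E) := logL_comp (I := I) mdifferentiableAt_snd hc rfl w
  have e₃ (w : E × E) := logR_comp (I := I) mdifferentiableAt_fst hc rfl w
  have e₄ (w : E × E) := logR_comp (I := I) mdifferentiableAt_snd hc rfl w
  rw [doubleFormE_apply, omega₁, omega₂, omegaBar₁, omegaBar₂, e₁, e₁, e₂, e₂, e₃, e₃, e₄, e₄]
  rfl

section Smooth
variable {n : ℕ∞ω} (hn : ∞ ≤ n) [LieGroup I n G] [LieGroup I ∞ G]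
include hn

/-- Only ∞ and the analytic class remain, and both absorb one lost derivative. -/
theorem add_one_le_of_infty_le : n + 1 ≤ n := by
  induction n using WithTop.recTopCoe with
  | top => exact le_top
  | coe a =>
    obtain rfl : a = ⊤ := top_le_iff.mp (WithTop.coe_le_coe.mp hn)
    exact le_rfl

theorem contDiffAt_logL {V : Type*} [NormedAddCommGroup V] [NormedSpace 𝕜 V] {f : V → G} {x : V}
    (hf : ∀ᶠ y in 𝓝 x, ContMDiffAt 𝓘(𝕜, V) I n f y) :
    ContDiffAt 𝕜 n (logL I 𝓘(𝕜, V) f) x :=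
  (contDiffAt_fderiv_inCharts (add_one_le_of_infty_le hn) (contMDiff_words I n).2.1
    hf.self_of_nhds (inv_mul_cancel _)).congr_of_eventuallyEq
      (logL_eventuallyEq (hf.mono fun _ h => h.of_le (le_trans (by simp) hn)))

theorem contDiffAt_logR {V : Type*} [NormedAddCommGroup V] [NormedSpace 𝕜 V] {f : V → G} {x : V}
    (hf : ∀ᶠ y in 𝓝 x, ContMDiffAt 𝓘(𝕜, V) I n f y) :
    ContDiffAt 𝕜 n (logR I 𝓘(𝕜, V) f) x :=
  (contDiffAt_fderiv_inCharts (add_one_le_of_infty_le hn) (contMDiff_words I n).2.2.1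
    hf.self_of_nhds (mul_inv_cancel _)).congr_of_eventuallyEq
      (logR_eventuallyEq (hf.mono fun _ h => h.of_le (le_trans (by simp) hn)))

theorem isOfClass_doubleForm : (doubleForm B).IsOfClass n := by
  intro q y hy
  have hc : ContDiffAt 𝕜 n (doubleChart B q) y :=
    ((contDiffAt_wedgeE (contDiffAt_logL hn (eventually_contMDiffAt_chartFst hy))
      (contDiffAt_logR hn (eventually_contMDiffAt_chartSnd hy))).add
    (contDiffAt_wedgeE (contDiffAt_logR hn (eventually_contMDiffAt_chartFst hy))
      (contDiffAt_logL hn (eventually_contMDiffAt_chartSnd hy)))).const_smul _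
  exact hc.contDiffWithinAt.congr (fun z hz => inChart_doubleForm hz) (inChart_doubleForm hy)

end Smooth

variable [LieGroup I ∞ G]

/-- The tangent space at `q` is identified with the model space by the preferred chart at `q`, whose
derivative at `q` is therefore the identity. -/
theorem tderiv_extChartAt_symm (q : G × G) (v : E × E) :
    tderiv 𝓘(𝕜, E × E) (I.prod I) (extChartAt (I.prod I) q).symm (extChartAt (I.prod I) q q) v =
      v := by
  have h := mfderivWithin_range_extChartAt_symm (I := I.prod I) (x := q)
  rw [(I.prod I).range_eq_univ, mfderivWithin_univ] at h
  exact DFunLike.congr_fun h v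

section Base
variable (q : G × G) (v : E × E)

theorem mdifferentiableAt_extChartAt_symm : MDifferentiableAt 𝓘(𝕜, E × E) (I.prod I)
    (extChartAt (I.prod I) q).symm (extChartAt (I.prod I) q q) :=
  (contMDiffAt_extChartAt_symm (n := 1) (mem_extChartAt_target _)).mdifferentiableAt one_ne_zero

theorem logL_chartFst :
    logL I 𝓘(𝕜, E × E) (chartFst I q) (extChartAt (I.prod I) q q) v = omega₁ I q v := by
  have := logL_comp (I := I) mdifferentiableAt_fst (mdifferentiableAt_extChartAt_symm (I := I) q)
    (extChartAt_to_inv q) v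
  rw [tderiv_extChartAt_symm] at this
  exact this.symm

theorem logL_chartSnd :
    logL I 𝓘(𝕜, E × E) (chartSnd I q) (extChartAt (I.prod I) q q) v = omega₂ I q v := by
  have := logL_comp (I := I) mdifferentiableAt_snd (mdifferentiableAt_extChartAt_symm (I := I) q)
    (extChartAt_to_inv q) v
  rw [tderiv_extChartAt_symm] at this
  exact this.symm

theorem logR_chartFst :
    logR I 𝓘(𝕜, E × E) (chartFst I q) (extChartAt (I.prod I) q q) v = omegaBar₁ I q v := by
  have := logR_comp (I := I) mdifferentiableAt_fst (mdifferentiableAt_extChartAt_symm (I := I) q)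
    (extChartAt_to_inv q) v
  rw [tderiv_extChartAt_symm] at this
  exact this.symm

theorem logR_chartSnd :
    logR I 𝓘(𝕜, E × E) (chartSnd I q) (extChartAt (I.prod I) q q) v = omegaBar₂ I q v := by
  have := logR_comp (I := I) mdifferentiableAt_snd (mdifferentiableAt_extChartAt_symm (I := I) q)
    (extChartAt_to_inv q) v
  rw [tderiv_extChartAt_symm] at this
  exact this.symm

end Base

theorem extDeriv_doubleForm (q : G × G) (v : Fin 3 → E × E) :
    (doubleForm B).extDeriv q v =
      extDeriv (doubleChart B q) (extChartAt (I.prod I) q q) v := by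
  have h₁ : (fun i => mfderiv (I.prod I) 𝓘(𝕜, E × E) (extChartAt (I.prod I) q) q (v i)) = v := by
    ext1 i
    exact DFunLike.congr_fun (mfderiv_extChartAt_self (I := I.prod I) (x := q)) (v i)
  have h₂ : (doubleForm B).inChart q =ᶠ[𝓝 (extChartAt (I.prod I) q q)] doubleChart B q := by
    filter_upwards [extChartAt_target_mem_nhds (I := I.prod I) q] with y hy
    exact inChart_doubleForm hy
  have h₃ : extDerivWithin ((doubleForm B).inChart q) (range (I.prod I))
      (extChartAt (I.prod I) q q) = extDeriv (doubleChart B q) (extChartAt (I.prod I) q q) := by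
    rw [(I.prod I).range_eq_univ, extDerivWithin_univ, h₂.extDeriv_eq]
  exact (congrArg (extDerivWithin ((doubleForm B).inChart q) (range (I.prod I))
      (extChartAt (I.prod I) q q)) h₁).trans (DFunLike.congr_fun h₃ v)

theorem extDeriv_doubleChart (hs : B.IsSymm) (hB : IsAdInvariant B) (q : G × G)
    (v : Fin 3 → E × E) :
    extDeriv (doubleChart B q) (extChartAt (I.prod I) q q) v = (1 / 2 : 𝕜) *
      (formE B (lieBilin I G (omega₁ I q (v 0) + omegaBar₂ I q (v 0))
          (omega₁ I q (v 1) + omegaBar₂ I q (v 1))) (omega₁ I q (v 2) + omegaBar₂ I q (v 2)) -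
        formE B (lieBilin I G (omegaBar₁ I q (v 0) + omega₂ I q (v 0))
          (omegaBar₁ I q (v 1) + omega₂ I q (v 1))) (omegaBar₁ I q (v 2) + omega₂ I q (v 2))) := by
  have hx : extChartAt (I.prod I) q q ∈ (extChartAt (I.prod I) q).target := mem_extChartAt_target _
  have l₁ := (contDiffAt_logL le_rfl (eventually_contMDiffAt_chartFst (I := I) hx)).of_le
    (m := 1) (by simp)
  have l₂ := (contDiffAt_logL le_rfl (eventually_contMDiffAt_chartSnd (I := I) hx)).of_le
    (m := 1) (by simp)
  have r₁ := (contDiffAt_logR le_rfl (eventually_contMDiffAt_chartFst (I := I) hx)).of_le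
    (m := 1) (by simp)
  have r₂ := (contDiffAt_logR le_rfl (eventually_contMDiffAt_chartSnd (I := I) hx)).of_le
    (m := 1) (by simp)
  have d₁ := maurerCartan_logL (eventually_contMDiffAt_chartFst (I := I) hx)
  have d₂ := maurerCartan_logL (eventually_contMDiffAt_chartSnd (I := I) hx)
  have d₃ := maurerCartan_logR (eventually_contMDiffAt_chartFst (I := I) hx)
  have d₄ := maurerCartan_logR (eventually_contMDiffAt_chartSnd (I := I) hx)
  -- At the centre of the chart the logarithmic derivatives are ωⱼ and ω̄ⱼ; subtraction is turned
  -- into addition to fit the hypotheses of `extDeriv_wedgeE`.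
  simp only [logL_chartFst, logL_chartSnd, logR_chartFst, logR_chartSnd, sub_eq_add_neg]
    at d₁ d₂ d₃ d₄
  have w₁ := extDeriv_wedgeE (B := B) l₁ r₂ d₁ d₄ v
  have w₂ := extDeriv_wedgeE (B := B) r₁ l₂ d₃ d₂ v
  simp only [logL_chartFst, logL_chartSnd, logR_chartFst, logR_chartSnd] at w₁ w₂
  have hw₁ := (contDiffAt_wedgeE (B := B) l₁ r₂).differentiableAt one_ne_zero
  have hw₂ := (contDiffAt_wedgeE (B := B) r₁ l₂).differentiableAt one_ne_zero
  have e : extDeriv (doubleChart B q) (extChartAt (I.prod I) q q) v = (-(1 / 2) : 𝕜) *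
      (extDeriv (fun y => wedgeE B (logL I 𝓘(𝕜, E × E) (chartFst I q) y)
          (logR I 𝓘(𝕜, E × E) (chartSnd I q) y)) (extChartAt (I.prod I) q q) v +
        extDeriv (fun y => wedgeE B (logR I 𝓘(𝕜, E × E) (chartFst I q) y)
          (logL I 𝓘(𝕜, E × E) (chartSnd I q) y)) (extChartAt (I.prod I) q q) v) :=
    DFunLike.congr_fun ((extDeriv_fun_smul _ _).trans
      (congrArg _ (extDeriv_fun_add hw₁ hw₂))) v
  have hc := cartan_identity (E := formE B) (br := lieBilin I G) (formE_symm hs)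
    (fun X Y => lieBilin_swap X Y) (formE_lieBilin hB)
    (a := fun i => omega₁ I q (v i)) (a' := fun i => omegaBar₁ I q (v i))
    (b := fun i => omega₂ I q (v i)) (b' := fun i => omegaBar₂ I q (v i))
    (by simp only [omegaBar₁_eq, ← adE_lieBilin, formE_adE_adE hB])
    (by simp only [omegaBar₂_eq, ← adE_lieBilin, formE_adE_adE hB])
  rw [e, w₁, w₂, hc]
  ring

/-- Form and bracket split into components, each contributing six equal terms. The components are
conjugates of ω₁ + ω̄₂ and -(ω̄₁ + ω₂): conjugation drops out and the sign survives in odd degree.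
-/
theorem sum_bracket_doubleMap (hs : B.IsSymm) (hB : IsAdInvariant B) (q : G × G)
    {x : Fin 3 → E × E} (v : Fin 3 → E × E)
    (hx : ∀ i, x i = logL (I.prod I) (I.prod I) doubleMap q (v i)) :
    ∑ π : Equiv.Perm (Fin 3), ((Equiv.Perm.sign π : ℤ) : 𝕜) *
        formE (sumForm B) (lieBilin (I.prod I) (G × G) (x (π 0)) (x (π 1))) (x (π 2)) = 6 *
      (formE B (lieBilin I G (omega₁ I q (v 0) + omegaBar₂ I q (v 0))
          (omega₁ I q (v 1) + omegaBar₂ I q (v 1))) (omega₁ I q (v 2) + omegaBar₂ I q (v 2)) -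
        formE B (lieBilin I G (omegaBar₁ I q (v 0) + omega₂ I q (v 0))
          (omegaBar₁ I q (v 1) + omega₂ I q (v 1))) (omegaBar₁ I q (v 2) + omega₂ I q (v 2))) := by
  have s := sum_perm_bracket (E := formE B) (br := lieBilin I G) (formE_symm hs)
    (fun X Y => lieBilin_swap X Y) (formE_lieBilin hB)
  have h₁ (i : Fin 3) : (x i).1 = adE I q.2⁻¹ (omega₁ I q (v i) + omegaBar₂ I q (v i)) := by
    rw [hx, fst_logL_doubleMap]
  have h₂ (i : Fin 3) : (x i).2 = -adE I q.2 (omegaBar₁ I q (v i) + omega₂ I q (v i)) := by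
    rw [hx, snd_logL_doubleMap]
  simp only [sumForm_apply, fst_lieBilin, snd_lieBilin, mul_add, Finset.sum_add_distrib]
  rw [s fun i => (x i).1, s fun i => (x i).2]
  simp only [h₁, h₂, map_neg (lieBilin I G), map_neg (lieBilin I G _), map_neg (formE B _),
    map_neg (formE B), LinearMap.neg_apply, ← adE_lieBilin, formE_adE_adE hB]
  ring

theorem cartanForm_doubleMap (hs : B.IsSymm) (hB : IsAdInvariant B) (q : G × G)
    (v : Fin 3 → E × E) :
    cartanForm (sumForm B) (doubleMap q)
      (fun i => tderiv (I.prod I) (I.prod I) doubleMap q (v i)) = (1 / 2 : 𝕜) *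
      (formE B (lieBilin I G (omega₁ I q (v 0) + omegaBar₂ I q (v 0))
          (omega₁ I q (v 1) + omegaBar₂ I q (v 1))) (omega₁ I q (v 2) + omegaBar₂ I q (v 2)) -
        formE B (lieBilin I G (omegaBar₁ I q (v 0) + omega₂ I q (v 0))
          (omegaBar₁ I q (v 1) + omega₂ I q (v 1))) (omegaBar₁ I q (v 2) + omega₂ I q (v 2))) := by
  refine (cartanForm_logL doubleMap q v).trans ?_
  rw [sum_bracket_doubleMap hs hB q v fun _ => rfl]
  ring

theorem isQuasiClosed_double (hs : B.IsSymm) (hB : IsAdInvariant B) :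
    IsQuasiClosed (I.prod I) (I.prod I) (sumForm B) (doubleForm B)
      (doubleMap : G × G → G × G) := fun q v =>
  (extDeriv_doubleForm q v).trans
    ((extDeriv_doubleChart hs hB q v).trans (cartanForm_doubleMap hs hB q v).symm)

theorem isMomentumMap_double {n : ℕ∞ω} (hn : ∞ ≤ n) [LieGroup I n G] (hs : B.IsSymm)
    (hB : IsAdInvariant B) :
    IsMomentumMap (I.prod I) (I.prod I) n doubleAct (sumForm B) (doubleForm B)
      (doubleMap : G × G → G × G) where
  form_class := isOfClass_doubleForm hn
  form_invariant := doubleForm_isInvariant hB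
  map_class := contMDiff_doubleMap
  map_equivariant := doubleMap_isEquivariant
  momentum X q v := doubleForm_momentum hs hB X q v

end Double

end Lie

end QuasiHam

end

/-- The external weakly quasi Hamiltonian double: (1) for smooth or analytic Lie groups over `ℝ` or
`ℂ`; (2) for affine algebraic groups over a field of characteristic zero. -/
theorem proposition4 :
    (∀ (𝕜 : Type*) [RCLike 𝕜] (E : Type*) [NormedAddCommGroup E] [NormedSpace 𝕜 E]
      [FiniteDimensional 𝕜 E] (H : Type*) [TopologicalSpace H] (I : ModelWithCorners 𝕜 E H)
      [I.Boundaryless] (n : ℕ∞ω) (_ : ∞ ≤ n)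
      (G : Type*) [TopologicalSpace G] [ChartedSpace H G] [Group G] [LieGroup I n G]
      (B : LinearMap.BilinForm 𝕜 (GroupLieAlgebra I G)) (_ : B.IsSymm)
      (_ : QuasiHam.Lie.IsAdInvariant B),
      QuasiHam.Lie.IsAction (I.prod I) (I.prod I) n
          (QuasiHam.Lie.doubleAct : G × G → G × G → G × G) ∧
        QuasiHam.Lie.IsMomentumMap (I.prod I) (I.prod I) n QuasiHam.Lie.doubleAct
          (QuasiHam.Lie.sumForm B) (QuasiHam.Lie.doubleForm B) QuasiHam.Lie.doubleMap ∧
        QuasiHam.Lie.IsQuasiClosed (I.prod I) (I.prod I)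
          (QuasiHam.Lie.sumForm B) (QuasiHam.Lie.doubleForm B) QuasiHam.Lie.doubleMap ∧
        (B.Nondegenerate → QuasiHam.Lie.IsNondegenerateRel (I.prod I) (I.prod I)
          (QuasiHam.Lie.doubleForm B) QuasiHam.Lie.doubleMap)) ∧
    (∀ (K : Type*) [Field K] [CharZero K] (A : Type*) [CommRing A] [HopfAlgebra K A]
      [Algebra.FiniteType K A] (B : LinearMap.BilinForm K (QuasiHam.Alg.LieAlg K A K))
      (_ : B.IsSymm) (_ : QuasiHam.Alg.IsAdInvariant B),
      QuasiHam.Alg.IsMomentumMap (QuasiHam.Alg.doubleAction K A)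
          (QuasiHam.Alg.sumForm B) (QuasiHam.Alg.doubleForm B) (QuasiHam.Alg.doubleMap K A) ∧
        QuasiHam.Alg.IsQuasiClosed
          (QuasiHam.Alg.sumForm B) (QuasiHam.Alg.doubleForm B) (QuasiHam.Alg.doubleMap K A) ∧
        (B.Nondegenerate → QuasiHam.Alg.IsNondegenerateRel
          (QuasiHam.Alg.doubleForm B) (QuasiHam.Alg.doubleMap K A))) := by
  refine ⟨?_, ?_⟩
  · intro 𝕜 _ E _ _ _ H _ I _ n hn G _ _ _ _ B hs hB
    -- The analytic case is also smooth, which is all that the structure equations require; the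
    -- class `n` itself matters only for the regularity of the action, of Φ and of σ^×.
    have : LieGroup I ∞ G := .of_le hn
    exact ⟨QuasiHam.Lie.doubleAct_isAction, QuasiHam.Lie.isMomentumMap_double hn hs hB,
      QuasiHam.Lie.isQuasiClosed_double hs hB, QuasiHam.Lie.isNondegenerateRel_double hB⟩
  · intro K _ _ A _ _ _ B hs hB
    exact ⟨QuasiHam.Alg.isMomentumMap_double hs hB, QuasiHam.Alg.isQuasiClosed_double hs hB,
      QuasiHam.Alg.isNondegenerateRel_double hs hB⟩
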